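/- Consider the problem $$(\mathrm{IQP})\qquad \min\Big\{\sum_{i=1}^{k} -q_i x_i^2 + h^\top x \;:\; Wx\le w,\ x\in\mathbb Z^n\Big\},$$ where $k\le n$, $W\in\mathbb Z^{m\times n}$, $w\in\mathbb Z^m$, $q\in\mathbb Z^k_{>0}$, $h\in\mathbb Z^n$, and let $\Delta$ be the largest absolute value of a subdeterminant of $W$. Let $f$ be the objective function. If the problem has an optimal solution $x^*$, a feasible point $x^\diamond$ is an $\epsilon$-approximate solution if, for the maximum value $f_{\max}$ of $f$ on the feasible region, either $f(x^*)=f_{\max}$, or $f(x^*)<f_{\max}$ and $\frac{f(x^\diamond)-f(x^*)}{f_{\max}-f(x^*)}\le\epsilon$ (if $f$ has no upper bound on the feasible region, every feasible point is an $\epsilon$-approximate solution). There is a polynomial $p$ such that for every real $\epsilon\in(0,1]$ there is an algorithm, with access to an arbitrary solver for integer linear programs (ILPs), which, given an instance of (IQP) together with its $\Delta$, finds an $\epsilon$-approximate solution if (IQP) has an optimal solution, and otherwise correctly reports that (IQP) is infeasible or that it is unbounded. It does so by solving at most $$N:=\left(3+\left\lceil\sqrt{k\left((2n\Delta)^2+\tfrac1\epsilon\right)}\right\rceil\right)^k$$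 ILPs. Each of these ILPs has size at most $p(\text{size of (IQP)})$, integral data, at most $n$ variables, at most $m$ linear inequalities and possibly additional variable bounds, and a constraint matrix (including the rows of the variable bounds) with subdeterminants bounded by $\Delta$ in absolute value. The running time of the algorithm (on a random access machine with logarithmic costs, the solver's own work not being counted) is at most $p$ evaluated at the sum of the size of (IQP), $N$, and the total size of the answers returned by the solver. -/

import Mathlib

open scoped Matrix

noncomputable section

namespace ConcaveIQP

/-! ## Encoding length, subdeterminants -/

/-- The binary encoding length of an integer, sign included. -/
def bitLen (z : ℤ) : ℕ := z.natAbs.size + 1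

/-- The largest absolute value of the determinant of a square (nonempty) submatrix of `A`.
Selections of rows and columns with repetitions are harmless: they give determinant `0`. -/
def maxSubdet {ι κ : Type} [Fintype ι] [Fintype κ] (A : Matrix ι κ ℤ) : ℕ :=
  (Finset.range (min (Fintype.card ι) (Fintype.card κ))).sup fun r =>
    Finset.univ.sup fun p : (Fin (r + 1) → ι) × (Fin (r + 1) → κ) =>
      ((A.submatrix p.1 p.2).det).natAbs

/-! ## Minimization problems -/

/-- The problem of minimizing `f` over `F` is unbounded: `f` takes arbitrarily small values. -/
def UnboundedBelow {α : Type} (f : α → ℤ) (F : Set α) : Prop :=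
  ∀ B : ℤ, ∃ x ∈ F, f x < B

/-- `x` is an optimal solution to the problem of minimizing `f` over `F`. -/
def IsOptimal {α : Type} (f : α → ℤ) (F : Set α) (x : α) : Prop :=
  x ∈ F ∧ ∀ y ∈ F, f x ≤ f y

/-- `x` is an `ε`-approximate solution to the problem of minimizing `f` over `F`: the problem has
an optimal solution `xs`, `x` is feasible, and, for the maximum value `M` of `f` on `F`,
either `f xs = M`, or `f xs < M` and `(f x - f xs) / (M - f xs) ≤ ε`.
(If `f` has no upper bound on `F`, then every feasible point is an `ε`-approximate solution.) -/
def IsApproxSolution {α : Type} (ε : ℝ) (f : α → ℤ) (F : Set α) (x : α) : Prop :=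
  x ∈ F ∧ ∃ xs, IsOptimal f F xs ∧
    ∀ M : ℤ, IsGreatest (f '' F) M →
      f xs = M ∨ (f xs < M ∧ ((f x : ℝ) - f xs) / ((M : ℝ) - f xs) ≤ ε)

/-- What a solver may return on a problem in `n` integer variables. -/
inductive Answer (n : ℕ) where
  | infeasible : Answer n
  | unbounded : Answer n
  | point (x : Fin n → ℤ) : Answer n

/-- The encoding length of an answer. -/
def Answer.size {n : ℕ} : Answer n → ℕ
  | .infeasible => 1
  | .unbounded => 1
  | .point x => 1 + ∑ j, bitLen (x j)

/-! ## Integer linear programs -/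

/-- The data of an integer linear program
`min cᵀx  s.t.  A x ≤ b,  lo j ≤ x j ≤ hi j  (for the bounds that are present),  x ∈ ℤⁿ`. -/
structure ILP where
  n : ℕ
  m : ℕ
  A : Matrix (Fin m) (Fin n) ℤ
  b : Fin m → ℤ
  c : Fin n → ℤ
  lo : Fin n → Option ℤ
  hi : Fin n → Option ℤ

namespace ILP

def feasible (p : ILP) : Set (Fin p.n → ℤ) :=
  {x | (∀ i, (p.A *ᵥ x) i ≤ p.b i) ∧ (∀ j, ∀ l ∈ p.lo j, l ≤ x j) ∧ (∀ j, ∀ u ∈ p.hi j, x j ≤ u)}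

def objective (p : ILP) (x : Fin p.n → ℤ) : ℤ := p.c ⬝ᵥ x

/-- The rows of the whole constraint system: linear inequalities, lower bounds, upper bounds. -/
abbrev Row (p : ILP) : Type :=
  Fin p.m ⊕ ({j : Fin p.n // (p.lo j).isSome = true} ⊕ {j : Fin p.n // (p.hi j).isSome = true})

/-- The whole constraint matrix; the variable bounds that are present contribute the rows
`-eⱼ` (lower bounds) and `eⱼ` (upper bounds). -/
def constraintMatrix (p : ILP) : Matrix p.Row (Fin p.n) ℤ
  | .inl i, j => p.A i j
  | .inr (.inl t), j => if j = t.1 then -1 else 0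
  | .inr (.inr t), j => if j = t.1 then 1 else 0

/-- The encoding length of an optional integer. -/
def optLen : Option ℤ → ℕ
  | none => 1
  | some z => 1 + bitLen z

/-- The encoding length of the data of an integer linear program. -/
def size (p : ILP) : ℕ :=
  p.n + p.m + (∑ i, ∑ j, bitLen (p.A i j)) + (∑ i, bitLen (p.b i)) + (∑ j, bitLen (p.c j)) +
    (∑ j, optLen (p.lo j)) + (∑ j, optLen (p.hi j))

/-- The given answer is right: the problem is infeasible, or it is unbounded, or the
returned point is an optimal solution. -/
def Correct (p : ILP) : Answer p.n → Prop
  | .infeasible => p.feasible = ∅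
  | .unbounded => UnboundedBelow p.objective p.feasible
  | .point x => IsOptimal p.objective p.feasible x

end ILP

/-- A solver for integer linear programs: any function returning a right answer on each of them. -/
structure ILPSolver where
  answer : (p : ILP) → Answer p.n
  correct : ∀ p : ILP, p.Correct (answer p)

/-! ## Separable concave integer quadratic programs -/

/-- An instance of `min ∑_{i ≤ k} -qᵢ xᵢ² + hᵀx  s.t.  W x ≤ w,  x ∈ ℤⁿ`, with integral data,
`k ≤ n` and `q > 0`. -/
structure IQP where
  n : ℕ
  m : ℕ
  k : ℕ
  k_le_n : k ≤ n
  W : Matrix (Fin m) (Fin n) ℤ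
  w : Fin m → ℤ
  q : Fin k → ℤ
  q_pos : ∀ i, 0 < q i
  h : Fin n → ℤ

namespace IQP

def feasible (I : IQP) : Set (Fin I.n → ℤ) := {x | ∀ i, (I.W *ᵥ x) i ≤ I.w i}

def objective (I : IQP) (x : Fin I.n → ℤ) : ℤ :=
  (∑ i : Fin I.k, -(I.q i) * x (Fin.castLE I.k_le_n i) ^ 2) + I.h ⬝ᵥ x

/-- The encoding length of the data of an instance. -/
def size (I : IQP) : ℕ :=
  I.n + I.m + I.k + (∑ i, ∑ j, bitLen (I.W i j)) + (∑ i, bitLen (I.w i)) +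
    (∑ i, bitLen (I.q i)) + (∑ j, bitLen (I.h j))

/-- The largest absolute value of a subdeterminant of the constraint matrix. -/
def Δ (I : IQP) : ℕ := maxSubdet I.W

/-- The given answer is right, up to approximation: the problem is infeasible, or it is unbounded,
or the returned point is an `ε`-approximate solution. -/
def ApproxCorrect (I : IQP) (ε : ℝ) : Answer I.n → Prop
  | .infeasible => I.feasible = ∅
  | .unbounded => UnboundedBelow I.objective I.feasible
  | .point x => IsApproxSolution ε I.objective I.feasible x

end IQP

/-! ## Algorithms that call an ILP solver

Algorithms are programs of a structured random access machine over the integers, with the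
logarithmic cost criterion (every operation is charged the binary lengths of the numbers that it
handles), and with one further instruction which passes the integer linear program stored in memory
to a solver and stores the solver's answer in memory. -/

/-- The names of the arrays of the memory; each array holds an integer at every index. -/
inductive Arr where
  /-- input: `n`, `m`, `k`, `Δ` at indices `0, 1, 2, 3` -/
  | inDim
  /-- input: the matrix `W`, row by row -/
  | inW
  | inRhs
  | inQ
  | inH
  /-- query: number of variables and of inequalities at indices `0, 1` -/
  | qDim
  /-- query: the matrix, row by row -/
  | qA
  | qB
  | qC
  /-- query: a positive entry means that the variable has a lower bound -/
  | qLoFlag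
  | qLo
  /-- query: a positive entry means that the variable has an upper bound -/
  | qHiFlag
  | qHi
  /-- answer of the solver: `0` infeasible, `1` unbounded, `2` optimal solution found -/
  | ansStatus
  | ansPoint
  /-- output of the algorithm: `0` infeasible, `1` unbounded, otherwise a point is returned -/
  | outStatus
  | outPoint
  /-- work space -/
  | work (i : ℕ)

/-- The state of the memory. -/
abbrev State : Type := Arr → ℤ → ℤ

/-- Expressions; `div` is integer division. -/
inductive Expr where
  | const (z : ℤ)
  | load (a : Arr) (i : Expr)
  | add (e f : Expr)
  | sub (e f : Expr)
  | mul (e f : Expr)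
  | div (e f : Expr)

namespace Expr

def eval (s : State) : Expr → ℤ
  | const z => z
  | load a i => s a (i.eval s)
  | add e f => e.eval s + f.eval s
  | sub e f => e.eval s - f.eval s
  | mul e f => e.eval s * f.eval s
  | div e f => e.eval s / f.eval s

/-- Logarithmic cost of evaluating an expression: the total binary length of the values of all its
subexpressions. -/
def cost (s : State) : Expr → ℕ
  | const z => bitLen z
  | load a i => bitLen (s a (i.eval s)) + i.cost s
  | add e f => bitLen (e.eval s + f.eval s) + e.cost s + f.cost s
  | sub e f => bitLen (e.eval s - f.eval s) + e.cost s + f.cost s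
  | mul e f => bitLen (e.eval s * f.eval s) + e.cost s + f.cost s
  | div e f => bitLen (e.eval s / f.eval s) + e.cost s + f.cost s

end Expr

/-- Programs. -/
inductive Prog where
  /-- do nothing -/
  | skip
  /-- `a[i] := e` -/
  | store (a : Arr) (i e : Expr)
  /-- first `P`, then `Q` -/
  | seq (P Q : Prog)
  /-- if `e > 0` then `P` else `Q` -/
  | branch (e : Expr) (P Q : Prog)
  /-- while `e > 0` do `P` -/
  | loop (e : Expr) (P : Prog)
  /-- solve the integer linear program in the query arrays -/
  | solve

namespace State

open Classical in
/-- `a[i] := z`. -/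
def set (s : State) (a : Arr) (i z : ℤ) : State :=
  fun a' i' => if a' = a ∧ i' = i then z else s a' i'

/-- The integer linear program stored in the query arrays. -/
def toILP (s : State) : ILP where
  n := (s .qDim 0).toNat
  m := (s .qDim 1).toNat
  A := fun i j => s .qA (i * (s .qDim 0).toNat + j)
  b := fun i => s .qB i
  c := fun j => s .qC j
  lo := fun j => if 0 < s .qLoFlag j then some (s .qLo j) else none
  hi := fun j => if 0 < s .qHiFlag j then some (s .qHi j) else none

/-- The entry of a vector at an integer index, and `d` when there is none. -/
def entry {n : ℕ} (v : Fin n → ℤ) (i d : ℤ) : ℤ :=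
  if hi : 0 ≤ i ∧ i.toNat < n then v ⟨i.toNat, hi.2⟩ else d

/-- Store the answer of the solver in the answer arrays. -/
def setAnswer {n : ℕ} (s : State) : Answer n → State
  | .infeasible => s.set .ansStatus 0 0
  | .unbounded => s.set .ansStatus 0 1
  | .point x => fun a i =>
      match a with
      | .ansPoint => entry x i (s .ansPoint i)
      | a => s.set .ansStatus 0 2 a i

/-- The output of the algorithm, for an instance with `n` variables. -/
def output (s : State) (n : ℕ) : Answer n :=
  if s .outStatus 0 = 0 then .infeasible
  else if s .outStatus 0 = 1 then .unbounded
  else .point fun j => s .outPoint j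

end State

/-- The initial memory: the data of the instance and the number `Δ`, and zeros elsewhere. -/
def IQP.init (I : IQP) : State
  | .inDim, i => State.entry ![(I.n : ℤ), I.m, I.k, I.Δ] i 0
  | .inW, i => State.entry (fun r : Fin (I.m * I.n) => I.W r.divNat r.modNat) i 0
  | .inRhs, i => State.entry I.w i 0
  | .inQ, i => State.entry I.q i 0
  | .inH, i => State.entry I.h i 0
  | _, _ => 0

/-- `Exec O P s t L s'`: with the solver `O`, the program `P` started in state `s` halts in state
`s'`, after a computation of cost `t` in which the integer linear programs solved are, in this
order and with repetitions, those in the list `L`. -/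
inductive Exec (O : ILPSolver) : Prog → State → ℕ → List ILP → State → Prop where
  | skip (s : State) : Exec O .skip s 1 [] s
  | store (a : Arr) (i e : Expr) (s : State) :
      Exec O (.store a i e) s (1 + i.cost s + e.cost s) [] (s.set a (i.eval s) (e.eval s))
  | seq {P Q : Prog} {s s₁ s₂ : State} {t₁ t₂ : ℕ} {L₁ L₂ : List ILP}
      (hP : Exec O P s t₁ L₁ s₁) (hQ : Exec O Q s₁ t₂ L₂ s₂) :
      Exec O (.seq P Q) s (1 + t₁ + t₂) (L₁ ++ L₂) s₂
  | branch_pos {e : Expr} {P Q : Prog} {s s₁ : State} {t : ℕ} {L : List ILP}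
      (he : 0 < e.eval s) (hP : Exec O P s t L s₁) :
      Exec O (.branch e P Q) s (1 + e.cost s + t) L s₁
  | branch_nonpos {e : Expr} {P Q : Prog} {s s₁ : State} {t : ℕ} {L : List ILP}
      (he : e.eval s ≤ 0) (hQ : Exec O Q s t L s₁) :
      Exec O (.branch e P Q) s (1 + e.cost s + t) L s₁
  | loop_pos {e : Expr} {P : Prog} {s s₁ s₂ : State} {t₁ t₂ : ℕ} {L₁ L₂ : List ILP}
      (he : 0 < e.eval s) (hP : Exec O P s t₁ L₁ s₁) (hL : Exec O (.loop e P) s₁ t₂ L₂ s₂) :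
      Exec O (.loop e P) s (1 + e.cost s + t₁ + t₂) (L₁ ++ L₂) s₂
  | loop_nonpos {e : Expr} {P : Prog} {s : State} (he : e.eval s ≤ 0) :
      Exec O (.loop e P) s (1 + e.cost s) [] s
  | solve (s : State) :
      Exec O .solve s (1 + s.toILP.size + (O.answer s.toILP).size) [s.toILP]
        (s.setAnswer (O.answer s.toILP))

/-- The total encoding length of the answers that the solver returns on a list of problems. -/
def ILPSolver.answersSize (O : ILPSolver) (L : List ILP) : ℕ :=
  (L.map fun p => (O.answer p).size).sum

/-- The number `(3 + ⌈√(k ((2 n Δ)² + 1/ε))⌉) ^ k`. -/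
def ilpBound (n k Δ : ℕ) (ε : ℝ) : ℕ :=
  (3 + ⌈Real.sqrt ((k : ℝ) * ((2 * (n : ℝ) * (Δ : ℝ)) ^ 2 + 1 / ε))⌉₊) ^ k

end ConcaveIQP

end

open ConcaveIQP

/-! The algorithm is a depth-first branch and bound over boxes in the `k` nonlinear variables. At a
node, two linear problems per unbounded nonlinear variable determine its range. The variable with
the smallest range `[l, u]` is cut into at most `g` pieces of `⌊(u - l) / g⌋ + 1` integers each.
Once all nonlinear variables are bounded, each `-q t²` is replaced by its chord over the box, one
linear problem is solved, and the best point found so far is kept.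

Why this approximates: the chord error is at most a quarter of the sum of `q i` times the squared
side lengths. As long as the smallest range is below `g`, pieces are single integers and cause no
error. Let `B₀` be the first node on the path whose smallest range is at least `g`, let `R i` be the
ranges on it, and let `H` be the largest `q i * R i ^ 2`. Below `B₀` the error is at most `k H / (4
g²)`. On the other hand, the spread `M - m` of the objective is large. Take points `a`, `b` of `B₀`
at the two ends of the range that gives `H`, and an integer vector `v` near half of `b - a` such
that `a + v` and `b - v` are feasible. The second-order identity `objective_split` yields `4 (M - m)
≥ H - ∑ q i (2 v i - (b i - a i))²`. Since `|2 v i - (b i - a i)| ≤ 2nΔ` and `q i g² ≤ H`, the right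
side is at least `H (1 - k (2nΔ)² / g²)`. With `g² ≥ k ((2nΔ)² + 1/ε)` the error is at most `ε (M -
m)`. This is `Node.Fine.approx`; `Node.Fine` records the role of `B₀`.

The vector `v` comes from `exists_near_half`: `b - a` is a nonnegative combination of `n` integer
vectors that lie in the same orthants as `b - a` for all rows of `W` and all coordinates and have
entries bounded by minors, and the halved coefficients are rounded down. Such vectors exist because
a conformal vector with a minimal kernel of tight rows spans a line, which Cramer's rule describes
by an adjugate column (`exists_conformal_ray`).

The same decomposition, applied to the homogenized system, gives `exists_recession`: a feasible
point with a coordinate beyond a determinant bound forces a recession direction that moves this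
coordinate. A recession direction that moves a nonlinear variable drives the concave objective to
minus infinity, so an unbounded range query proves the whole problem unbounded. Otherwise the ranges
obey the determinant bound, and all queries stay polynomially small. If `Δ = 0`, then `W = 0`, no
coordinate attains an extreme value, and no variable bound, whose row has an entry `±1`, is ever
added.

For the count, a node with `r` unbounded variables gets the weight `w (r + 1) = 2 (r + 1) + g * w
r`, `w 0 = 1`, so that `w r ≤ (g + 2) ^ r`. The invariant `Pending` bounds the weight of the stack
plus the number of problems already solved. The program itself is verified by the rules for `Runs`,
which charge every elementary step a multiple of the word length `K + 4 A`, where `A` bounds the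
size of the answers. -/

namespace ConcaveIQP

/-! ## Conformal decompositions -/

section Decomposition

variable {ι : Type} {n : ℕ}

/-- The vectors that are killed by every row of `A` that kills `r`. -/
def tightKer (A : Matrix ι (Fin n) ℚ) (r : Fin n → ℚ) : Submodule ℚ (Fin n → ℚ) where
  carrier := {p | ∀ i, (A *ᵥ r) i = 0 → (A *ᵥ p) i = 0}
  add_mem' := by
    intro a b ha hb i hi
    simp [Matrix.mulVec_add, ha i hi, hb i hi]
  zero_mem' := by simp
  smul_mem' := by
    intro c x hx i hi
    simp [Matrix.mulVec_smul, hx i hi]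

/-- `A v` lies in the closed orthant determined by `A r`. -/
def Conformal (A : Matrix ι (Fin n) ℚ) (v r : Fin n → ℚ) : Prop :=
  ∀ i, 0 ≤ (A *ᵥ v) i * (A *ᵥ r) i ∧ ((A *ᵥ r) i = 0 → (A *ᵥ v) i = 0)

theorem Conformal.refl (A : Matrix ι (Fin n) ℚ) (r : Fin n → ℚ) : Conformal A r r :=
  fun _ => ⟨mul_self_nonneg _, id⟩

/-- Where `(A *ᵥ v) i` is nonzero, the product of the two sign conditions is its square times the
desired product. -/
theorem Conformal.trans {A : Matrix ι (Fin n) ℚ} {u v r : Fin n → ℚ}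
    (h : Conformal A u v) (h' : Conformal A v r) : Conformal A u r := by
  intro i
  refine ⟨?_, fun hr => (h i).2 ((h' i).2 hr)⟩
  by_cases hv : (A *ᵥ v) i = 0
  · simp [(h i).2 hv]
  · have h1 := mul_nonneg (h i).1 (h' i).1
    have h2 : 0 < (A *ᵥ v) i * (A *ᵥ v) i := mul_self_pos.2 hv
    by_contra hlt
    push Not at hlt
    nlinarith

theorem Conformal.tightKer_le {A : Matrix ι (Fin n) ℚ} {v r : Fin n → ℚ}
    (h : Conformal A v r) : tightKer A v ≤ tightKer A r :=
  fun _ hp i hi => hp i ((h i).2 hi)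

/-- Moving from `r` along `p` until a further row becomes tight. -/
theorem exists_hit [Finite ι] {A : Matrix ι (Fin n) ℚ} (hA : ∀ p, A *ᵥ p = 0 → p = 0)
    {r p : Fin n → ℚ} (hp : p ∈ tightKer A r) (hp0 : p ≠ 0) :
    ∃ t : ℚ, t ≠ 0 ∧ Conformal A (r + t • p) r ∧
      (∃ i, (A *ᵥ r) i ≠ 0 ∧ t * (A *ᵥ p) i = -(A *ᵥ r) i) ∧
      tightKer A (r + t • p) < tightKer A r := by
  obtain ⟨i1, hi1⟩ : ∃ i, (A *ᵥ p) i ≠ 0 := by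
    by_contra! hcon
    exact hp0 (hA p (funext hcon))
  have : Nonempty ι := ⟨i1⟩
  -- The row with the largest quotient becomes tight at the smallest `|t|`. Rows with `(A *ᵥ r) i =
  -- 0` have quotient `0` by the convention on division, and `p` keeps them tight anyway.
  obtain ⟨i0, hmax⟩ := Finite.exists_max fun i => |(A *ᵥ p) i / (A *ᵥ r) i|
  have hr1 : (A *ᵥ r) i1 ≠ 0 := fun h => hi1 (hp i1 h)
  have hpos : 0 < |(A *ᵥ p) i0 / (A *ᵥ r) i0| :=
    lt_of_lt_of_le (abs_pos.2 (div_ne_zero hi1 hr1)) (hmax i1)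
  have hq := abs_pos.1 hpos
  have hp0' : (A *ᵥ p) i0 ≠ 0 := fun h => hq (by simp [h])
  have hr0 : (A *ᵥ r) i0 ≠ 0 := fun h => hq (by simp [h])
  set t : ℚ := -((A *ᵥ r) i0 / (A *ᵥ p) i0) with ht
  have hti : t * (A *ᵥ p) i0 = -(A *ᵥ r) i0 := by rw [ht]; field_simp
  have hval : ∀ i, (A *ᵥ (r + t • p)) i = (A *ᵥ r) i + t * (A *ᵥ p) i := by
    intro i; simp [Matrix.mulVec_add, Matrix.mulVec_smul]
  have hconf : Conformal A (r + t • p) r := by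
    intro i
    rw [hval]
    refine ⟨?_, fun h => by rw [h, hp i h]; simp⟩
    by_cases h : (A *ᵥ r) i = 0
    · simp [h]
    · have h1 : ((A *ᵥ r) i + t * (A *ᵥ p) i) * (A *ᵥ r) i
          = ((A *ᵥ r) i) ^ 2 * (1 + t * ((A *ᵥ p) i / (A *ᵥ r) i)) := by field_simp
      rw [h1]
      refine mul_nonneg (sq_nonneg _) ?_
      have h2 : |t * ((A *ᵥ p) i / (A *ᵥ r) i)| ≤ 1 := by
        have : |t| = |(A *ᵥ p) i0 / (A *ᵥ r) i0|⁻¹ := by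
          rw [ht, abs_neg, ← abs_inv, inv_div]
        rw [abs_mul, this]
        exact (inv_mul_le_one₀ hpos).2 (hmax i)
      linarith [(abs_le.1 h2).1]
  refine ⟨t, ?_, hconf, ⟨i0, hr0, hti⟩, ?_⟩
  · intro h
    rw [h] at hti
    simp at hti
    exact hr0 hti
  · refine lt_of_le_of_ne hconf.tightKer_le fun heq => ?_
    have hmem : r ∈ tightKer A (r + t • p) := by
      rw [heq]; exact fun _ h => h
    exact hr0 (hmem i0 (by rw [hval, hti]; ring))

end Decomposition

/-! ### Conformal rays and decompositions with entries bounded by minors. -/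

section Rays

variable {ι : Type} [Fintype ι] {n : ℕ}

/-- Under every nonzero vector there is a conformal integer vector given by minors of `A`. -/
theorem exists_conformal_ray (A : Matrix ι (Fin (n + 1)) ℤ)
    (hA : ∀ p, A.map (Int.cast : ℤ → ℚ) *ᵥ p = 0 → p = 0) (D : ℕ)
    (hD : ∀ (f : Fin n → ι) (g : Fin n → Fin (n + 1)), (A.submatrix f g).det.natAbs ≤ D)
    {r : Fin (n + 1) → ℚ} (hr : r ≠ 0) :
    ∃ v : Fin (n + 1) → ℤ, v ≠ 0 ∧ Conformal (A.map (Int.cast : ℤ → ℚ)) (fun j => (v j : ℚ)) r ∧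
      ∀ j, (v j).natAbs ≤ D := by
  classical
  set B : Matrix ι (Fin (n + 1)) ℚ := A.map (Int.cast : ℤ → ℚ) with hB
  -- a conformal vector with the smallest kernel
  obtain ⟨r', ⟨hr'0, hr'c⟩, hmin⟩ := exists_minimal_of_wellFoundedLT
    (α := ℕ) (fun N => ∃ r', (r' ≠ 0 ∧ Conformal B r' r) ∧ Module.finrank ℚ (tightKer B r') = N)
      ⟨_, r, ⟨hr, Conformal.refl B r⟩, rfl⟩ |>.elim fun N h => by
      obtain ⟨⟨r', h1, h2⟩, h3⟩ := h
      exact (⟨r', h1, fun r'' h4 => by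
        have := h3 ⟨r'', h4, rfl⟩
        by_contra hlt
        push Not at hlt
        have h5 := this (by omega)
        omega⟩ : ∃ r', (r' ≠ 0 ∧ Conformal B r' r) ∧ ∀ r'', (r'' ≠ 0 ∧ Conformal B r'' r) →
          Module.finrank ℚ (tightKer B r') ≤ Module.finrank ℚ (tightKer B r''))
  -- A `p` off the line of `r'` would lead, by `exists_hit`, to a nonzero conformal vector with a
  -- smaller kernel.
  have hline : ∀ p ∈ tightKer B r', ∃ c : ℚ, p = c • r' := by
    intro p hp
    by_contra! hcon
    have hp0 : p ≠ 0 := fun h => hcon 0 (by simp [h])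
    obtain ⟨t, ht0, htc, -, hlt⟩ := exists_hit hA hp hp0
    have hne : r' + t • p ≠ 0 := by
      intro h
      apply hcon (-t⁻¹)
      have : t • p = -r' := eq_neg_of_add_eq_zero_right h
      rw [neg_smul, ← smul_neg, ← this, smul_smul, inv_mul_cancel₀ ht0, one_smul]
    have := hmin _ ⟨hne, htc.trans hr'c⟩
    have h2 := Submodule.finrank_lt_finrank_of_lt hlt
    omega
  -- a basis of the row space that starts with a basis of the span of the tight rows
  set T : Set ι := {i | (B *ᵥ r') i = 0} with hT
  obtain ⟨b, hbT, -, hbspan, hbli⟩ := exists_linearIndepOn_extension (K := ℚ) (v := fun i => B i)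
    (linearIndepOn_empty ℚ _) (Set.empty_subset T)
  obtain ⟨b', -, hbb', hb'span, hb'li⟩ := exists_linearIndepOn_extension (K := ℚ)
    (v := fun i => B i) hbli (Set.subset_univ b)
  -- The row rank equals the column rank, which is full because `B` is injective.
  have htop : Submodule.span ℚ (Set.range fun i => B i) = ⊤ := by
    apply Submodule.eq_top_of_finrank_eq
    have h1 := Matrix.rank_eq_finrank_span_row B
    have h2 : Function.Injective B.mulVecLin := by
      rw [← LinearMap.ker_eq_bot, LinearMap.ker_eq_bot']
      intro p hp
      exact hA p (by simpa using hp)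
    have h3 := LinearMap.finrank_range_of_inj h2
    rw [Matrix.rank] at h1
    rw [← h3, h1]
    rfl
  have hb'top : Submodule.span ℚ ((fun i => B i) '' b') = ⊤ := by
    rw [eq_top_iff, ← htop, Submodule.span_le]
    rwa [Set.image_univ] at hb'span
  have hli : LinearIndependent ℚ (fun i : b' => B i.1) := hb'li
  let bas : Module.Basis b' ℚ (Fin (n + 1) → ℚ) := Module.Basis.mk hli (by
    rw [← hb'top, Set.image_eq_range])
  have hcard : Fintype.card b' = Fintype.card (Fin (n + 1)) := by
    rw [← Module.finrank_eq_card_basis bas]; simp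
  let e : Fin (n + 1) ≃ b' := (Fintype.equivOfCardEq hcard).symm
  let M : Matrix (Fin (n + 1)) (Fin (n + 1)) ℤ := A.submatrix (fun j => (e j).1) id
  have hMB : M.map (Int.cast : ℤ → ℚ) = B.submatrix (fun j => (e j).1) id := by
    ext i j; rfl
  have hdet : M.det ≠ 0 := by
    intro h0
    have hu : IsUnit (M.map (Int.cast : ℤ → ℚ)) := by
      rw [← Matrix.linearIndependent_rows_iff_isUnit, hMB]
      exact hli.comp e e.injective
    rw [Matrix.isUnit_iff_isUnit_det] at hu
    have : (M.map (Int.cast : ℤ → ℚ)).det = ((M.det : ℤ) : ℚ) := (Int.cast_det M).symm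
    rw [this, h0] at hu
    simp at hu
  -- If all chosen rows were tight, the invertible matrix `M` would kill `r'`.
  obtain ⟨j0, hj0⟩ : ∃ j0, (e j0).1 ∉ b := by
    by_contra! hcon
    apply hr'0
    have h1 : M.map (Int.cast : ℤ → ℚ) *ᵥ r' = 0 := by
      ext j
      have := hbT (hcon j)
      rw [hMB]
      exact this
    apply Matrix.eq_zero_of_mulVec_eq_zero _ h1
    rw [show (M.map (Int.cast : ℤ → ℚ)).det = ((M.det : ℤ) : ℚ) from (Int.cast_det M).symm]
    exact_mod_cast hdet
  -- Cramer's rule: this column is orthogonal to every row of `M` except row `j0`, hence to all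
  -- tight rows, and its entries are, up to sign, minors of `A` of order `n`.
  let v : Fin (n + 1) → ℤ := fun j => M.adjugate j j0
  have hMv : ∀ j, (M *ᵥ v) j = if j = j0 then M.det else 0 := by
    intro j
    have := congrFun (congrFun (Matrix.mul_adjugate M) j) j0
    rw [Matrix.mul_apply] at this
    simp only [Matrix.smul_apply, Matrix.one_apply, smul_eq_mul, mul_ite, mul_one, mul_zero] at this
    rw [← this]
    rfl
  have hv0 : v ≠ 0 := by
    intro h
    have := hMv j0
    rw [h] at this
    simp at this
    exact hdet this.symm
  have hrow : ∀ j, j ≠ j0 → (B *ᵥ fun l => (v l : ℚ)) (e j).1 = 0 := by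
    intro j hj
    have h1 := hMv j
    rw [if_neg hj] at h1
    have h2 : (B *ᵥ fun l => (v l : ℚ)) (e j).1 = (((M *ᵥ v) j : ℤ) : ℚ) := by
      simp [Matrix.mulVec, dotProduct, hB, M]
    rw [h2, h1]; simp
  have hvk : (fun l => (v l : ℚ)) ∈ tightKer B r' := by
    intro i hi
    have h1 : B i ∈ Submodule.span ℚ ((fun i => B i) '' b) := hbspan ⟨i, hi, rfl⟩
    have h2 : ∀ x ∈ Submodule.span ℚ ((fun i => B i) '' b), x ⬝ᵥ (fun l => (v l : ℚ)) = 0 := by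
      intro x hx
      induction hx using Submodule.span_induction with
      | mem x hx =>
        obtain ⟨i', hi', rfl⟩ := hx
        have h3 := hrow (e.symm ⟨i', hbb' hi'⟩) (by
          rintro rfl
          simp at hj0
          exact hj0 hi')
        simpa [Matrix.mulVec] using h3
      | zero => simp
      | add x y _ _ hx hy => rw [add_dotProduct, hx, hy, add_zero]
      | smul c x _ hx => rw [smul_dotProduct, hx, smul_zero]
    exact h2 _ h1
  obtain ⟨c, hc⟩ := hline _ hvk
  have hc0 : c ≠ 0 := by
    rintro rfl
    apply hv0
    ext j
    have := congrFun hc j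
    simpa using this
  have hvD : ∀ j, (v j).natAbs ≤ D := by
    intro j
    simp only [v, Matrix.adjugate_fin_succ_eq_det_submatrix]
    rw [Int.natAbs_mul, Int.natAbs_pow]
    simpa [M] using hD _ _
  have hscale : ∀ c : ℚ, 0 ≤ c → Conformal B (c • r') r' := by
    intro c hc i
    rw [Matrix.mulVec_smul]
    refine ⟨?_, fun h => by simp [h]⟩
    have := mul_nonneg hc (mul_self_nonneg ((B *ᵥ r') i))
    simpa [mul_assoc] using this
  -- The adjugate column may point away from `r'`; then its negative is taken.
  rcases lt_or_gt_of_ne hc0 with hneg | hpos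
  · refine ⟨-v, by simpa using hv0, ?_, by simpa using hvD⟩
    refine Conformal.trans ?_ hr'c
    have : (fun j => ((-v) j : ℚ)) = (-c) • r' := by
      ext j
      have := congrFun hc j
      simp only [Pi.smul_apply, smul_eq_mul] at this
      simp [this]
    rw [show (fun j => (((-v) j : ℤ) : ℚ)) = (-c) • r' by simpa using this]
    exact hscale _ (by linarith)
  · refine ⟨v, hv0, ?_, hvD⟩
    refine Conformal.trans ?_ hr'c
    rw [hc]
    exact hscale _ hpos.le

/-- Every vector is a nonnegative combination of at most `N` conformal integer vectors whose
entries are bounded by the minors of `A`. -/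
theorem exists_conformal_decomposition (A : Matrix ι (Fin (n + 1)) ℤ)
    (hA : ∀ p, A.map (Int.cast : ℤ → ℚ) *ᵥ p = 0 → p = 0) (D : ℕ)
    (hD : ∀ (f : Fin n → ι) (g : Fin n → Fin (n + 1)), (A.submatrix f g).det.natAbs ≤ D) :
    ∀ (N : ℕ) (r : Fin (n + 1) → ℚ),
      Module.finrank ℚ (tightKer (A.map (Int.cast : ℤ → ℚ)) r) ≤ N →
      ∃ (c : Fin N → ℚ) (v : Fin N → Fin (n + 1) → ℤ), (∀ j, 0 ≤ c j) ∧
        (∀ j, Conformal (A.map (Int.cast : ℤ → ℚ)) (fun l => (v j l : ℚ)) r) ∧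
        (∀ j l, (v j l).natAbs ≤ D) ∧ r = ∑ j, c j • fun l => (v j l : ℚ) := by
  set B : Matrix ι (Fin (n + 1)) ℚ := A.map (Int.cast : ℤ → ℚ) with hB
  intro N
  induction N with
  | zero =>
    intro r hr
    refine ⟨fun _ => 0, fun _ => 0, fun j => j.elim0, fun j => j.elim0, fun j => j.elim0, ?_⟩
    have h1 : tightKer B r = ⊥ := Submodule.finrank_eq_zero.1 (Nat.le_zero.1 hr)
    have h2 : r ∈ tightKer B r := fun _ h => h
    rw [h1, Submodule.mem_bot] at h2
    simp [h2]
  | succ N ih =>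
    intro r hr
    by_cases hr0 : r = 0
    · refine ⟨fun _ => 0, fun _ => 0, by simp, ?_, by simp, by simp [hr0]⟩
      intro j i
      have : (fun l => (((0 : Fin (n + 1) → ℤ) l : ℤ) : ℚ)) = 0 := by ext; simp
      rw [this]
      simp
    obtain ⟨v, hv0, hvc, hvD⟩ := exists_conformal_ray A hA D hD hr0
    have hvk : (fun l => (v l : ℚ)) ∈ tightKer B r := fun i hi => (hvc i).2 hi
    have hv0' : (fun l => (v l : ℚ)) ≠ 0 := by
      intro h
      apply hv0
      ext j
      simpa using congrFun h j
    obtain ⟨t, ht0, htc, ⟨i0, hi0, hti⟩, hlt⟩ := exists_hit hA hvk hv0'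
    -- In the row that becomes tight, `v` and `r` have the same sign, so the row is reached by
    -- subtracting `v`. Hence `-t` is an admissible coefficient.
    have htneg : t ≤ 0 := by
      by_contra hpos
      push Not at hpos
      have h1 := (hvc i0).1
      have h2 : 0 < (B *ᵥ r) i0 * (B *ᵥ r) i0 := mul_self_pos.2 hi0
      have h3 : t * ((B *ᵥ fun l => (v l : ℚ)) i0 * (B *ᵥ r) i0)
          = -((B *ᵥ r) i0 * (B *ᵥ r) i0) := by
        rw [← mul_assoc, hti]; ring
      nlinarith [mul_nonneg hpos.le h1]
    have hfr := Submodule.finrank_lt_finrank_of_lt hlt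
    obtain ⟨c, u, hc, huc, huD, hsum⟩ := ih (r + t • fun l => (v l : ℚ)) (by omega)
    refine ⟨Fin.cons (-t) c, Fin.cons v u, ?_, ?_, ?_, ?_⟩
    · intro j
      refine Fin.cases ?_ (fun j => ?_) j
      · simpa using htneg
      · simpa using hc j
    · intro j
      refine Fin.cases ?_ (fun j => ?_) j
      · simpa using hvc
      · simpa using (huc j).trans htc
    · intro j
      refine Fin.cases ?_ (fun j => ?_) j
      · simpa using hvD
      · simpa using huD j
    · rw [Fin.sum_univ_succ]
      simp only [Fin.cons_zero, Fin.cons_succ]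
      rw [← hsum]
      simp

end Rays

end ConcaveIQP

namespace ConcaveIQP

/-! ## Subdeterminants -/

/-- A repeated row or column makes the determinant vanish, and an injective selection is small
enough to occur in the supremum. -/
theorem natAbs_det_le_maxSubdet {ι κ : Type} [Fintype ι] [Fintype κ] (A : Matrix ι κ ℤ) {r : ℕ}
    (f : Fin (r + 1) → ι) (g : Fin (r + 1) → κ) :
    (A.submatrix f g).det.natAbs ≤ maxSubdet A := by
  classical
  by_cases hf : Function.Injective f
  · by_cases hg : Function.Injective g
    · have h1 := Fintype.card_le_of_injective f hf
      have h2 := Fintype.card_le_of_injective g hg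
      simp only [Fintype.card_fin] at h1 h2
      have hr : r ∈ Finset.range (min (Fintype.card ι) (Fintype.card κ)) := by
        rw [Finset.mem_range]; omega
      unfold maxSubdet
      refine le_trans ?_ (Finset.le_sup (f := fun r => Finset.univ.sup
        fun p : (Fin (r + 1) → ι) × (Fin (r + 1) → κ) => ((A.submatrix p.1 p.2).det).natAbs) hr)
      exact Finset.le_sup (f := fun p : (Fin (r + 1) → ι) × (Fin (r + 1) → κ) =>
        ((A.submatrix p.1 p.2).det).natAbs) (Finset.mem_univ (f, g))
    · simp only [Function.Injective, not_forall] at hg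
      obtain ⟨i, j, h, hne⟩ := hg
      rw [Matrix.det_zero_of_column_eq hne (fun k => by simp [h])]
      simp
  · simp only [Function.Injective, not_forall] at hf
    obtain ⟨i, j, h, hne⟩ := hf
    rw [Matrix.det_zero_of_row_eq hne (by ext k; simp [h])]
    simp

theorem maxSubdet_le {ι κ : Type} [Fintype ι] [Fintype κ] (A : Matrix ι κ ℤ) (D : ℕ)
    (h : ∀ (r : ℕ) (f : Fin (r + 1) → ι) (g : Fin (r + 1) → κ),
      (A.submatrix f g).det.natAbs ≤ D) : maxSubdet A ≤ D :=
  Finset.sup_le fun _ _ => Finset.sup_le fun _ _ => h _ _ _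

/-- Adding rows with at most one nonzero entry, of absolute value at most `1`, does not enlarge
the subdeterminants. -/
theorem natAbs_det_le_of_unit_rows {ι ι' κ : Type} [DecidableEq κ]
    (W : Matrix ι κ ℤ) (A : Matrix ι' κ ℤ) (D : ℕ) (hD : 1 ≤ D)
    (hW : ∀ (r : ℕ) (f : Fin r → ι) (g : Fin r → κ), (W.submatrix f g).det.natAbs ≤ D)
    (hA : ∀ i, (∃ i', A i = W i') ∨
      ∃ j, ∃ c : ℤ, c.natAbs ≤ 1 ∧ ∀ l, A i l = if l = j then c else 0) :
    ∀ (r : ℕ) (f : Fin r → ι') (g : Fin r → κ), (A.submatrix f g).det.natAbs ≤ D := by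
  intro r
  induction r with
  | zero => intro f g; simpa using hD
  | succ r ih =>
    intro f g
    by_cases hall : ∀ a, ∃ i', A (f a) = W i'
    · choose f' hf' using hall
      have : A.submatrix f g = W.submatrix f' g := by
        ext a b; simp [hf']
      rw [this]
      exact hW _ _ _
    · push Not at hall
      obtain ⟨a, ha⟩ := hall
      obtain ⟨j, c, hc, hrow⟩ := (hA (f a)).resolve_left fun ⟨i', h⟩ => ha i' h
      by_cases hg : Function.Injective g
      -- Laplace expansion along the unit row: as `g` is injective, at most one term survives, and
      -- its entry has absolute value at most `1`.
      · rw [Matrix.det_succ_row _ a]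
        by_cases hj : ∃ b0, g b0 = j
        · obtain ⟨b0, hb0⟩ := hj
          rw [Finset.sum_eq_single b0]
          · rw [Int.natAbs_mul, Int.natAbs_mul, Int.natAbs_pow]
            have h1 : ((A.submatrix f g) a b0).natAbs ≤ 1 := by
              simp [hrow, hb0, hc]
            have h2 := ih (f ∘ a.succAbove) (g ∘ b0.succAbove)
            simp only [Int.natAbs_neg, Int.natAbs_one, one_pow, one_mul]
            calc _ ≤ 1 * D := Nat.mul_le_mul h1 (by simpa using h2)
              _ = D := one_mul D
          · intro b _ hb
            have : g b ≠ j := fun h => hb (hg (h.trans hb0.symm))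
            simp [hrow, this]
          · simp
        · push Not at hj
          rw [Finset.sum_eq_zero]
          · simp
          · intro b _
            simp [hrow, hj b]
      · simp only [Function.Injective, not_forall] at hg
        obtain ⟨i, j, h, hne⟩ := hg
        rw [Matrix.det_zero_of_column_eq hne (fun k => by simp [h])]
        simp

/-- The maximum with `1` is there for the empty minor, which `maxSubdet` does not count. -/
theorem natAbs_det_le_max_maxSubdet {ι κ : Type} [Fintype ι] [Fintype κ] (A : Matrix ι κ ℤ)
    (r : ℕ) (f : Fin r → ι) (g : Fin r → κ) :
    (A.submatrix f g).det.natAbs ≤ max 1 (maxSubdet A) := by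
  cases r with
  | zero => simp
  | succ r => exact (natAbs_det_le_maxSubdet A f g).trans (le_max_right _ _)

/-- The matrix `A` with the unit rows added. -/
def withUnitRows {m n : ℕ} (A : Matrix (Fin m) (Fin n) ℤ) : Matrix (Fin m ⊕ Fin n) (Fin n) ℤ
  | .inl i => A i
  | .inr j => fun l => if l = j then 1 else 0

theorem withUnitRows_mulVec_inl {m n : ℕ} (A : Matrix (Fin m) (Fin n) ℤ) (r : Fin n → ℚ)
    (i : Fin m) : ((withUnitRows A).map (Int.cast : ℤ → ℚ) *ᵥ r) (.inl i)
      = (A.map (Int.cast : ℤ → ℚ) *ᵥ r) i := rfl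

theorem withUnitRows_mulVec_inr {m n : ℕ} (A : Matrix (Fin m) (Fin n) ℤ) (r : Fin n → ℚ)
    (j : Fin n) : ((withUnitRows A).map (Int.cast : ℤ → ℚ) *ᵥ r) (.inr j) = r j := by
  simp [Matrix.mulVec, dotProduct, withUnitRows]

theorem map_cast_mulVec {m n : ℕ} (A : Matrix (Fin m) (Fin n) ℤ) (v : Fin n → ℤ) (i : Fin m) :
    (A.map (Int.cast : ℤ → ℚ) *ᵥ fun l => (v l : ℚ)) i = (((A *ᵥ v) i : ℤ) : ℚ) := by
  simp [Matrix.mulVec, dotProduct]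

/-- The conformal decomposition with respect to the orthants of the rows of `A` and of the
coordinates. -/
theorem exists_orthant_decomposition {m n : ℕ} (A : Matrix (Fin m) (Fin (n + 1)) ℤ) (D : ℕ)
    (hD1 : 1 ≤ D)
    (hD : ∀ (r : ℕ) (f : Fin r → Fin m) (g : Fin r → Fin (n + 1)),
      (A.submatrix f g).det.natAbs ≤ D) (d : Fin (n + 1) → ℤ) :
    ∃ (c : Fin (n + 1) → ℚ) (v : Fin (n + 1) → Fin (n + 1) → ℤ), (∀ j, 0 ≤ c j) ∧
      (∀ j i, 0 ≤ (A *ᵥ v j) i * (A *ᵥ d) i ∧ ((A *ᵥ d) i = 0 → (A *ᵥ v j) i = 0)) ∧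
      (∀ j l, 0 ≤ v j l * d l ∧ (d l = 0 → v j l = 0)) ∧
      (∀ j l, (v j l).natAbs ≤ D) ∧
      (∀ l, (d l : ℚ) = ∑ j, c j * v j l) := by
  -- The unit rows serve two purposes: they make the map injective, and conformality with respect to
  -- them is the sign condition on the coordinates.
  have hinj : ∀ p, (withUnitRows A).map (Int.cast : ℤ → ℚ) *ᵥ p = 0 → p = 0 := by
    intro p hp
    ext j
    have := congrFun hp (.inr j)
    rwa [withUnitRows_mulVec_inr] at this
  have hminors : ∀ (f : Fin n → Fin m ⊕ Fin (n + 1)) (g : Fin n → Fin (n + 1)),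
      ((withUnitRows A).submatrix f g).det.natAbs ≤ D := by
    refine natAbs_det_le_of_unit_rows A _ D hD1 hD ?_ n
    rintro (i | j)
    · exact .inl ⟨i, rfl⟩
    · exact .inr ⟨j, 1, by simp, fun l => rfl⟩
  obtain ⟨c, v, hc, hv, hvD, hsum⟩ := exists_conformal_decomposition (withUnitRows A) hinj D
    hminors (n + 1) (fun l => (d l : ℚ)) ((Submodule.finrank_le _).trans (by simp))
  refine ⟨c, v, hc, fun j i => ?_, fun j l => ?_, hvD, fun l => ?_⟩
  · have h := hv j (.inl i)
    rw [withUnitRows_mulVec_inl, withUnitRows_mulVec_inl, map_cast_mulVec, map_cast_mulVec] at h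
    exact_mod_cast h
  · have h := hv j (.inr l)
    rw [withUnitRows_mulVec_inr, withUnitRows_mulVec_inr] at h
    exact_mod_cast h
  · have := congrFun hsum l
    simpa using this

/-- All terms of the sum for `x` have the sign of `x`, so lowering the coefficients without making
them negative keeps the value between `0` and `x`. -/
theorem between_of_sum {N : ℕ} (x : ℤ) (c : Fin N → ℚ) (u : Fin N → ℤ) (b : Fin N → ℤ)
    (hb : ∀ j, 0 ≤ b j ∧ (b j : ℚ) ≤ c j) (hu : ∀ j, 0 ≤ u j * x ∧ (x = 0 → u j = 0))
    (hx : (x : ℚ) = ∑ j, c j * u j) :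
    (0 ≤ ∑ j, b j * u j ∧ ∑ j, b j * u j ≤ x) ∨ (x ≤ ∑ j, b j * u j ∧ ∑ j, b j * u j ≤ 0) := by
  have hsign : ∀ j, 0 ≤ x → 0 ≤ u j := by
    intro j h
    rcases h.eq_or_lt with h | h
    · rw [(hu j).2 h.symm]
    · by_contra hlt
      push Not at hlt
      nlinarith [(hu j).1]
  have hsign' : ∀ j, x ≤ 0 → u j ≤ 0 := by
    intro j h
    rcases h.eq_or_lt with h | h
    · rw [(hu j).2 h]
    · by_contra hlt
      push Not at hlt
      nlinarith [(hu j).1]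
  rcases le_total 0 x with h | h
  · left
    refine ⟨Finset.sum_nonneg fun j _ => mul_nonneg (hb j).1 (hsign j h), ?_⟩
    have : ((∑ j, b j * u j : ℤ) : ℚ) ≤ x := by
      rw [hx]
      push_cast
      refine Finset.sum_le_sum fun j _ => mul_le_mul_of_nonneg_right (hb j).2 ?_
      exact_mod_cast hsign j h
    exact_mod_cast this
  · right
    refine ⟨?_, Finset.sum_nonpos fun j _ => mul_nonpos_of_nonneg_of_nonpos (hb j).1 (hsign' j h)⟩
    have : (x : ℚ) ≤ ((∑ j, b j * u j : ℤ) : ℚ) := by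
      rw [hx]
      push_cast
      refine Finset.sum_le_sum fun j _ => mul_le_mul_of_nonpos_right (hb j).2 ?_
      exact_mod_cast hsign' j h
    exact_mod_cast this

/-- Near one half of an integer vector `d` there is an integer vector `y` with `W y` between
`0` and `W d`. -/
theorem exists_near_half {m n : ℕ} (W : Matrix (Fin m) (Fin n) ℤ) (D : ℕ) (hD1 : 1 ≤ D)
    (hD : maxSubdet W ≤ D) (d : Fin n → ℤ) :
    ∃ y : Fin n → ℤ,
      (∀ i, (0 ≤ (W *ᵥ y) i ∧ (W *ᵥ y) i ≤ (W *ᵥ d) i) ∨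
        ((W *ᵥ d) i ≤ (W *ᵥ y) i ∧ (W *ᵥ y) i ≤ 0)) ∧
      (∀ l, d l = 0 → y l = 0) ∧ ∀ l, |2 * y l - d l| ≤ 2 * n * D := by
  cases n with
  | zero => exact ⟨d, fun i => by simp [Matrix.mulVec, dotProduct], fun l => l.elim0,
      fun l => l.elim0⟩
  | succ n =>
    obtain ⟨c, v, hc, hv, hvl, hvD, hsum⟩ := exists_orthant_decomposition W D hD1
      (fun r f g => (natAbs_det_le_max_maxSubdet W r f g).trans (by omega)) d
    -- Half of `d` has the coefficients `c j / 2`; rounding down makes the vector integral and keeps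
    -- the coefficients between `0` and `c j`.
    let b : Fin (n + 1) → ℤ := fun j => ⌊c j / 2⌋
    have hb : ∀ j, 0 ≤ b j ∧ (b j : ℚ) ≤ c j := fun j =>
      ⟨Int.floor_nonneg.2 (by linarith [hc j]),
        (Int.floor_le _).trans (by linarith [hc j])⟩
    have hWy : ∀ i, (W *ᵥ fun l => ∑ j, b j * v j l) i = ∑ j, b j * (W *ᵥ v j) i := by
      intro i
      simp only [Matrix.mulVec, dotProduct, Finset.mul_sum]
      rw [Finset.sum_comm]
      exact Finset.sum_congr rfl fun _ _ => Finset.sum_congr rfl fun _ _ => by ring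
    have hWd : ∀ i, (((W *ᵥ d) i : ℤ) : ℚ) = ∑ j, c j * (((W *ᵥ v j) i : ℤ) : ℚ) := by
      intro i
      simp only [Matrix.mulVec, dotProduct, Int.cast_sum, Int.cast_mul, Finset.mul_sum, hsum]
      rw [Finset.sum_comm]
      exact Finset.sum_congr rfl fun _ _ => Finset.sum_congr rfl fun _ _ => by ring
    refine ⟨fun l => ∑ j, b j * v j l, fun i => ?_, fun l hl => ?_, fun l => ?_⟩
    · rw [hWy]
      exact between_of_sum _ c _ b hb (fun j => hv j i) (hWd i)
    · exact Finset.sum_eq_zero fun j _ => by rw [(hvl j l).2 hl, mul_zero]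
    · have h1 : (2 * ((∑ j, b j * v j l : ℤ) : ℚ) - d l) = ∑ j, (2 * b j - c j) * v j l := by
        rw [hsum]
        push_cast
        rw [Finset.mul_sum, ← Finset.sum_sub_distrib]
        exact Finset.sum_congr rfl fun _ _ => by ring
      -- Rounding changes `2 * (c j / 2)` by at most `2`, and `|v j l| ≤ D`, so each of the `n + 1`
      -- terms contributes at most `2 * D`.
      have h2 : |2 * ((∑ j, b j * v j l : ℤ) : ℚ) - d l| ≤ ∑ _j : Fin (n + 1), (2 * D : ℚ) := by
        rw [h1]
        refine (Finset.abs_sum_le_sum_abs _ _).trans (Finset.sum_le_sum fun j _ => ?_)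
        rw [abs_mul]
        refine mul_le_mul ?_ ?_ (abs_nonneg _) (by norm_num)
        · have h3 := Int.floor_le (c j / 2)
          have h4 := Int.lt_floor_add_one (c j / 2)
          have h5 : (b j : ℚ) = ⌊c j / 2⌋ := rfl
          rw [abs_le]
          constructor <;> linarith
        · have := hvD j l
          rw [← Int.cast_abs, Int.abs_eq_natAbs]
          exact_mod_cast this
      rw [Finset.sum_const, Finset.card_univ, Fintype.card_fin, nsmul_eq_mul] at h2
      have h6 : (|2 * (∑ j, b j * v j l) - d l| : ℤ) ≤ ((n + 1 : ℕ) : ℤ) * (2 * D) := by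
        exact_mod_cast h2
      calc _ ≤ _ := h6
        _ = _ := by push_cast; ring

theorem natAbs_det_le_factorial {r : ℕ} (A : Matrix (Fin r) (Fin r) ℤ) (X : ℕ)
    (h : ∀ i j, (A i j).natAbs ≤ X) : A.det.natAbs ≤ r.factorial * X ^ r := by
  have := Matrix.det_le (A := A) (abv := AbsoluteValue.abs) (x := (X : ℤ)) (by
    intro i j
    rw [AbsoluteValue.abs_apply, Int.abs_eq_natAbs]
    exact_mod_cast h i j)
  rw [AbsoluteValue.abs_apply, Int.abs_eq_natAbs, Fintype.card_fin, nsmul_eq_mul] at this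
  exact_mod_cast this

/-- A feasible point with a large coordinate gives a recession direction that enlarges this
coordinate. -/
theorem exists_recession {m n : ℕ} (W : Matrix (Fin m) (Fin n) ℤ) (w : Fin m → ℤ) (X : ℕ)
    (hX : 1 ≤ X) (hW : ∀ i j, (W i j).natAbs ≤ X) (hw : ∀ i, (w i).natAbs ≤ X)
    (x : Fin n → ℤ) (hx : ∀ i, (W *ᵥ x) i ≤ w i) (σ : ℤ) (hσ : σ.natAbs = 1) (l : Fin n)
    (hl : (((n + 1).factorial * X ^ (n + 1) : ℕ) : ℤ) < σ * x l) :
    ∃ y : Fin n → ℤ, (∀ i, (W *ᵥ y) i ≤ 0) ∧ 0 < σ * y l := by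
  set D : ℕ := (n + 1).factorial * X ^ (n + 1) with hDdef
  have hD1 : 1 ≤ D := Nat.mul_pos (Nat.factorial_pos _) (Nat.pow_pos hX)
  -- Homogenization: feasibility of `x` says that `H` maps `(1, x)` to a nonpositive vector, and `D`
  -- bounds all minors of `H` by Leibniz' formula.
  let H : Matrix (Fin m) (Fin (n + 1)) ℤ := fun i => Fin.cons (-w i) (W i)
  have hH : ∀ i j, (H i j).natAbs ≤ X := by
    intro i j
    refine Fin.cases ?_ (fun j => ?_) j
    · simpa [H] using hw i
    · simpa [H] using hW i j
  have hdet : ∀ (r : ℕ) (f : Fin r → Fin m) (g : Fin r → Fin (n + 1)),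
      (H.submatrix f g).det.natAbs ≤ D := by
    intro r f g
    by_cases hg : Function.Injective g
    · have hr := Fintype.card_le_of_injective g hg
      simp only [Fintype.card_fin] at hr
      refine (natAbs_det_le_factorial _ X fun i j => hH _ _).trans ?_
      exact Nat.mul_le_mul (Nat.factorial_le hr) (Nat.pow_le_pow_right hX hr)
    · simp only [Function.Injective, not_forall] at hg
      obtain ⟨i, j, h, hne⟩ := hg
      rw [Matrix.det_zero_of_column_eq hne (fun k => by simp [h])]
      simp
  obtain ⟨c, v, hc, hv, hvl, hvD, hsum⟩ := exists_orthant_decomposition H D hD1 hdet (Fin.cons 1 x)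
  have hmul : ∀ (u : Fin (n + 1) → ℤ) i, (H *ᵥ u) i = (W *ᵥ Fin.tail u) i - w i * u 0 := by
    intro u i
    simp only [Matrix.mulVec, dotProduct, Fin.sum_univ_succ, H, Fin.cons_zero, Fin.cons_succ,
      Fin.tail]
    ring
  have hr : ∀ i, (H *ᵥ (Fin.cons 1 x : Fin (n + 1) → ℤ)) i ≤ 0 := by
    intro i
    rw [hmul]
    simp
    exact hx i
  have hvneg : ∀ j i, (H *ᵥ v j) i ≤ 0 := by
    intro j i
    rcases (hr i).eq_or_lt with h | h
    · rw [(hv j i).2 h]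
    · by_contra hlt
      push Not at hlt
      nlinarith [(hv j i).1]
  have hs : ∀ j, 0 ≤ v j 0 := by
    intro j
    have := (hvl j 0).1
    simpa using this
  by_contra! hcon
  -- A summand with leading entry `0` is a recession direction, which by assumption does not enlarge
  -- the coordinate. Otherwise the leading entry is at least `1`, and the bound on the entries
  -- suffices. The leading entries, weighted by `c`, add up to `1`.
  have hbound : ∀ j, σ * v j l.succ ≤ D * v j 0 := by
    intro j
    rcases (hs j).eq_or_lt with h | h
    · rw [← h, mul_zero]
      refine hcon (Fin.tail (v j)) fun i => ?_
      have := hvneg j i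
      rw [hmul, ← h] at this
      simpa using this
    · have h1 : (σ * v j l.succ).natAbs ≤ D := by
        rw [Int.natAbs_mul, hσ, one_mul]; exact hvD j _
      have h2 : (D : ℤ) * 1 ≤ D * v j 0 := mul_le_mul_of_nonneg_left h (by positivity)
      omega
  have h0 := hsum 0
  have h1 := hsum l.succ
  simp only [Fin.cons_zero, Fin.cons_succ, Int.cast_one] at h0 h1
  have : ((σ * x l : ℤ) : ℚ) ≤ D := by
    calc ((σ * x l : ℤ) : ℚ) = ∑ j, c j * ((σ * v j l.succ : ℤ) : ℚ) := by
          push_cast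
          rw [h1, Finset.mul_sum]
          exact Finset.sum_congr rfl fun _ _ => by ring
      _ ≤ ∑ j, c j * ((D * v j 0 : ℤ) : ℚ) :=
          Finset.sum_le_sum fun j _ => mul_le_mul_of_nonneg_left (by exact_mod_cast hbound j) (hc j)
      _ = D * ∑ j, c j * v j 0 := by
          rw [Finset.mul_sum]
          exact Finset.sum_congr rfl fun _ _ => by push_cast; ring
      _ = D := by rw [← h0, mul_one]
  have : σ * x l ≤ D := by exact_mod_cast this
  omega

end ConcaveIQP

namespace ConcaveIQP

/-! ### Nodes of the search tree, their relaxations, and the approximation guarantee. -/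

namespace IQP

variable (I : IQP)

/-- The position of the `i`-th nonlinear variable. -/
def idx (i : Fin I.k) : Fin I.n := Fin.castLE I.k_le_n i

theorem idx_injective : Function.Injective I.idx := Fin.castLE_injective I.k_le_n

/-- A node of the search tree: bounds on some of the variables. -/
abbrev Node : Type := Fin I.n → Option (ℤ × ℤ)

variable {I}

/-- The feasible points that satisfy the bounds of a node. -/
def Node.pts (B : I.Node) : Set (Fin I.n → ℤ) :=
  {x | x ∈ I.feasible ∧ ∀ j, ∀ p ∈ B j, p.1 ≤ x j ∧ x j ≤ p.2}

theorem Node.pts_of_forall_none {B : I.Node} (h : ∀ j, B j = none) : B.pts = I.feasible := by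
  ext x; simp [Node.pts, h]

/-- With the default `0` here and in `Node.hi`, an unbounded variable contributes nothing to the
correction in `Node.chord`. -/
def Node.lo (B : I.Node) (j : Fin I.n) : ℤ := ((B j).getD (0, 0)).1

def Node.hi (B : I.Node) (j : Fin I.n) : ℤ := ((B j).getD (0, 0)).2

/-- All nonlinear variables are bounded. -/
def Node.Full (B : I.Node) : Prop := ∀ i, (B (I.idx i)).isSome

theorem Node.Full.eq_some {B : I.Node} (h : B.Full) (i : Fin I.k) :
    B (I.idx i) = some (B.lo (I.idx i), B.hi (I.idx i)) := by
  have := h i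
  rw [Option.isSome_iff_exists] at this
  obtain ⟨p, hp⟩ := this
  simp [Node.lo, Node.hi, hp]

/-- The integer linear program of a node, with objective `c`. -/
def Node.ilp (B : I.Node) (c : Fin I.n → ℤ) : ILP where
  n := I.n
  m := I.m
  A := I.W
  b := I.w
  c := c
  lo := fun j => (B j).map Prod.fst
  hi := fun j => (B j).map Prod.snd

theorem Node.ilp_feasible (B : I.Node) (c : Fin I.n → ℤ) : (B.ilp c).feasible = B.pts := by
  ext x
  simp only [ILP.feasible, Node.pts, Node.ilp, IQP.feasible, Set.mem_ofPred_eq]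
  constructor
  · rintro ⟨h1, h2, h3⟩
    exact ⟨h1, fun j p hp => ⟨h2 j p.1 (Option.mem_map_of_mem _ hp),
      h3 j p.2 (Option.mem_map_of_mem _ hp)⟩⟩
  · rintro ⟨h1, h2⟩
    refine ⟨h1, fun j l hl => ?_, fun j l hl => ?_⟩
    · obtain ⟨p, hp, rfl⟩ := Option.mem_map.1 hl
      exact (h2 j p hp).1
    · obtain ⟨p, hp, rfl⟩ := Option.mem_map.1 hl
      exact (h2 j p hp).2

/-! ### Linear underestimators -/

/-- The coefficients of the linear underestimator on the box of a node. -/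
def Node.chord (B : I.Node) (j : Fin I.n) : ℤ :=
  I.h j - ∑ i, if I.idx i = j then I.q i * (B.lo j + B.hi j) else 0

/-- The error of the linear underestimator. -/
def Node.err (B : I.Node) (x : Fin I.n → ℤ) : ℤ :=
  ∑ i, I.q i * ((x (I.idx i) - B.lo (I.idx i)) * (B.hi (I.idx i) - x (I.idx i)))

/-- Termwise, `-q t² = -q (l + u) t + q l u + q (t - l) (u - t)`. This holds for every point; only
the sign of the last term needs the box. -/
theorem Node.objective_eq (B : I.Node) (x : Fin I.n → ℤ) :
    I.objective x = B.chord ⬝ᵥ x + (∑ i, I.q i * (B.lo (I.idx i) * B.hi (I.idx i))) + B.err x := by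
  have h1 : B.chord ⬝ᵥ x = I.h ⬝ᵥ x
      - ∑ i, I.q i * (B.lo (I.idx i) + B.hi (I.idx i)) * x (I.idx i) := by
    simp only [dotProduct, Node.chord, sub_mul, Finset.sum_sub_distrib, Finset.sum_mul]
    rw [Finset.sum_comm]
    congr 1
    refine Finset.sum_congr rfl fun i _ => ?_
    rw [Finset.sum_eq_single (I.idx i)]
    · simp
    · intro b _ hb
      simp [hb.symm]
    · simp
  rw [h1, IQP.objective, Node.err]
  have h2 : ∀ a b c d e : ℤ, a = c + d - b → a + e = e - b + c + d := by intros; linarith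
  apply h2
  rw [← Finset.sum_add_distrib, ← Finset.sum_sub_distrib]
  refine Finset.sum_congr rfl fun i _ => ?_
  simp only [idx]
  ring

theorem Node.err_term_nonneg {B : I.Node} (hB : B.Full) {x : Fin I.n → ℤ} (hx : x ∈ B.pts)
    (i : Fin I.k) :
    0 ≤ I.q i * ((x (I.idx i) - B.lo (I.idx i)) * (B.hi (I.idx i) - x (I.idx i))) := by
  have := hx.2 _ _ (hB.eq_some i)
  exact mul_nonneg (I.q_pos i).le (mul_nonneg (by linarith [this.1]) (by linarith [this.2]))

theorem Node.err_nonneg {B : I.Node} (hB : B.Full) {x : Fin I.n → ℤ} (hx : x ∈ B.pts) :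
    0 ≤ B.err x :=
  Finset.sum_nonneg fun i _ => Node.err_term_nonneg hB hx i

/-- Termwise, the difference of the two sides is `q i` times `(2 x - lo - hi)²`. -/
theorem Node.four_mul_err_le (B : I.Node) (x : Fin I.n → ℤ) :
    4 * B.err x ≤ ∑ i, I.q i * (B.hi (I.idx i) - B.lo (I.idx i)) ^ 2 := by
  rw [Node.err, Finset.mul_sum]
  refine Finset.sum_le_sum fun i _ => ?_
  have h1 := (I.q_pos i).le
  have h2 := sq_nonneg (2 * x (I.idx i) - B.lo (I.idx i) - B.hi (I.idx i))
  have h3 := mul_nonneg h1 h2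
  nlinarith

/-! ### Ranges of the variables and fine nodes -/

/-- The smallest and the largest value of the variable `j` on a node. -/
structure Node.IsRange (B : I.Node) (j : Fin I.n) (l u : ℤ) : Prop where
  exists_lo : ∃ x ∈ B.pts, x j = l
  exists_hi : ∃ x ∈ B.pts, x j = u
  le : ∀ x ∈ B.pts, l ≤ x j ∧ x j ≤ u

def Node.Fixed (B : I.Node) : Prop := ∀ j p, B j = some p → p.1 = p.2

/-- Either all bounded variables are fixed, or the node is a subdivision of such a node on which
all other nonlinear variables have range at least `g`, and the subdivision divides these ranges
by `g`. -/
def Node.Fine (g : ℤ) (B : I.Node) : Prop :=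
  B.Fixed ∨ ∃ B₀ : I.Node, B₀.Fixed ∧ B.pts ⊆ B₀.pts ∧ (∀ j, (B₀ j).isSome → B j = B₀ j) ∧
    ∃ l u : Fin I.k → ℤ, ∀ i, B₀ (I.idx i) = none →
      B₀.IsRange (I.idx i) (l i) (u i) ∧ g ≤ u i - l i ∧
        ∀ p, B (I.idx i) = some p → p.1 ≤ p.2 ∧ g * (p.2 - p.1) ≤ u i - l i

/-- The second-order identity for the objective along a conformal splitting. -/
theorem objective_split (a b y : Fin I.n → ℤ) :
    2 * (I.objective (a + y) + I.objective (b - y) - I.objective a - I.objective b) =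
      ∑ i, I.q i * ((b (I.idx i) - a (I.idx i)) ^ 2
        - (2 * y (I.idx i) - (b (I.idx i) - a (I.idx i))) ^ 2) := by
  simp only [IQP.objective, dotProduct_add, dotProduct_sub, Pi.add_apply, Pi.sub_apply]
  have h2 : ∀ A B C D E X Y Z : ℤ, 2 * (A + B - C - D) = E →
      2 * (A + (X + Y) + (B + (Z - Y)) - (C + X) - (D + Z)) = E := by intros; linarith
  apply h2
  rw [← Finset.sum_add_distrib, ← Finset.sum_sub_distrib, ← Finset.sum_sub_distrib, Finset.mul_sum]
  refine Finset.sum_congr rfl fun i _ => ?_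
  simp only [idx]
  ring

/-- Every row of `W` takes at `a + y` and at `b - y` values between those at `a` and at `b`. -/
theorem feasible_of_between {a b y : Fin I.n → ℤ} (ha : a ∈ I.feasible) (hb : b ∈ I.feasible)
    (hy : ∀ i, (0 ≤ (I.W *ᵥ y) i ∧ (I.W *ᵥ y) i ≤ (I.W *ᵥ (b - a)) i) ∨
        ((I.W *ᵥ (b - a)) i ≤ (I.W *ᵥ y) i ∧ (I.W *ᵥ y) i ≤ 0)) :
    a + y ∈ I.feasible ∧ b - y ∈ I.feasible := by
  constructor <;> intro i <;> have h1 := hy i <;> have h2 := ha i <;> have h3 := hb i <;>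
    simp only [Matrix.mulVec_add, Matrix.mulVec_sub, Pi.add_apply, Pi.sub_apply] at h1 ⊢ <;>
    rcases h1 with h1 | h1 <;> linarith

/-- On a fine node, the linear underestimator gives an approximate solution. -/
theorem Node.Fine.approx {B : I.Node} {g : ℤ} (hfine : B.Fine g) (hfull : B.Full) (hg : 0 < g)
    {D : ℕ} (hD : 1 ≤ D) (hΔ : I.Δ ≤ D) {ε : ℝ} (hε : 0 < ε)
    (hgb : (I.k : ℝ) * ((2 * (I.n : ℝ) * (D : ℝ)) ^ 2 + 1 / ε) ≤ (g : ℝ) ^ 2)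
    {x y : Fin I.n → ℤ} (hx : x ∈ B.pts) (hy : y ∈ B.pts) (hxy : B.chord ⬝ᵥ x ≤ B.chord ⬝ᵥ y)
    {m M : ℤ} (hm : ∀ z ∈ I.feasible, m ≤ I.objective z) (hM : ∀ z ∈ I.feasible, I.objective z ≤ M) :
    ((I.objective x : ℝ) - I.objective y) ≤ ε * ((M : ℝ) - m) := by
  have hmM : (0 : ℝ) ≤ (M : ℝ) - m := by
    have := (hm x hx.1).trans (hM x hx.1)
    have : (m : ℝ) ≤ M := by exact_mod_cast this
    linarith
  have hrhs : 0 ≤ ε * ((M : ℝ) - m) := mul_nonneg hε.le hmM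
  have hle : I.objective x - I.objective y ≤ B.err x := by
    rw [B.objective_eq x, B.objective_eq y]
    have := B.err_nonneg hfull hy
    linarith
  have hleR : ((I.objective x : ℝ) - I.objective y) ≤ B.err x := by exact_mod_cast hle
  have hq := B.four_mul_err_le x
  -- If all bounded variables are fixed, the box has sides of length `0` and the chords are exact.
  rcases hfine with hfix | ⟨B₀, hfix, hsub, hsome, l, u, hlu⟩
  · have : ∑ i, I.q i * (B.hi (I.idx i) - B.lo (I.idx i)) ^ 2 = 0 :=
      Finset.sum_eq_zero fun i _ => by
        have := hfix _ _ (hfull.eq_some i)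
        simp only at this
        rw [this]; ring
    have h0 : B.err x ≤ 0 := by linarith
    have h0R : (B.err x : ℝ) ≤ 0 := by exact_mod_cast h0
    linarith
  by_cases hne : ∃ i, B₀ (I.idx i) = none
  swap
  · push Not at hne
    have : ∑ i, I.q i * (B.hi (I.idx i) - B.lo (I.idx i)) ^ 2 = 0 :=
      Finset.sum_eq_zero fun i _ => by
        have h1 := hsome _ (Option.isSome_iff_ne_none.2 (hne i))
        have := hfix _ _ (h1 ▸ hfull.eq_some i)
        simp only at this
        rw [this]; ring
    have h0 : B.err x ≤ 0 := by linarith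
    have h0R : (B.err x : ℝ) ≤ 0 := by exact_mod_cast h0
    linarith
  classical
  -- `H` measures the curvature visible on `B₀`. It bounds the error from above and, through the
  -- variable `i₀`, the spread of the objective from below.
  obtain ⟨i₀, hi₀, hmax⟩ := Finset.exists_max_image
    (Finset.univ.filter fun i => B₀ (I.idx i) = none) (fun i => I.q i * (u i - l i) ^ 2)
    (hne.imp fun i hi => by simpa using hi)
  simp only [Finset.mem_filter, Finset.mem_univ, true_and] at hi₀ hmax
  set H : ℤ := I.q i₀ * (u i₀ - l i₀) ^ 2 with hH
  have hH0 : 0 ≤ H := mul_nonneg (I.q_pos _).le (sq_nonneg _)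
  have hRpos : ∀ i, B₀ (I.idx i) = none → 0 ≤ u i - l i := fun i hi =>
    hg.le.trans (hlu i hi).2.1
  -- the error
  have herr : g ^ 2 * (4 * B.err x) ≤ I.k * H := by
    calc g ^ 2 * (4 * B.err x)
        ≤ g ^ 2 * ∑ i, I.q i * (B.hi (I.idx i) - B.lo (I.idx i)) ^ 2 :=
          mul_le_mul_of_nonneg_left hq (sq_nonneg _)
      _ = ∑ i, I.q i * (g * (B.hi (I.idx i) - B.lo (I.idx i))) ^ 2 := by
          rw [Finset.mul_sum]
          exact Finset.sum_congr rfl fun _ _ => by ring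
      _ ≤ ∑ _i : Fin I.k, H := by
          refine Finset.sum_le_sum fun i _ => ?_
          by_cases hi : B₀ (I.idx i) = none
          · refine le_trans ?_ (hmax i hi)
            obtain ⟨-, -, h3⟩ := hlu i hi
            have h4 := h3 _ (hfull.eq_some i)
            simp only at h4
            refine mul_le_mul_of_nonneg_left ?_ (I.q_pos i).le
            exact pow_le_pow_left₀ (mul_nonneg hg.le (by linarith [h4.1])) h4.2 2
          · have h1 := hsome _ (Option.isSome_iff_ne_none.2 hi)
            have := hfix _ _ (h1 ▸ hfull.eq_some i)
            simp only at this
            rw [this]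
            simpa using hH0
      _ = I.k * H := by simp
  -- the spread of the objective
  obtain ⟨a, ha, hal⟩ := (hlu i₀ hi₀).1.exists_lo
  obtain ⟨b, hb, hbu⟩ := (hlu i₀ hi₀).1.exists_hi
  obtain ⟨v, hv1, hv2, hv3⟩ := exists_near_half I.W D hD hΔ (b - a)
  obtain ⟨hz, hz'⟩ := feasible_of_between ha.1 hb.1 hv1
  -- The four points `a`, `b`, `a + v`, `b - v` are feasible for the whole problem, so twice the
  -- second difference of the objective is at most `4 * (M - m)`.
  have hspread : g ^ 2 * (H - ∑ i, I.q i * (2 * v (I.idx i) - (b (I.idx i) - a (I.idx i))) ^ 2)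
      ≤ g ^ 2 * (4 * (M - m)) := by
    refine mul_le_mul_of_nonneg_left ?_ (sq_nonneg _)
    have h1 := objective_split a b v
    have h2 := hM _ hz
    have h3 := hM _ hz'
    have h4 := hm _ ha.1
    have h5 := hm _ hb.1
    have h6 : H ≤ ∑ i, I.q i * (b (I.idx i) - a (I.idx i)) ^ 2 := by
      have := Finset.single_le_sum (f := fun i => I.q i * (b (I.idx i) - a (I.idx i)) ^ 2)
        (fun i _ => mul_nonneg (I.q_pos i).le (sq_nonneg _)) (Finset.mem_univ i₀)
      simpa only [hal, hbu] using this
    simp only [mul_sub, Finset.sum_sub_distrib] at h1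
    linarith
  have hcorr : g ^ 2 * ∑ i, I.q i * (2 * v (I.idx i) - (b (I.idx i) - a (I.idx i))) ^ 2
      ≤ I.k * ((2 * I.n * D) ^ 2 * H) := by
    rw [Finset.mul_sum]
    calc _ ≤ ∑ _i : Fin I.k, ((2 * I.n * D) ^ 2 * H : ℤ) := by
          refine Finset.sum_le_sum fun i _ => ?_
          by_cases hi : B₀ (I.idx i) = none
          · have h1 := hv3 (I.idx i)
            simp only [Pi.sub_apply] at h1
            have h2 : (2 * v (I.idx i) - (b (I.idx i) - a (I.idx i))) ^ 2
                ≤ (2 * I.n * D : ℤ) ^ 2 := sq_le_sq' (abs_le.1 h1).1 (abs_le.1 h1).2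
            -- This is where ranges of at least `g` are needed: they give `q i * g ^ 2 ≤ H`, so the
            -- rounding term is bounded by `H` although `q i` may be large.
            have h3 : g ^ 2 ≤ (u i - l i) ^ 2 := pow_le_pow_left₀ hg.le (hlu i hi).2.1 2
            have hqi := (I.q_pos i).le
            calc g ^ 2 * (I.q i * (2 * v (I.idx i) - (b (I.idx i) - a (I.idx i))) ^ 2)
                ≤ g ^ 2 * (I.q i * (2 * I.n * D : ℤ) ^ 2) := by gcongr
              _ ≤ (u i - l i) ^ 2 * (I.q i * (2 * I.n * D : ℤ) ^ 2) := by gcongr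
              _ = (2 * I.n * D : ℤ) ^ 2 * (I.q i * (u i - l i) ^ 2) := by ring
              _ ≤ _ := mul_le_mul_of_nonneg_left (hmax i hi) (sq_nonneg _)
          · obtain ⟨p, hp⟩ := Option.ne_none_iff_exists'.1 hi
            have h1 := ha.2 _ p hp
            have h2 := hb.2 _ p hp
            have h3 := hfix _ _ hp
            -- On a fixed coordinate `a` and `b` agree, so `v` vanishes there and there is no
            -- rounding error.
            have h4 : b (I.idx i) - a (I.idx i) = 0 := by linarith [h1.1, h1.2, h2.1, h2.2]
            rw [h4, hv2 _ h4]
            simpa using mul_nonneg (sq_nonneg (2 * (I.n : ℤ) * D)) hH0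
      _ = _ := by simp
  have hfin : g ^ 2 * H - I.k * ((2 * I.n * D) ^ 2 * H) ≤ g ^ 2 * (4 * (M - m)) := by
    rw [mul_sub] at hspread
    linarith
  have herrR : (g : ℝ) ^ 2 * (4 * B.err x) ≤ I.k * H := by exact_mod_cast herr
  have hfinR : (g : ℝ) ^ 2 * H - I.k * ((2 * I.n * D) ^ 2 * H) ≤ (g : ℝ) ^ 2 * (4 * (M - m)) := by
    exact_mod_cast hfin
  have hHR : (0 : ℝ) ≤ H := by exact_mod_cast hH0
  have hgR : (0 : ℝ) < (g : ℝ) ^ 2 := by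
    have : (0 : ℝ) < g := by exact_mod_cast hg
    positivity
  -- The part `k (2nD)²` of the lower bound for `g ^ 2` absorbs the rounding; the part `k / ε`
  -- remains.
  have h1 : (I.k : ℝ) * (1 / ε) * H ≤ (g : ℝ) ^ 2 * (4 * (M - m)) := by
    have := mul_le_mul_of_nonneg_right hgb hHR
    nlinarith
  have h2 : (I.k : ℝ) * H ≤ ε * ((g : ℝ) ^ 2 * (4 * (M - m))) := by
    have := mul_le_mul_of_nonneg_left h1 hε.le
    calc (I.k : ℝ) * H = ε * (I.k * (1 / ε) * H) := by field_simp
      _ ≤ _ := this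
  have h3 : (g : ℝ) ^ 2 * (B.err x) ≤ (g : ℝ) ^ 2 * (ε * (M - m)) := by nlinarith
  have h4 := le_of_mul_le_mul_left h3 hgR
  linarith

/-! ### Unboundedness and coordinate bounds -/

theorem natAbs_lt_two_pow {z : ℤ} {b : ℕ} (h : bitLen z ≤ b) : z.natAbs < 2 ^ b := by
  have : z.natAbs.size ≤ b := by unfold bitLen at h; omega
  exact Nat.size_le.1 this

theorem bitLen_W_le (i : Fin I.m) (j : Fin I.n) : bitLen (I.W i j) ≤ I.size := by
  have h1 := Finset.single_le_sum (f := fun j => bitLen (I.W i j)) (fun _ _ => Nat.zero_le _)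
    (Finset.mem_univ j)
  have h2 := Finset.single_le_sum (f := fun i => ∑ j, bitLen (I.W i j)) (fun _ _ => Nat.zero_le _)
    (Finset.mem_univ i)
  unfold IQP.size
  omega

theorem bitLen_w_le (i : Fin I.m) : bitLen (I.w i) ≤ I.size := by
  have h1 := Finset.single_le_sum (f := fun i => bitLen (I.w i)) (fun _ _ => Nat.zero_le _)
    (Finset.mem_univ i)
  unfold IQP.size
  omega

theorem bitLen_q_le (i : Fin I.k) : bitLen (I.q i) ≤ I.size := by
  have h1 := Finset.single_le_sum (f := fun i => bitLen (I.q i)) (fun _ _ => Nat.zero_le _)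
    (Finset.mem_univ i)
  unfold IQP.size
  omega

theorem bitLen_h_le (i : Fin I.n) : bitLen (I.h i) ≤ I.size := by
  have h1 := Finset.single_le_sum (f := fun i => bitLen (I.h i)) (fun _ _ => Nat.zero_le _)
    (Finset.mem_univ i)
  unfold IQP.size
  omega

variable (I) in
/-- A bound for the coordinates that are bounded on the feasible set. -/
def coordBound : ℕ := (I.n + 1).factorial * (2 ^ I.size) ^ (I.n + 1)

theorem exists_recession_of_large {x : Fin I.n → ℤ} (hx : x ∈ I.feasible) (σ : ℤ)
    (hσ : σ.natAbs = 1) (l : Fin I.n) (hl : (I.coordBound : ℤ) < σ * x l) :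
    ∃ y : Fin I.n → ℤ, (∀ i, (I.W *ᵥ y) i ≤ 0) ∧ 0 < σ * y l :=
  exists_recession I.W I.w (2 ^ I.size) Nat.one_le_two_pow
    (fun i j => (natAbs_lt_two_pow (bitLen_W_le i j)).le)
    (fun i => (natAbs_lt_two_pow (bitLen_w_le i)).le) x hx σ hσ l hl

/-- Along the ray `x + t y` the objective is a quadratic polynomial in `t` whose leading coefficient
is negative, because `y` moves a nonlinear variable. -/
theorem unboundedBelow_of_recession {x y : Fin I.n → ℤ} (hx : x ∈ I.feasible)
    (hy : ∀ i, (I.W *ᵥ y) i ≤ 0) (i : Fin I.k) (hyi : y (I.idx i) ≠ 0) :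
    UnboundedBelow I.objective I.feasible := by
  intro Bd
  set c₂ : ℤ := ∑ i, I.q i * y (I.idx i) ^ 2 with hc₂
  set c₁ : ℤ := I.h ⬝ᵥ y - ∑ i, 2 * I.q i * x (I.idx i) * y (I.idx i) with hc₁
  have hform : ∀ t : ℤ, I.objective (x + t • y) = I.objective x + t * c₁ - t ^ 2 * c₂ := by
    intro t
    simp only [IQP.objective, dotProduct_add, dotProduct_smul, Pi.add_apply, Pi.smul_apply,
      smul_eq_mul, hc₁, hc₂, mul_sub, Finset.mul_sum]
    have h2 : ∀ A C D E X Y : ℤ, A = C - D - E → A + (X + Y) = C + X + (Y - D) - E := by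
      intros; linarith
    apply h2
    rw [← Finset.sum_sub_distrib, ← Finset.sum_sub_distrib]
    refine Finset.sum_congr rfl fun i _ => ?_
    simp only [idx]
    ring
  have hc₂1 : 1 ≤ c₂ := by
    have h1 := Finset.single_le_sum (f := fun i => I.q i * y (I.idx i) ^ 2)
        (fun i _ => mul_nonneg (I.q_pos i).le (sq_nonneg _)) (Finset.mem_univ i)
    have h2 : 0 < I.q i * y (I.idx i) ^ 2 := mul_pos (I.q_pos i) (by positivity)
    linarith
  -- Large enough for `t ^ 2` to outweigh the linear term, the initial value and the target
  -- together.
  set t : ℤ := |c₁| + |I.objective x| + |Bd| + 1 with ht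
  have ht1 : 0 < t := by positivity
  refine ⟨x + t • y, fun i => ?_, ?_⟩
  · have h1 := hx i
    have h2 := mul_nonpos_of_nonneg_of_nonpos ht1.le (hy i)
    simp only [Matrix.mulVec_add, Matrix.mulVec_smul, Pi.add_apply, Pi.smul_apply, smul_eq_mul]
    linarith
  · rw [hform]
    have h1 : t ^ 2 * 1 ≤ t ^ 2 * c₂ := mul_le_mul_of_nonneg_left hc₂1 (sq_nonneg _)
    have h2 : t * c₁ ≤ t * |c₁| := mul_le_mul_of_nonneg_left (le_abs_self _) ht1.le
    have h3 := le_abs_self (I.objective x)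
    have h4 := neg_abs_le Bd
    have h5 : t * (t - |c₁|) = t * (|I.objective x| + |Bd| + 1) := by rw [ht]; ring
    have h6 : 1 * (|I.objective x| + |Bd| + 1) ≤ t * (|I.objective x| + |Bd| + 1) :=
      mul_le_mul_of_nonneg_right (by linarith [Int.add_one_le_iff.2 ht1]) (by positivity)
    nlinarith

/-- An unbounded coordinate exceeds `coordBound` somewhere, and then `exists_recession_of_large`
supplies a direction that moves it. -/
theorem unboundedBelow_of_coordinate {B : I.Node} (i : Fin I.k) (σ : ℤ) (hσ : σ.natAbs = 1)
    (h : UnboundedBelow (fun x => σ * x (I.idx i)) B.pts) :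
    UnboundedBelow I.objective I.feasible := by
  obtain ⟨x, hx, hlt⟩ := h (-I.coordBound)
  obtain ⟨y, hy, hyi⟩ := exists_recession_of_large hx.1 (-σ) (by simpa using hσ) (I.idx i)
    (by linarith)
  refine unboundedBelow_of_recession hx.1 hy i ?_
  intro h0
  rw [h0] at hyi
  simp at hyi

/-- A coordinate beyond `coordBound` would give a recession direction, and adding this direction to
an extremal point would improve on the extreme value. -/
theorem Node.IsRange.abs_le {B : I.Node} {j : Fin I.n} {l u : ℤ} (h : B.IsRange j l u)
    (hB : ∀ j, B j = none) {x : Fin I.n → ℤ} (hx : x ∈ I.feasible) : |x j| ≤ I.coordBound := by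
  have hpts := Node.pts_of_forall_none hB
  have key : ∀ σ : ℤ, σ.natAbs = 1 → ∀ z ∈ I.feasible, (∀ z' ∈ I.feasible, σ * z' j ≤ σ * z j) →
      ∀ x ∈ I.feasible, σ * x j ≤ I.coordBound := by
    intro σ hσ z hz hmax x hx
    by_contra hlt
    push Not at hlt
    obtain ⟨y, hy, hyi⟩ := exists_recession_of_large hx σ hσ j hlt
    have := hmax (z + y) fun i => by
      have := hz i
      have := hy i
      simp only [Matrix.mulVec_add, Pi.add_apply]
      linarith
    simp only [Pi.add_apply, mul_add] at this
    linarith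
  obtain ⟨a, ha, hal⟩ := h.exists_lo
  obtain ⟨b, hb, hbu⟩ := h.exists_hi
  have hle := h.le
  rw [hpts] at ha hb hle
  have h1 := key 1 rfl b hb (fun z hz => by linarith [(hle z hz).2]) x hx
  have h2 := key (-1) rfl a ha (fun z hz => by linarith [(hle z hz).1]) x hx
  rw [_root_.abs_le]
  constructor <;> linarith

/-- On a full node the objective exceeds its linear underestimator by at most a constant. -/
theorem Node.unboundedBelow_of_chord {B : I.Node} (hB : B.Full)
    (h : UnboundedBelow (fun x => B.chord ⬝ᵥ x) B.pts) :
    UnboundedBelow I.objective I.feasible := by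
  intro Bd
  set C := (∑ i, I.q i * (B.lo (I.idx i) * B.hi (I.idx i)))
    + ∑ i, I.q i * (B.hi (I.idx i) - B.lo (I.idx i)) ^ 2 with hC
  obtain ⟨x, hx, hlt⟩ := h (Bd - C)
  refine ⟨x, hx.1, ?_⟩
  have h1 := B.four_mul_err_le x
  have h2 := B.err_nonneg hB hx
  rw [B.objective_eq]
  linarith

/-- The values are integers, so a lower bound implies that the minimum is attained. -/
theorem exists_isOptimal {α : Type} {f : α → ℤ} {F : Set α} (hF : F.Nonempty) (Bd : ℤ)
    (h : ∀ y ∈ F, Bd ≤ f y) : ∃ x, IsOptimal f F x := by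
  obtain ⟨x0, hx0⟩ := hF
  obtain ⟨lb, ⟨x, hx, rfl⟩, hlb⟩ := Int.exists_least_of_bdd (P := fun z => ∃ x ∈ F, f x = z)
    ⟨Bd, fun z ⟨x, hx, hz⟩ => hz ▸ h x hx⟩ ⟨_, x0, hx0, rfl⟩
  exact ⟨x, hx, fun y hy => hlb _ ⟨y, hy, rfl⟩⟩

theorem W_eq_zero_of_Δ_eq_zero (h : I.Δ = 0) : I.W = 0 := by
  ext i j
  have h1 := natAbs_det_le_maxSubdet I.W (r := 0) (fun _ => i) (fun _ => j)
  have h2 : maxSubdet I.W = 0 := h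
  rw [h2] at h1
  simpa using h1

/-- If all subdeterminants vanish, then no coordinate attains its minimum or maximum. -/
theorem Δ_pos_of_isOptimal {B : I.Node} (hB : ∀ j, B j = none) {j : Fin I.n} {σ : ℤ}
    (hσ : σ.natAbs = 1) {x : Fin I.n → ℤ} (h : IsOptimal (fun x => σ * x j) B.pts x) :
    1 ≤ I.Δ := by
  by_contra h0
  have hW := W_eq_zero_of_Δ_eq_zero (I := I) (by omega)
  rw [Node.pts_of_forall_none hB] at h
  -- With `W = 0` feasibility does not depend on the point, so this better neighbour of `x` is
  -- feasible too.
  have h1 := h.2 (x - Pi.single j σ) fun i => by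
    have := h.1 i
    rw [hW] at this ⊢
    simpa using this
  have h2 : σ * σ = 1 := by
    rcases Int.natAbs_eq_iff.1 hσ with h | h <;> rw [h] <;> norm_num
  simp only [Pi.sub_apply, Pi.single_eq_same, mul_sub, h2] at h1
  linarith

/-! ### The integer linear programs of the nodes -/

/-- The row of a variable bound is a signed unit vector. It is harmless by expansion along it, but
it has itself the subdeterminant `±1`, hence the condition `1 ≤ I.Δ` as soon as there are bounds. -/
theorem Node.maxSubdet_ilp_le {B : I.Node} (h : (∀ j, B j = none) ∨ 1 ≤ I.Δ) (c : Fin I.n → ℤ) :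
    maxSubdet (B.ilp c).constraintMatrix ≤ I.Δ := by
  rcases h with h | h
  · refine maxSubdet_le _ _ fun r f g => ?_
    have hrow : ∀ a : (B.ilp c).Row, ∃ i : Fin I.m, a = .inl i := by
      rintro (i | ⟨j, hj⟩ | ⟨j, hj⟩)
      · exact ⟨i, rfl⟩
      · have hj' : (B j).isSome = true := by simpa [Node.ilp] using hj
        rw [show B j = none from h j] at hj'
        simp at hj'
      · have hj' : (B j).isSome = true := by simpa [Node.ilp] using hj
        rw [show B j = none from h j] at hj'
        simp at hj'
    choose f' hf' using fun a => hrow (f a)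
    have : (B.ilp c).constraintMatrix.submatrix f g = I.W.submatrix f' g := by
      ext a b
      change (B.ilp c).constraintMatrix (f a) (g b) = I.W (f' a) (g b)
      rw [hf']
      rfl
    rw [this]
    exact natAbs_det_le_maxSubdet _ _ _
  · refine maxSubdet_le _ _ fun r f g => ?_
    refine natAbs_det_le_of_unit_rows I.W (B.ilp c).constraintMatrix I.Δ h ?_ ?_ _ f g
    · intro r f g
      exact (natAbs_det_le_max_maxSubdet I.W r f g).trans (by
        have : maxSubdet I.W = I.Δ := rfl
        omega)
    · rintro (i | ⟨j, hj⟩ | ⟨j, hj⟩)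
      · exact .inl ⟨i, rfl⟩
      · exact .inr ⟨j, -1, by simp, fun l => rfl⟩
      · exact .inr ⟨j, 1, by simp, fun l => rfl⟩

theorem Node.size_ilp_le (B : I.Node) (c : Fin I.n → ℤ) (b : ℕ)
    (hB : ∀ j p, B j = some p → bitLen p.1 ≤ b ∧ bitLen p.2 ≤ b) (hc : ∀ j, bitLen (c j) ≤ b) :
    (B.ilp c).size ≤ I.size + I.n * (3 * b + 2) := by
  have h1 : ∑ j, bitLen (c j) ≤ I.n * b := by
    refine (Finset.sum_le_card_nsmul _ _ b fun j _ => hc j).trans ?_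
    simp
  have hopt : ∀ f : ℤ × ℤ → ℤ, (∀ j p, B j = some p → bitLen (f p) ≤ b) →
      ∑ j, ILP.optLen ((B j).map f) ≤ I.n * (b + 1) := by
    intro f hf
    refine (Finset.sum_le_card_nsmul _ _ (b + 1) fun j _ => ?_).trans (by simp)
    rcases hj : B j with _ | p
    · simp [ILP.optLen]
    · have := hf j p hj
      simp only [Option.map_some, ILP.optLen]
      omega
  have h2 := hopt Prod.fst fun j p h => (hB j p h).1
  have h3 := hopt Prod.snd fun j p h => (hB j p h).2
  have h4 : I.n * b + I.n * (b + 1) + I.n * (b + 1) = I.n * (3 * b + 2) := by ring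
  have h5 : (B.ilp c).size = I.n + I.m + (∑ i, ∑ j, bitLen (I.W i j)) + (∑ i, bitLen (I.w i))
    + (∑ j, bitLen (c j)) + (∑ j, ILP.optLen ((B j).map Prod.fst))
    + (∑ j, ILP.optLen ((B j).map Prod.snd)) := rfl
  have h6 : I.n + I.m + (∑ i, ∑ j, bitLen (I.W i j)) + (∑ i, bitLen (I.w i)) ≤ I.size := by
    unfold IQP.size; omega
  omega

end IQP

end ConcaveIQP

namespace ConcaveIQP

/-! ## Binary lengths -/

theorem bitLen_le_iff {z : ℤ} {b : ℕ} : bitLen z ≤ b + 1 ↔ z.natAbs < 2 ^ b := by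
  rw [bitLen, Nat.add_le_add_iff_right, Nat.size_le]

theorem one_le_bitLen (z : ℤ) : 1 ≤ bitLen z := by unfold bitLen; omega

theorem bitLen_mono {y z : ℤ} (h : y.natAbs ≤ z.natAbs) : bitLen y ≤ bitLen z :=
  Nat.add_le_add_right (Nat.size_le_size h) 1

theorem natAbs_lt_two_pow_bitLen (z : ℤ) : z.natAbs < 2 ^ (bitLen z - 1) := by
  rw [← bitLen_le_iff, Nat.sub_add_cancel (one_le_bitLen z)]

theorem bitLen_add_le (x y : ℤ) : bitLen (x + y) ≤ bitLen x + bitLen y := by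
  have hx := natAbs_lt_two_pow_bitLen x
  have hy := natAbs_lt_two_pow_bitLen y
  have h1 := one_le_bitLen x
  have h2 := one_le_bitLen y
  obtain ⟨a, ha⟩ := Nat.exists_eq_add_of_le' h1
  obtain ⟨b, hb⟩ := Nat.exists_eq_add_of_le' h2
  rw [ha, Nat.add_sub_cancel] at hx
  rw [hb, Nat.add_sub_cancel] at hy
  rw [ha, hb]
  rw [show a + 1 + (b + 1) = (a + b + 1) + 1 by ring, bitLen_le_iff]
  have h3 : (x + y).natAbs ≤ x.natAbs + y.natAbs := Int.natAbs_add_le x y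
  have h4 : 2 ^ a ≤ 2 ^ (a + b) := Nat.pow_le_pow_right (by norm_num) (by omega)
  have h5 : 2 ^ b ≤ 2 ^ (a + b) := Nat.pow_le_pow_right (by norm_num) (by omega)
  rw [pow_succ]
  omega

theorem bitLen_neg (x : ℤ) : bitLen (-x) = bitLen x := by simp [bitLen]

theorem bitLen_sub_le (x y : ℤ) : bitLen (x - y) ≤ bitLen x + bitLen y := by
  rw [sub_eq_add_neg, ← bitLen_neg y]
  exact bitLen_add_le _ _

theorem bitLen_mul_le (x y : ℤ) : bitLen (x * y) ≤ bitLen x + bitLen y := by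
  have hx := natAbs_lt_two_pow_bitLen x
  have hy := natAbs_lt_two_pow_bitLen y
  have h1 := one_le_bitLen x
  have h2 := one_le_bitLen y
  have h3 : bitLen (x * y) ≤ (bitLen x - 1 + (bitLen y - 1)) + 1 := by
    rw [bitLen_le_iff, Int.natAbs_mul, pow_add]
    exact Nat.mul_lt_mul'' hx hy
  omega

theorem bitLen_div_le (x y : ℤ) : bitLen (x / y) ≤ bitLen x + bitLen y :=
  (bitLen_mono (Int.natAbs_ediv_le_natAbs x y)).trans (Nat.le_add_right _ _)

theorem bitLen_le_four {z : ℤ} (h : z.natAbs ≤ 7) : bitLen z ≤ 4 := by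
  rw [bitLen_le_iff]; omega

theorem bitLen_natCast_le (z : ℕ) : bitLen (z : ℤ) ≤ z + 1 := by
  rw [bitLen_le_iff, Int.natAbs_natCast]
  exact Nat.lt_two_pow_self

theorem bitLen_natCast_mono {y z : ℕ} (h : y ≤ z) : bitLen (y : ℤ) ≤ bitLen (z : ℤ) :=
  bitLen_mono (by simpa using h)

/-! ## Memory -/

namespace State

theorem set_self (s : State) (a : Arr) (i z i' : ℤ) :
    s.set a i z a i' = if i' = i then z else s a i' := by
  unfold set; simp

theorem set_self_same (s : State) (a : Arr) (i z : ℤ) : s.set a i z a i = z := by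
  rw [set_self, if_pos rfl]

theorem set_of_ne {a a' : Arr} (h : a' ≠ a) (s : State) (i z : ℤ) : s.set a i z a' = s a' := by
  funext i'
  unfold set
  simp [h]

/-- The two memories agree outside of the given arrays. -/
def SameOff (l : List Arr) (s s' : State) : Prop := ∀ a, a ∉ l → s' a = s a

theorem SameOff.refl (l : List Arr) (s : State) : SameOff l s s := fun _ _ => rfl

theorem SameOff.trans {l : List Arr} {s s' s'' : State} (h : SameOff l s s')
    (h' : SameOff l s' s'') : SameOff l s s'' := fun a ha => (h' a ha).trans (h a ha)

theorem SameOff.mono {l l' : List Arr} {s s' : State} (h : SameOff l s s') (hl : l ⊆ l') :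
    SameOff l' s s' := fun a ha => h a fun h' => ha (hl h')

theorem SameOff.set {l : List Arr} {s s' : State} (h : SameOff l s s') {a : Arr} (ha : a ∈ l)
    (i z : ℤ) : SameOff l s (s'.set a i z) := by
  intro a' ha'
  rw [set_of_ne (fun h' => ha' (by rwa [h'])), h a' ha']

theorem SameOff.set_right (s : State) {l : List Arr} {a : Arr} (ha : a ∈ l)
    (i z : ℤ) : SameOff l s (s.set a i z) := (SameOff.refl l s).set ha i z

/-- All entries have at most `M` bits, and those of the last answer at most `A` bits. -/
def Bdd (A M : ℕ) (s : State) : Prop :=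
  (∀ a i, bitLen (s a i) ≤ M) ∧ ∀ i, bitLen (s .ansPoint i) ≤ A

theorem Bdd.set {A M : ℕ} {s : State} (h : s.Bdd A M) {a : Arr} (ha : a ≠ .ansPoint) (i : ℤ) {z : ℤ}
    (hz : bitLen z ≤ M) : (s.set a i z).Bdd A M := by
  refine ⟨fun a' i' => ?_, fun i' => ?_⟩
  · unfold State.set
    split_ifs
    · exact hz
    · exact h.1 _ _
  · rw [set_of_ne ha.symm]
    exact h.2 _

theorem bitLen_entry_le {n : ℕ} (v : Fin n → ℤ) (i d : ℤ) (b : ℕ) (hv : ∀ j, bitLen (v j) ≤ b)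
    (hd : bitLen d ≤ b) : bitLen (entry v i d) ≤ b := by
  unfold entry
  split_ifs
  · exact hv _
  · exact hd

theorem entry_natCast {n : ℕ} (v : Fin n → ℤ) (j : Fin n) (d : ℤ) :
    entry v (j : ℕ) d = v j := by
  unfold entry
  simp

end State

/-! ## Cost of expressions -/

namespace Expr

/-- A load is a single leaf whatever its index is, because every stored entry fits into a word. -/
def leaves : Expr → ℕ
  | const _ => 1
  | load _ _ => 1
  | add e f => e.leaves + f.leaves
  | sub e f => e.leaves + f.leaves
  | mul e f => e.leaves + f.leaves
  | div e f => e.leaves + f.leaves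

def weight : Expr → ℕ
  | const _ => 1
  | load _ i => 1 + i.weight
  | add e f => e.leaves + f.leaves + e.weight + f.weight
  | sub e f => e.leaves + f.leaves + e.weight + f.weight
  | mul e f => e.leaves + f.leaves + e.weight + f.weight
  | div e f => e.leaves + f.leaves + e.weight + f.weight

/-- The constants of the expression have at most `K` bits. -/
def ConstLe (K : ℕ) : Expr → Prop
  | const z => bitLen z ≤ K
  | load _ i => i.ConstLe K
  | add e f => e.ConstLe K ∧ f.ConstLe K
  | sub e f => e.ConstLe K ∧ f.ConstLe K
  | mul e f => e.ConstLe K ∧ f.ConstLe K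
  | div e f => e.ConstLe K ∧ f.ConstLe K

def maxConst : Expr → ℕ
  | const z => z.natAbs
  | load _ i => i.maxConst
  | add e f => max e.maxConst f.maxConst
  | sub e f => max e.maxConst f.maxConst
  | mul e f => max e.maxConst f.maxConst
  | div e f => max e.maxConst f.maxConst

/-- Each of the four operations yields a number with at most as many bits as its two operands have
together. -/
theorem bitLen_eval_le {A M : ℕ} {s : State} (hs : s.Bdd A M) :
    ∀ e : Expr, e.ConstLe M → bitLen (e.eval s) ≤ e.leaves * M
  | const z, h => by rw [leaves, one_mul]; exact h
  | load a i, _ => by rw [leaves, one_mul]; exact hs.1 a _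
  | add e f, h => by
    have h1 := bitLen_eval_le hs e h.1
    have h2 := bitLen_eval_le hs f h.2
    have h3 := bitLen_add_le (e.eval s) (f.eval s)
    simp only [eval, leaves, add_mul]
    omega
  | sub e f, h => by
    have h1 := bitLen_eval_le hs e h.1
    have h2 := bitLen_eval_le hs f h.2
    have h3 := bitLen_sub_le (e.eval s) (f.eval s)
    simp only [eval, leaves, add_mul]
    omega
  | mul e f, h => by
    have h1 := bitLen_eval_le hs e h.1
    have h2 := bitLen_eval_le hs f h.2
    have h3 := bitLen_mul_le (e.eval s) (f.eval s)
    simp only [eval, leaves, add_mul]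
    omega
  | div e f, h => by
    have h1 := bitLen_eval_le hs e h.1
    have h2 := bitLen_eval_le hs f h.2
    have h3 := bitLen_div_le (e.eval s) (f.eval s)
    simp only [eval, leaves, add_mul]
    omega

theorem cost_le {A M : ℕ} {s : State} (hs : s.Bdd A M) :
    ∀ e : Expr, e.ConstLe M → e.cost s ≤ e.weight * M
  | const z, h => by rw [weight, one_mul]; exact h
  | load a i, h => by
    have h1 := cost_le hs i h
    have h2 := hs.1 a (i.eval s)
    simp only [cost, weight, add_mul, one_mul]
    omega
  | add e f, h => by
    have h1 := bitLen_eval_le hs (.add e f) h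
    have h2 := cost_le hs e h.1
    have h3 := cost_le hs f h.2
    simp only [eval, leaves, add_mul] at h1
    simp only [cost, weight, add_mul]
    omega
  | sub e f, h => by
    have h1 := bitLen_eval_le hs (.sub e f) h
    have h2 := cost_le hs e h.1
    have h3 := cost_le hs f h.2
    simp only [eval, leaves, add_mul] at h1
    simp only [cost, weight, add_mul]
    omega
  | mul e f, h => by
    have h1 := bitLen_eval_le hs (.mul e f) h
    have h2 := cost_le hs e h.1
    have h3 := cost_le hs f h.2
    simp only [eval, leaves, add_mul] at h1
    simp only [cost, weight, add_mul]
    omega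
  | div e f, h => by
    have h1 := bitLen_eval_le hs (.div e f) h
    have h2 := cost_le hs e h.1
    have h3 := cost_le hs f h.2
    simp only [eval, leaves, add_mul] at h1
    simp only [cost, weight, add_mul]
    omega

theorem constLe_of_maxConst {K : ℕ} (hK : 4 ≤ K) :
    ∀ e : Expr, e.maxConst ≤ 7 → e.ConstLe K
  | const _, h => (bitLen_le_four h).trans hK
  | load _ i, h => constLe_of_maxConst hK i h
  | add e f, h => ⟨constLe_of_maxConst hK e (le_of_max_le_left h),
      constLe_of_maxConst hK f (le_of_max_le_right h)⟩
  | sub e f, h => ⟨constLe_of_maxConst hK e (le_of_max_le_left h),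
      constLe_of_maxConst hK f (le_of_max_le_right h)⟩
  | mul e f, h => ⟨constLe_of_maxConst hK e (le_of_max_le_left h),
      constLe_of_maxConst hK f (le_of_max_le_right h)⟩
  | div e f, h => ⟨constLe_of_maxConst hK e (le_of_max_le_left h),
      constLe_of_maxConst hK f (le_of_max_le_right h)⟩

/-- Expressions of small size with small constants. -/
def Light (e : Expr) : Prop := e.weight ≤ 49 ∧ e.maxConst ≤ 7

instance (e : Expr) : Decidable e.Light := inferInstanceAs (Decidable (_ ∧ _))

/-- The evaluation of the expression is charged at most `98` times the word length. -/
def Cheap (K : ℕ) (e : Expr) : Prop :=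
  ∀ A s, State.Bdd A (K + 4 * A) s → e.cost s ≤ 98 * (K + 4 * A)

theorem Light.cost_le {e : Expr} (h : e.Light) {K A : ℕ} {s : State} (hK : 4 ≤ K)
    (hs : s.Bdd A (K + 4 * A)) : e.cost s ≤ 49 * (K + 4 * A) :=
  (e.cost_le hs (constLe_of_maxConst (by omega) e h.2)).trans (Nat.mul_le_mul_right _ h.1)

theorem Light.cheap {e : Expr} (h : e.Light) {K : ℕ} (hK : 4 ≤ K) : e.Cheap K := fun _ _ hs =>
  (h.cost_le hK hs).trans (Nat.mul_le_mul_right _ (by norm_num))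

end Expr

/-! ## Executions with a bound for the running time -/

/-- All answers to the given problems have size at most `A`. -/
def ILPSolver.Small (O : ILPSolver) (A : ℕ) (L : List ILP) : Prop := ∀ Q ∈ L, (O.answer Q).size ≤ A

/-- The program `P` leads from `s` to `s'` while solving the problems in `L`. If the answers have
size at most `A`, then the memory keeps entries of at most `K + 4 A` bits, and the cost is at most
`N` times `100 (K + 4 A)`. -/
def Runs (O : ILPSolver) (K : ℕ) (P : Prog) (s : State) (L : List ILP) (s' : State) (N : ℕ) : Prop :=
  ∃ t, Exec O P s t L s' ∧ ∀ A, s.Bdd A (K + 4 * A) → O.Small A L →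
    t ≤ N * (100 * (K + 4 * A)) ∧ s'.Bdd A (K + 4 * A)

namespace Runs

variable {O : ILPSolver} {K : ℕ}

theorem mono {P : Prog} {s s' : State} {L : List ILP} {N N' : ℕ} (h : Runs O K P s L s' N)
    (hN : N ≤ N') : Runs O K P s L s' N' := by
  obtain ⟨t, h1, h2⟩ := h
  exact ⟨t, h1, fun A hA hL => ⟨(h2 A hA hL).1.trans (Nat.mul_le_mul_right _ hN), (h2 A hA hL).2⟩⟩

theorem skip (hK : 4 ≤ K) (s : State) : Runs O K .skip s [] s 1 :=
  ⟨1, .skip s, fun A hA _ => ⟨by omega, hA⟩⟩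

theorem store (hK : 4 ≤ K) {a : Arr} {i e : Expr} {s : State} (ha : a ≠ .ansPoint)
    (hv : ∀ A, s.Bdd A (K + 4 * A) → bitLen (e.eval s) ≤ K + 4 * A)
    (hi : i.Light := by decide) (he : e.Light := by decide) :
    Runs O K (.store a i e) s [] (s.set a (i.eval s) (e.eval s)) 1 :=
  -- Index and value cost at most `49` words each; with the unit charge this stays below the `100`
  -- words of one unit of `Runs`.
  ⟨_, .store a i e s, fun A hA _ => by
    have h1 := hi.cost_le hK hA
    have h2 := he.cost_le hK hA
    exact ⟨by omega, hA.set ha _ (hv A hA)⟩⟩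

theorem seq {P Q : Prog} {s s₁ s₂ : State} {L₁ L₂ : List ILP} {N₁ N₂ : ℕ}
    (h₁ : Runs O K P s L₁ s₁ N₁) (h₂ : Runs O K Q s₁ L₂ s₂ N₂) :
    Runs O K (.seq P Q) s (L₁ ++ L₂) s₂ (N₁ + N₂ + 1) := by
  obtain ⟨t₁, e₁, c₁⟩ := h₁
  obtain ⟨t₂, e₂, c₂⟩ := h₂
  refine ⟨_, .seq e₁ e₂, fun A hA hL => ?_⟩
  obtain ⟨b1, b2⟩ := c₁ A hA fun Q hQ => hL Q (List.mem_append_left _ hQ)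
  obtain ⟨b3, b4⟩ := c₂ A b2 fun Q hQ => hL Q (List.mem_append_right _ hQ)
  refine ⟨?_, b4⟩
  have := one_le_bitLen (s .inDim 0)
  have := hA.1 .inDim 0
  simp only [add_mul]
  omega

theorem branch_pos (hK : 4 ≤ K) {e : Expr} {P Q : Prog} {s s₁ : State} {L : List ILP} {N : ℕ}
    (hpos : 0 < e.eval s) (h : Runs O K P s L s₁ N) (he : e.Light := by decide) :
    Runs O K (.branch e P Q) s L s₁ (N + 1) := by
  obtain ⟨t, e₁, c₁⟩ := h
  refine ⟨_, .branch_pos hpos e₁, fun A hA hL => ?_⟩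
  obtain ⟨b1, b2⟩ := c₁ A hA hL
  have := he.cost_le hK hA
  refine ⟨?_, b2⟩
  simp only [add_mul]
  omega

theorem branch_nonpos (hK : 4 ≤ K) {e : Expr} {P Q : Prog} {s s₁ : State} {L : List ILP} {N : ℕ}
    (hpos : e.eval s ≤ 0) (h : Runs O K Q s L s₁ N) (he : e.Light := by decide) :
    Runs O K (.branch e P Q) s L s₁ (N + 1) := by
  obtain ⟨t, e₁, c₁⟩ := h
  refine ⟨_, .branch_nonpos hpos e₁, fun A hA hL => ?_⟩
  obtain ⟨b1, b2⟩ := c₁ A hA hL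
  have := he.cost_le hK hA
  refine ⟨?_, b2⟩
  simp only [add_mul]
  omega

/-- Loops with a decreasing measure. -/
theorem loop_rule (hK : 4 ≤ K) {e : Expr} {body : Prog} (he : e.Cheap K) (b : ℕ)
    (P : ℕ → State → List ILP → Prop)
    (hstep : ∀ r s L, P r s L → 0 < e.eval s →
      ∃ r' s' L', r' < r ∧ Runs O K body s L' s' b ∧ P r' s' (L ++ L')) :
    ∀ r s L, P r s L → ∃ r' s' L', Runs O K (.loop e body) s L' s' (r * (b + 1) + 1) ∧
      P r' s' (L ++ L') ∧ e.eval s' ≤ 0 := by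
  intro r
  induction r using Nat.strong_induction_on with
  | _ r ih =>
    intro s L hP
    rcases le_or_gt (e.eval s) 0 with h | h
    · refine ⟨r, s, [], ⟨_, .loop_nonpos h, fun A hA _ => ⟨?_, hA⟩⟩, by simpa using hP, h⟩
      have := he A s hA
      simp only [add_mul]
      omega
    · obtain ⟨r₁, s₁, L₁, hr, ⟨t₁, e₁, c₁⟩, hP₁⟩ := hstep r s L hP h
      obtain ⟨r₂, s₂, L₂, ⟨t₂, e₂, c₂⟩, hP₂, hend⟩ := ih r₁ hr s₁ _ hP₁
      refine ⟨r₂, s₂, L₁ ++ L₂, ⟨_, .loop_pos h e₁ e₂, fun A hA hL => ?_⟩,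
        by rwa [← List.append_assoc], hend⟩
      obtain ⟨b1, b2⟩ := c₁ A hA fun Q hQ => hL Q (List.mem_append_left _ hQ)
      obtain ⟨b3, b4⟩ := c₂ A b2 fun Q hQ => hL Q (List.mem_append_right _ hQ)
      refine ⟨?_, b4⟩
      have h1 := he A s hA
      have h2 : (r₁ + 1) * (b + 1) * (100 * (K + 4 * A)) ≤ r * (b + 1) * (100 * (K + 4 * A)) :=
        Nat.mul_le_mul_right _ (Nat.mul_le_mul_right _ hr)
      simp only [add_mul, one_mul] at *
      omega

end Runs

/-- The scalar stored in the given work array. -/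
abbrev var (c : ℕ) : Expr := .load (.work c) (.const 0)

/-- `for c := 0, …, bound - 1 do body`. -/
abbrev forUpTo (c : ℕ) (bound : Expr) (body : Prog) : Prog :=
  .seq (.store (.work c) (.const 0) (.const 0)) (.loop (.sub bound (var c))
    (.seq body (.store (.work c) (.const 0) (.add (var c) (.const 1)))))

/-- Fill a segment of an array. -/
abbrev fill (c : ℕ) (bound : Expr) (a : Arr) (ie e : Expr) : Prog := forUpTo c bound (.store a ie e)

namespace Runs

variable {O : ILPSolver} {K : ℕ}

/-- The loop rule with the measure `N - j`. Each round pays for the body, the increment, their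
composition and the test, hence `b + 3`. -/
theorem for_rule (hK : 4 ≤ K) {c : ℕ} {bound : Expr} {body : Prog} (N : ℕ)
    (hN : bitLen (N : ℤ) ≤ K) (b : ℕ) (P : ℕ → State → List ILP → Prop) (s : State)
    (h0 : P 0 (s.set (.work c) 0 0) [])
    (hbound : ∀ j s L, P j s L → bound.eval s = N)
    (hstep : ∀ j < N, ∀ s₁ L₁, P j s₁ L₁ → s₁ (.work c) 0 = j →
      ∃ s₂ L₂, Runs O K body s₁ L₂ s₂ b ∧ s₂ (.work c) 0 = j ∧
        P (j + 1) (s₂.set (.work c) 0 ((j + 1 : ℕ) : ℤ)) (L₁ ++ L₂))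
    (hlight : (Expr.sub bound (var c)).Light := by decide) :
    ∃ s' L', Runs O K (forUpTo c bound body) s L' s' (N * (b + 3) + 3) ∧ P N s' L' := by
  have hlc : (var c).Light ∧ (Expr.add (var c) (.const 1)).Light := by
    constructor <;> refine ⟨?_, ?_⟩ <;> simp [Expr.weight, Expr.maxConst, Expr.leaves]
  have hinit : Runs O K (.store (.work c) (.const 0) (.const 0)) s [] (s.set (.work c) 0 0) 1 :=
    store hK (by simp) (fun A _ => by
      have : bitLen 0 ≤ 4 := bitLen_le_four (by simp)
      simp only [Expr.eval]; omega)
  obtain ⟨r', s', L', hrun, ⟨j, hj, hr', hcnt, hP⟩, hend⟩ :=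
    loop_rule (O := O) hK (e := .sub bound (var c))
      (body := .seq body (.store (.work c) (.const 0) (.add (var c) (.const 1))))
      (hlight.cheap hK) (b + 2)
      (fun r s L => ∃ j ≤ N, r = N - j ∧ s (.work c) 0 = (j : ℤ) ∧ P j s L) (by
        rintro r s L ⟨j, hj, rfl, hcnt, hP⟩ hpos
        simp only [Expr.eval, hbound j s L hP, hcnt] at hpos
        have hjN : j < N := by omega
        obtain ⟨s₂, L₂, hrun, hc2, hP2⟩ := hstep j hjN s L hP hcnt
        have hval : (Expr.add (var c) (.const 1)).eval s₂ = ((j + 1 : ℕ) : ℤ) := by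
          simp [Expr.eval, hc2]
        have hst : Runs O K (.store (.work c) (.const 0) (.add (var c) (.const 1))) s₂ []
            (s₂.set (.work c) 0 ((j + 1 : ℕ) : ℤ)) 1 := by
          rw [← hval]
          refine store hK (by simp) (fun A _ => ?_) (by decide) hlc.2
          rw [hval]
          exact ((bitLen_natCast_mono hjN).trans hN).trans (by omega)
        refine ⟨N - (j + 1), _, L₂ ++ [], by omega, (hrun.seq hst).mono (by omega),
          j + 1, hjN, rfl, State.set_self_same _ _ _ _, by simpa using hP2⟩)
      N (s.set (.work c) 0 0) [] ⟨0, Nat.zero_le _, rfl, by simp [State.set_self_same], h0⟩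
  simp only [Expr.eval, hbound j s' _ hP, hcnt] at hend
  have hjN : j = N := by omega
  subst hjN
  refine ⟨s', [] ++ L', (hinit.seq hrun).mono ?_, hP⟩
  rw [show b + 2 + 1 = b + 3 from rfl]
  omega

/-- The rule for loops that do not call the solver. -/
theorem for_rule_nil (hK : 4 ≤ K) {c : ℕ} {bound : Expr} {body : Prog} (N : ℕ)
    (hN : bitLen (N : ℤ) ≤ K) (b : ℕ) (P : ℕ → State → Prop) (s : State)
    (h0 : P 0 (s.set (.work c) 0 0))
    (hbound : ∀ j s, P j s → bound.eval s = N)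
    (hstep : ∀ j < N, ∀ s₁, P j s₁ → s₁ (.work c) 0 = j →
      ∃ s₂, Runs O K body s₁ [] s₂ b ∧ s₂ (.work c) 0 = j ∧
        P (j + 1) (s₂.set (.work c) 0 ((j + 1 : ℕ) : ℤ)))
    (hlight : (Expr.sub bound (var c)).Light := by decide) :
    ∃ s', Runs O K (forUpTo c bound body) s [] s' (N * (b + 3) + 3) ∧ P N s' := by
  obtain ⟨s', L', h1, h2, h3⟩ := for_rule (O := O) hK N hN b (fun j s L => L = [] ∧ P j s) s
    ⟨rfl, h0⟩ (fun j s _ h => hbound j s h.2) (fun j hj s₁ L₁ hP hc => by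
      obtain ⟨s₂, h1, h2, h3⟩ := hstep j hj s₁ hP.2 hc
      exact ⟨s₂, [], h1, h2, by simp [hP.1], h3⟩) hlight
  subst h2
  exact ⟨s', h1, h3⟩

/-- The expression `e` may read the entry that it is about to overwrite: when the counter is `j`,
only positions before `off + j` have been changed. The in-place correction in `leafObjective` uses
this. -/
theorem fill_rule (hK : 4 ≤ K) {c : ℕ} {bound : Expr} {a : Arr} {ie e : Expr} (N : ℕ)
    (hN : bitLen (N : ℤ) ≤ K) (off : ℤ) (val : ℕ → ℤ) (s : State)
    (ha : a ≠ .ansPoint) (hac : a ≠ .work c)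
    (hbound : ∀ s₁, State.SameOff [a, .work c] s s₁ → bound.eval s₁ = N)
    (hie : ∀ j < N, ∀ s₁, State.SameOff [a, .work c] s s₁ → s₁ (.work c) 0 = j →
      ie.eval s₁ = off + j)
    (he : ∀ j < N, ∀ s₁, State.SameOff [a, .work c] s s₁ → s₁ (.work c) 0 = j →
      s₁ a (off + j) = s a (off + j) → e.eval s₁ = val j)
    (hval : ∀ j < N, ∀ s₁, State.SameOff [a, .work c] s s₁ → s₁ (.work c) 0 = j →
      s₁ a (off + j) = s a (off + j) → ∀ A, s₁.Bdd A (K + 4 * A) → bitLen (val j) ≤ K + 4 * A)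
    (hlight : (Expr.sub bound (var c)).Light := by decide)
    (hli : ie.Light := by decide) (hle : e.Light := by decide) :
    ∃ s', Runs O K (fill c bound a ie e) s [] s' (N * 4 + 3) ∧
      State.SameOff [a, .work c] s s' ∧ (∀ j < N, s' a (off + (j : ℕ)) = val j) ∧
      ∀ i, (∀ j < N, i ≠ off + (j : ℕ)) → s' a i = s a i := by
  obtain ⟨s', hrun, hP⟩ := for_rule_nil (O := O) hK (c := c) (bound := bound)
    (body := .store a ie e) N hN 1
    (fun j s₁ => State.SameOff [a, .work c] s s₁ ∧ (∀ j' < j, s₁ a (off + (j' : ℕ)) = val j') ∧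
      ∀ i, (∀ j' < j, i ≠ off + (j' : ℕ)) → s₁ a i = s a i) s
    ⟨State.SameOff.set_right s (by simp) _ _, by simp, fun i _ => by
      rw [State.set_of_ne hac]⟩
    (fun j s₁ h => hbound s₁ h.1)
    (fun j hj s₁ ⟨h1, h2, h3⟩ hc => by
      have hsame : s₁ a (off + j) = s a (off + j) := h3 _ fun j' hj' => by
        intro h; omega
      have hrun := store (O := O) hK (a := a) (i := ie) (e := e) (s := s₁) ha
        (by rw [he j hj s₁ h1 hc hsame]; exact hval j hj s₁ h1 hc hsame) hli hle
      rw [he j hj s₁ h1 hc hsame, hie j hj s₁ h1 hc] at hrun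
      refine ⟨_, hrun, ?_, ?_, ?_, ?_⟩
      · rw [State.set_of_ne hac.symm, hc]
      · exact (h1.set (by simp) _ _).set (by simp) _ _
      · intro j' hj'
        rw [State.set_of_ne hac, State.set_self]
        split_ifs with h
        · have : j' = j := by omega
          rw [this]
        · exact h2 j' (by omega)
      · intro i hi
        rw [State.set_of_ne hac, State.set_self, if_neg (hi j (by omega))]
        exact h3 i fun j' hj' => hi j' (by omega)) hlight
  exact ⟨s', hrun, hP⟩

/-- Adding up values in a scalar. -/
theorem sum_rule (hK : 4 ≤ K) {c d : ℕ} {bound e : Expr} (N : ℕ) (hcd : c ≠ d)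
    (hN : bitLen (N : ℤ) ≤ K) (val : ℕ → ℤ) (s : State)
    (hbound : ∀ s₁, State.SameOff [.work d, .work c] s s₁ → bound.eval s₁ = N)
    (he : ∀ j < N, ∀ s₁, State.SameOff [.work d, .work c] s s₁ → s₁ (.work c) 0 = j →
      e.eval s₁ = val j)
    (hval : ∀ j ≤ N, ∀ s₁, State.SameOff [.work d, .work c] s s₁ → ∀ A, s₁.Bdd A (K + 4 * A) →
      bitLen (s (.work d) 0 + ∑ j' ∈ Finset.range j, val j') ≤ K + 4 * A)
    (hlight : (Expr.sub bound (var c)).Light := by decide)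
    (hle : (Expr.add (var d) e).Light := by decide) :
    ∃ s', Runs O K (forUpTo c bound (.store (.work d) (.const 0) (.add (var d) e))) s [] s'
        (N * 4 + 3) ∧ State.SameOff [.work d, .work c] s s' ∧
      s' (.work d) 0 = s (.work d) 0 + ∑ j ∈ Finset.range N, val j := by
  have hdc : Arr.work d ≠ Arr.work c := by simpa using hcd.symm
  obtain ⟨s', hrun, hP⟩ := for_rule_nil (O := O) hK (c := c) (bound := bound)
    (body := .store (.work d) (.const 0) (.add (var d) e)) N hN 1
    (fun j s₁ => State.SameOff [.work d, .work c] s s₁ ∧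
      s₁ (.work d) 0 = s (.work d) 0 + ∑ j' ∈ Finset.range j, val j') s
    ⟨State.SameOff.set_right s (by simp) _ _, by rw [State.set_of_ne hdc]; simp⟩
    (fun j s₁ h => hbound s₁ h.1)
    (fun j hj s₁ ⟨h1, h2⟩ hc => by
      have hev : (Expr.add (var d) e).eval s₁
          = s (.work d) 0 + ∑ j' ∈ Finset.range (j + 1), val j' := by
        rw [Finset.sum_range_succ, ← add_assoc, ← h2, ← he j hj s₁ h1 hc]
        rfl
      have hrun := store (O := O) hK (a := .work d) (i := .const 0) (e := .add (var d) e) (s := s₁)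
        (by simp) (by rw [hev]; exact hval (j + 1) hj s₁ h1) (by decide) hle
      rw [hev] at hrun
      refine ⟨_, hrun, ?_, ?_, ?_⟩
      · rw [State.set_of_ne hdc.symm, hc]
      · exact (h1.set (by simp) _ _).set (by simp) _ _
      · rw [State.set_of_ne hdc]
        exact State.set_self_same _ _ _ _) hlight
  exact ⟨s', hrun, hP⟩

end Runs

end ConcaveIQP

namespace ConcaveIQP

open IQP State

/-! ## The data of a node in memory -/

/-- Use of the work arrays: `0` the number `g`; `1` the height of the stack; `2`, `3`, `4` the
flags, lower and upper bounds of the stacked nodes, `k` entries per node; `5` the selected variable,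
or `-1`; `6`, `7` its range; `8`, `9` counters; `10` the success flag; `11` the objective value of
the last answer; `12` that of the best point; `13` the number of a piece; `14` the number of
integers in a piece; `15` a minimum awaiting its maximum. -/
abbrev dim (c : ℤ) : Expr := .load .inDim (.const c)

/-- The data that the main loop does not change. -/
structure Static (I : IQP) (g : ℤ) (s : State) : Prop where
  inDim : s .inDim = I.init .inDim
  inQ : s .inQ = I.init .inQ
  inH : s .inH = I.init .inH
  qDim_zero : s .qDim 0 = I.n
  qDim_one : s .qDim 1 = I.m
  qA : ∀ (i : Fin I.m) (j : Fin I.n), s .qA ((i : ℕ) * (I.n : ℕ) + (j : ℕ)) = I.W i j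
  qB : ∀ i : Fin I.m, s .qB (i : ℕ) = I.w i
  loFlag : ∀ j : ℕ, I.k ≤ j → s .qLoFlag j = 0
  hiFlag : ∀ j : ℕ, I.k ≤ j → s .qHiFlag j = 0
  gval : s (.work 0) 0 = g

namespace Static

variable {I : IQP} {g : ℤ} {s s' : State}

theorem of_sameOff (hs : Static I g s) {l : List Arr} (h : SameOff l s s')
    (hl : ∀ a ∈ [Arr.inDim, .inQ, .inH, .qDim, .qA, .qB, .qLoFlag, .qHiFlag, .work 0], a ∉ l
      := by simp) : Static I g s' := by
  have h' : ∀ a ∈ [Arr.inDim, .inQ, .inH, .qDim, .qA, .qB, .qLoFlag, .qHiFlag, .work 0],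
      s' a = s a := fun a ha => h a (hl a ha)
  simp only [List.forall_mem_cons] at h'
  obtain ⟨h1, h2, h3, h4, h5, h6, h7, h8, h9, -⟩ := h'
  exact ⟨h1 ▸ hs.inDim, h2 ▸ hs.inQ, h3 ▸ hs.inH, h4 ▸ hs.qDim_zero, h4 ▸ hs.qDim_one, h5 ▸ hs.qA,
    h6 ▸ hs.qB, h7 ▸ hs.loFlag, h8 ▸ hs.hiFlag, h9 ▸ hs.gval⟩

theorem dim_zero (hs : Static I g s) : (dim 0).eval s = I.n := by
  simp [Expr.eval, hs.inDim, IQP.init, State.entry]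

theorem dim_two (hs : Static I g s) : (dim 2).eval s = I.k := by
  simp [Expr.eval, hs.inDim, IQP.init, State.entry]

end Static

/-- The query arrays hold the bounds of the node `B`. -/
structure Cur {I : IQP} (B : I.Node) (s : State) : Prop where
  eq : ∀ j : Fin I.n, B j =
    if 0 < s .qLoFlag (j : ℕ) then some (s .qLo (j : ℕ), s .qHi (j : ℕ)) else none
  flag : ∀ j : Fin I.n, s .qHiFlag (j : ℕ) = s .qLoFlag (j : ℕ)

theorem Cur.of_sameOff {I : IQP} {B : I.Node} {s s' : State} (hB : Cur B s) {l : List Arr}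
    (h : SameOff l s s')
    (hl : ∀ a ∈ [Arr.qLoFlag, .qHiFlag, .qLo, .qHi], a ∉ l := by simp) : Cur B s' := by
  have h' : ∀ a ∈ [Arr.qLoFlag, .qHiFlag, .qLo, .qHi], s' a = s a := fun a ha => h a (hl a ha)
  simp only [List.forall_mem_cons] at h'
  obtain ⟨h1, h2, h3, h4, -⟩ := h'
  exact ⟨by rw [h1, h3, h4]; exact hB.eq, by rw [h1, h2]; exact hB.flag⟩

/-- The dimensions are variables here so that they can be substituted; the types of the other fields
depend on them. -/
theorem toILP_eq_of {s : State} {n m : ℕ} {A : Matrix (Fin m) (Fin n) ℤ} {b : Fin m → ℤ}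
    {c : Fin n → ℤ} {lo hi : Fin n → Option ℤ} (hn : (s .qDim 0).toNat = n)
    (hm : (s .qDim 1).toNat = m)
    (hA : ∀ (i : Fin m) (j : Fin n), s .qA ((i : ℕ) * (n : ℕ) + (j : ℕ)) = A i j)
    (hb : ∀ i : Fin m, s .qB (i : ℕ) = b i) (hc : ∀ j : Fin n, s .qC (j : ℕ) = c j)
    (hlo : ∀ j : Fin n, (if 0 < s .qLoFlag (j : ℕ) then some (s .qLo (j : ℕ)) else none) = lo j)
    (hhi : ∀ j : Fin n, (if 0 < s .qHiFlag (j : ℕ) then some (s .qHi (j : ℕ)) else none) = hi j) :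
    s.toILP = ⟨n, m, A, b, c, lo, hi⟩ := by
  subst hn hm
  obtain rfl : _ = A := funext fun i => funext fun j => hA i j
  obtain rfl : _ = b := funext hb
  obtain rfl : _ = c := funext hc
  obtain rfl : _ = lo := funext hlo
  obtain rfl : _ = hi := funext hhi
  rfl

theorem toILP_eq {I : IQP} {g : ℤ} {s : State} {B : I.Node} (hs : Static I g s) (hB : Cur B s)
    {c : Fin I.n → ℤ} (hc : ∀ j : Fin I.n, s .qC (j : ℕ) = c j) : s.toILP = B.ilp c := by
  refine toILP_eq_of (by simp [hs.qDim_zero]) (by simp [hs.qDim_one]) hs.qA hs.qB hc ?_ ?_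
  · intro j
    rw [hB.eq]
    split_ifs <;> rfl
  · intro j
    rw [hB.eq, hB.flag]
    split_ifs <;> rfl

/-- What the answer arrays say about the minimization of `c` over the node. -/
def Outcome {I : IQP} (B : I.Node) (c : Fin I.n → ℤ) (s : State) : Prop :=
  (s .ansStatus 0 = 0 ∧ B.pts = ∅) ∨
  (s .ansStatus 0 = 1 ∧ UnboundedBelow (fun x => c ⬝ᵥ x) B.pts) ∨
  (s .ansStatus 0 = 2 ∧ ∃ x, IsOptimal (fun x => c ⬝ᵥ x) B.pts x ∧
    ∀ j : Fin I.n, s .ansPoint (j : ℕ) = x j)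

theorem setAnswer_point_of_ne {n : ℕ} (s : State) (x : Fin n → ℤ) {a : Arr} (ha : a ≠ .ansPoint) :
    s.setAnswer (.point x) a = s.set .ansStatus 0 2 a := by
  cases a <;> first | rfl | exact absurd rfl ha

theorem setAnswer_sameOff {n : ℕ} (s : State) (ans : Answer n) :
    SameOff [.ansStatus, .ansPoint] s (s.setAnswer ans) := by
  cases ans with
  | infeasible => exact SameOff.set_right s (by simp) _ _
  | unbounded => exact SameOff.set_right s (by simp) _ _
  | point x =>
    intro a ha
    simp only [List.mem_cons, List.not_mem_nil, or_false, not_or] at ha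
    rw [setAnswer_point_of_ne s x ha.2, State.set_of_ne ha.1]

/-- Indices outside of the returned point keep entries of earlier answers, which is why `State.Bdd`
bounds the whole array `ansPoint` by `A`. -/
theorem setAnswer_bdd {n : ℕ} {s : State} {K A : ℕ} (hK : 4 ≤ K) (hs : s.Bdd A (K + 4 * A))
    {ans : Answer n} (hA : ans.size ≤ A) : (s.setAnswer ans).Bdd A (K + 4 * A) := by
  have hsmall : ∀ z : ℤ, z.natAbs ≤ 7 → bitLen z ≤ K + 4 * A := fun z hz =>
    (bitLen_le_four hz).trans (by omega)
  cases ans with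
  | infeasible => exact hs.set (by simp) _ (hsmall _ (by simp))
  | unbounded => exact hs.set (by simp) _ (hsmall _ (by simp))
  | point x =>
    have hx : ∀ j, bitLen (x j) ≤ A := by
      intro j
      have h1 := Finset.single_le_sum (f := fun j => bitLen (x j)) (fun _ _ => Nat.zero_le _)
        (Finset.mem_univ j)
      simp only [Answer.size] at hA
      omega
    have hset := hs.set (a := .ansStatus) (by simp) 0 (hsmall 2 (by simp))
    have hpt : ∀ i, bitLen (s.setAnswer (.point x) .ansPoint i) ≤ A := fun i =>
      bitLen_entry_le _ _ _ _ hx (hs.2 i)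
    refine ⟨fun a i => ?_, hpt⟩
    by_cases ha : a = .ansPoint
    · subst ha
      exact (hpt i).trans (by omega)
    · rw [setAnswer_point_of_ne s x ha]
      exact hset.1 a i

variable {O : ILPSolver} {K : ℕ} {I : IQP} {g : ℤ}

theorem runs_solve (hK : 4 ≤ K) {s : State} {B : I.Node} (hs : Static I g s) (hB : Cur B s)
    {c : Fin I.n → ℤ} (hc : ∀ j : Fin I.n, s .qC (j : ℕ) = c j) (hsize : (B.ilp c).size ≤ K) :
    ∃ s', Runs O K .solve s [B.ilp c] s' 1 ∧ SameOff [.ansStatus, .ansPoint] s s' ∧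
      Outcome B c s' := by
  have hex := Exec.solve (O := O) s
  rw [toILP_eq hs hB hc] at hex
  refine ⟨_, ⟨_, hex, fun A hA hL => ?_⟩, setAnswer_sameOff _ _, ?_⟩
  · have h1 := hL _ (List.mem_singleton.2 rfl)
    exact ⟨by omega, setAnswer_bdd hK hA h1⟩
  · have hcor := O.correct (B.ilp c)
    have hfeas := B.ilp_feasible c
    cases hans : O.answer (B.ilp c) with
    | infeasible =>
      rw [hans] at hcor
      exact .inl ⟨State.set_self_same _ _ _ _, hfeas ▸ hcor⟩
    | unbounded =>
      rw [hans] at hcor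
      exact .inr (.inl ⟨State.set_self_same _ _ _ _, hfeas ▸ hcor⟩)
    | point x =>
      rw [hans] at hcor
      refine .inr (.inr ⟨State.set_self_same s .ansStatus 0 2, x, hfeas ▸ hcor, fun j => ?_⟩)
      exact State.entry_natCast (n := (B.ilp c).n) x j _

/-! ## Sizes of the queries -/

namespace IQP

variable (I)

/-- A bound for the binary lengths of the objectives and the bounds in the queries. -/
def entryBits : ℕ := 2 * I.size + 2 * bitLen (3 * I.coordBound : ℤ) + 4

def querySize : ℕ := I.size + I.n * (3 * I.entryBits + 2)

/-- The queries that the algorithm may make. -/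
def GoodQuery (Q : ILP) : Prop :=
  Q.size ≤ I.querySize ∧ Q.n ≤ I.n ∧ Q.m ≤ I.m ∧ maxSubdet Q.constraintMatrix ≤ I.Δ

/-- All nonlinear variables are bounded on the feasible set. -/
def CoordBdd : Prop := ∀ x ∈ I.feasible, ∀ i, |x (I.idx i)| ≤ I.coordBound

variable {I}

/-- The properties of the nodes on the stack. -/
structure Node.OK (g : ℤ) (B : I.Node) : Prop where
  bdd : ∀ j p, B j = some p → |p.1| ≤ 3 * I.coordBound ∧ |p.2| ≤ 3 * I.coordBound
  fine : B.Fine g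
  some : (∀ j, B j = none) ∨ 1 ≤ I.Δ ∧ I.CoordBdd

theorem bitLen_le_of_abs {x : ℤ} (h : |x| ≤ 3 * I.coordBound) :
    bitLen x ≤ bitLen (3 * I.coordBound : ℤ) := by
  refine bitLen_mono ?_
  rw [Int.abs_eq_natAbs] at h
  omega

theorem Node.OK.goodQuery {B : I.Node} (hB : B.OK g) {c : Fin I.n → ℤ}
    (hc : ∀ j, bitLen (c j) ≤ I.entryBits) : I.GoodQuery (B.ilp c) := by
  refine ⟨B.size_ilp_le c _ (fun j p h => ?_) hc, le_rfl, le_rfl,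
    Node.maxSubdet_ilp_le (hB.some.imp_right And.left) c⟩
  have h1 := bitLen_le_of_abs (hB.bdd j p h).1
  have h2 := bitLen_le_of_abs (hB.bdd j p h).2
  unfold entryBits
  omega

theorem Node.OK.goodQuery_single {B : I.Node} (hB : B.OK g) (j : Fin I.n) {σ : ℤ}
    (hσ : σ.natAbs = 1) : I.GoodQuery (B.ilp (Pi.single j σ)) := by
  refine hB.goodQuery fun l => ?_
  have : bitLen ((Pi.single j σ : Fin I.n → ℤ) l) ≤ 4 := by
    refine bitLen_le_four ?_
    by_cases h : l = j
    · subst h; simp [hσ]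
    · simp [h]
  unfold entryBits
  omega

theorem Node.OK.bitLen_chord_le {B : I.Node} (hB : B.OK g) (l : Fin I.n) :
    bitLen (B.chord l) ≤ I.entryBits := by
  have hb : ∀ i, bitLen (B.lo (I.idx i)) ≤ bitLen (3 * I.coordBound : ℤ) ∧
      bitLen (B.hi (I.idx i)) ≤ bitLen (3 * I.coordBound : ℤ) := by
    intro i
    rcases h : B (I.idx i) with _ | p
    · simp only [Node.lo, Node.hi, h, Option.getD_none]
      exact ⟨bitLen_mono (by simp), bitLen_mono (by simp)⟩
    · simp only [Node.lo, Node.hi, h, Option.getD_some]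
      exact ⟨bitLen_le_of_abs (hB.bdd _ p h).1, bitLen_le_of_abs (hB.bdd _ p h).2⟩
  unfold Node.chord entryBits
  by_cases hl : ∃ i, I.idx i = l
  · obtain ⟨i, rfl⟩ := hl
    rw [Finset.sum_eq_single i]
    · simp only [if_true]
      have h1 := bitLen_sub_le (I.h (I.idx i)) (I.q i * (B.lo (I.idx i) + B.hi (I.idx i)))
      have h2 := bitLen_mul_le (I.q i) (B.lo (I.idx i) + B.hi (I.idx i))
      have h3 := bitLen_add_le (B.lo (I.idx i)) (B.hi (I.idx i))
      have h4 := bitLen_h_le (I.idx i)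
      have h5 := bitLen_q_le i
      have h6 := hb i
      omega
    · intro b _ hb
      rw [if_neg fun h => hb (I.idx_injective h)]
    · simp
  · push Not at hl
    rw [Finset.sum_eq_zero fun i _ => if_neg (hl i), sub_zero]
    have := bitLen_h_le l
    omega

theorem Node.OK.goodQuery_chord {B : I.Node} (hB : B.OK g) : I.GoodQuery (B.ilp B.chord) :=
  hB.goodQuery hB.bitLen_chord_le

end IQP

/-- The unconditional lower bounds for the word length. -/
structure WordLength (I : IQP) (g : ℤ) (K : ℕ) : Prop where
  four_le : 4 ≤ K
  n_le : bitLen (I.n : ℤ) ≤ K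
  k_le : bitLen (I.k : ℤ) ≤ K
  query_le : I.querySize ≤ K
  g_le : bitLen g ≤ K
  entry_le : I.entryBits ≤ K
  objective_le : I.n + I.k + 2 * I.size + 4 ≤ K

/-! ## Scanning the ranges of the variables -/

/-- Optimize `σ` times the variable whose index is in `work 8`. -/
def rangeQuery (σ : ℤ) : Prog :=
  .seq (fill 9 (dim 0) .qC (var 9) (.const 0)) (.seq (.store .qC (var 8) (.const σ)) .solve)

theorem runs_rangeQuery (hK : WordLength I g K) {s : State} {B : I.Node} (hs : Static I g s)
    (hB : Cur B s) (hOK : B.OK g) {σ : ℤ} (hσ : σ = 1 ∨ σ = -1) (i : Fin I.k)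
    (hi : s (.work 8) 0 = (i : ℕ)) :
    ∃ s', Runs O K (rangeQuery σ) s [B.ilp (Pi.single (I.idx i) σ)] s' (I.n * 4 + 7) ∧
      SameOff [.qC, .work 9, .ansStatus, .ansPoint] s s' ∧
      Outcome B (Pi.single (I.idx i) σ) s' := by
  have h4 := hK.four_le
  obtain ⟨s₁, hrun₁, hoff₁, hval₁, -⟩ := Runs.fill_rule (O := O) h4 (c := 9) (bound := dim 0)
    (a := .qC) (ie := var 9) (e := .const 0) I.n hK.n_le 0 (fun _ => 0) s (by simp) (by simp)
    (fun s₁ h => (hs.of_sameOff h).dim_zero) (fun j _ s₁ _ h => by simpa [Expr.eval] using h)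
    (fun j _ s₁ _ _ _ => rfl) (fun j _ s₁ _ _ _ A _ => by
      have : bitLen 0 ≤ 4 := bitLen_le_four (by simp)
      omega)
  have hσ1 : σ.natAbs = 1 := by rcases hσ with rfl | rfl <;> rfl
  have hrun₂ : Runs O K (.store .qC (var 8) (.const σ)) s₁ [] (s₁.set .qC (i : ℕ) σ) 1 := by
    have : (var 8).eval s₁ = (i : ℕ) := by
      rw [← hi]
      exact congrFun (hoff₁ (.work 8) (by simp)) 0
    rw [← this]
    refine Runs.store h4 (by simp) (fun A _ => ?_) (by decide) ?_
    · have : bitLen σ ≤ 4 := bitLen_le_four (by omega)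
      simp only [Expr.eval]; omega
    · rcases hσ with rfl | rfl <;> decide
  have hoff₂ : SameOff [.qC, .work 9, .ansStatus, .ansPoint] s (s₁.set .qC (i : ℕ) σ) :=
    (hoff₁.mono (by simp)).set (by simp) _ _
  obtain ⟨s₃, hrun₃, hoff₃, hout⟩ := runs_solve (O := O) h4 (hs.of_sameOff hoff₂)
    (hB.of_sameOff hoff₂) (c := Pi.single (I.idx i) σ) (fun j => by
      rw [State.set_self]
      by_cases h : j = I.idx i
      · subst h
        simp [IQP.idx]
      · rw [if_neg, Pi.single_eq_of_ne h]
        · simpa using hval₁ j j.2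
        · intro h'
          exact h (Fin.ext (by simpa [IQP.idx] using h')))
    ((hOK.goodQuery_single _ hσ1).1.trans hK.query_le)
  exact ⟨s₃, (hrun₁.seq (hrun₂.seq hrun₃)).mono (by omega),
    hoff₂.trans (hoff₃.mono (by simp)), hout⟩

/-- The node can be dropped, or the problem is unbounded. -/
def Failed (B : I.Node) (s : State) : Prop :=
  (s .ansStatus 0 = 0 ∧ B.pts = ∅) ∨
    (s .ansStatus 0 = 1 ∧ UnboundedBelow I.objective I.feasible)

/-- The solver's status is `0`, `1` or `2`, so positivity singles out an optimal point. -/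
def isPoint : Expr := .sub (.load .ansStatus (.const 0)) (.const 1)

/-- Unboundedness of a coordinate on a node already shows that the whole problem is unbounded, so a
range query either finds an end of the range or settles the node. -/
theorem Outcome.range {B : I.Node} {i : Fin I.k} {σ : ℤ} (hσ : σ.natAbs = 1) {s : State}
    (h : Outcome B (Pi.single (I.idx i) σ) s) :
    (isPoint.eval s ≤ 0 ∧ Failed B s) ∨ (0 < isPoint.eval s ∧ ∃ x ∈ B.pts,
      s .ansPoint (i : ℕ) = x (I.idx i) ∧ ∀ y ∈ B.pts, σ * x (I.idx i) ≤ σ * y (I.idx i)) := by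
  rcases h with ⟨h1, h2⟩ | ⟨h1, h2⟩ | ⟨h1, x, h2, h3⟩
  · exact .inl ⟨by simp [isPoint, Expr.eval, h1], .inl ⟨h1, h2⟩⟩
  · refine .inl ⟨by simp [isPoint, Expr.eval, h1], .inr ⟨h1, ?_⟩⟩
    refine unboundedBelow_of_coordinate (B := B) i σ hσ ?_
    simpa [single_dotProduct] using h2
  · refine .inr ⟨by simp [isPoint, Expr.eval, h1], x, h2.1, h3 (I.idx i), fun y hy => ?_⟩
    simpa [single_dotProduct] using h2.2 y hy

def setSel : Prog :=
  .seq (.store (.work 5) (.const 0) (var 8)) (.seq (.store (.work 6) (.const 0) (var 15))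
    (.store (.work 7) (.const 0) (.load .ansPoint (var 8))))

/-- Determine the range of the variable in `work 8`, unless it is bounded already, and keep the
variable with the smallest range in `work 5`, and this range in `work 6` and `work 7`. -/
def scanBody : Prog :=
  .branch (var 10)
    (.branch (.load .qLoFlag (var 8)) .skip
      (.seq (rangeQuery 1)
        (.branch isPoint
          (.seq (.store (.work 15) (.const 0) (.load .ansPoint (var 8)))
            (.seq (rangeQuery (-1))
              (.branch isPoint
                (.branch (.add (var 5) (.const 1))
                  (.branch (.sub (.sub (var 7) (var 6)) (.sub (.load .ansPoint (var 8)) (var 15)))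
                    setSel .skip)
                  setSel)
                (.store (.work 10) (.const 0) (.const 0)))))
          (.store (.work 10) (.const 0) (.const 0)))))
    .skip

/-- The smallest range found among the first `i` variables. -/
def Found (B : I.Node) (i : ℕ) (s : State) : Prop :=
  (s (.work 5) 0 = -1 ∧ ∀ i' : Fin I.k, (i' : ℕ) < i → B (I.idx i') ≠ none) ∨
  ∃ i₀ : Fin I.k, (i₀ : ℕ) < i ∧ B (I.idx i₀) = none ∧ s (.work 5) 0 = (i₀ : ℕ) ∧
    B.IsRange (I.idx i₀) (s (.work 6) 0) (s (.work 7) 0) ∧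
    ∀ i' : Fin I.k, (i' : ℕ) < i → B (I.idx i') = none → ∃ l u, B.IsRange (I.idx i') l u ∧
      s (.work 7) 0 - s (.work 6) 0 ≤ u - l

def scanMods : List Arr :=
  [.qC, .work 5, .work 6, .work 7, .work 8, .work 9, .work 10, .work 15, .ansStatus, .ansPoint]

open Classical in
/-- The number of unbounded variables among the first `i` ones. -/
def IQP.Node.free (B : I.Node) (i : ℕ) : ℕ :=
  Nat.count (fun j => ∃ h : j < I.k, B (I.idx ⟨j, h⟩) = none) i

theorem runs_setSel (hK : 4 ≤ K) (s : State) :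
    ∃ s', Runs O K setSel s [] s' 5 ∧ SameOff [.work 5, .work 6, .work 7] s s' ∧
      s' (.work 5) 0 = s (.work 8) 0 ∧ s' (.work 6) 0 = s (.work 15) 0 ∧
      s' (.work 7) 0 = s .ansPoint (s (.work 8) 0) := by
  have h1 := Runs.store (O := O) hK (a := .work 5) (i := .const 0) (e := var 8) (s := s) (by simp)
    (fun A hA => hA.1 _ _)
  have h2 := Runs.store (O := O) hK (a := .work 6) (i := .const 0) (e := var 15)
    (s := s.set (.work 5) 0 (s (.work 8) 0)) (by simp) (fun A hA => hA.1 _ _)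
  have h3 := Runs.store (O := O) hK (a := .work 7) (i := .const 0) (e := .load .ansPoint (var 8))
    (s := (s.set (.work 5) 0 (s (.work 8) 0)).set (.work 6) 0 (s (.work 15) 0)) (by simp)
    (fun A hA => hA.1 _ _)
  simp only [Expr.eval] at h1 h2 h3
  rw [State.set_of_ne (by simp)] at h2
  rw [State.set_of_ne (by simp), State.set_of_ne (by simp), State.set_of_ne (by simp),
    State.set_of_ne (by simp)] at h3
  refine ⟨_, h1.seq (h2.seq h3), ?_, ?_, ?_, ?_⟩
  · exact ((SameOff.set_right s (by simp) _ _).set (by simp) _ _).set (by simp) _ _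
  · rw [State.set_of_ne (by simp), State.set_of_ne (by simp), State.set_self_same]
  · rw [State.set_of_ne (by simp), State.set_self_same]
  · rw [State.set_self_same]

end ConcaveIQP

/-! ### Correctness of the scan. -/

namespace ConcaveIQP

open IQP State

variable {O : ILPSolver} {K : ℕ} {I : IQP} {g : ℤ}

theorem IQP.Node.free_succ_of_none {B : I.Node} (i : Fin I.k) (h : B (I.idx i) = none) :
    B.free (i + 1) = B.free i + 1 := by
  classical
  unfold IQP.Node.free
  rw [Nat.count_succ, if_pos ⟨i.2, h⟩]

theorem Found.congr {B : I.Node} {i : ℕ} {s s' : State} (h : Found B i s)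
    (h5 : s' (.work 5) = s (.work 5)) (h6 : s' (.work 6) = s (.work 6))
    (h7 : s' (.work 7) = s (.work 7)) : Found B i s' := by
  unfold Found at *
  rwa [h5, h6, h7]

theorem Failed.congr {B : I.Node} {s s' : State} (h : Failed B s)
    (h5 : s' .ansStatus = s .ansStatus) : Failed B s' := by
  unfold Failed at *
  rwa [h5]

theorem lt_succ_cases {k : ℕ} {i i' : Fin k} (h : (i' : ℕ) < i + 1) : (i' : ℕ) < i ∨ i' = i := by
  rcases Nat.lt_succ_iff_lt_or_eq.1 h with h | h
  · exact .inl h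
  · exact .inr (Fin.ext h)

theorem Found.succ_of_ne_none {B : I.Node} {i : Fin I.k} {s : State} (h : Found B i s)
    (hi : B (I.idx i) ≠ none) : Found B (i + 1) s := by
  rcases h with ⟨h1, h2⟩ | ⟨i₀, h1, h2, h3, h4, h5⟩
  · refine .inl ⟨h1, fun i' hi' => ?_⟩
    rcases lt_succ_cases hi' with h | rfl
    · exact h2 i' h
    · exact hi
  · refine .inr ⟨i₀, by omega, h2, h3, h4, fun i' hi' hn => ?_⟩
    rcases lt_succ_cases hi' with h | rfl
    · exact h5 i' h hn
    · exact absurd hn hi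

/-- `work 10` tells whether the scan has failed. -/
def ScanState (B : I.Node) (i : ℕ) (s : State) : Prop :=
  (s (.work 10) 0 = 1 ∧ Found B i s) ∨ (s (.work 10) 0 = 0 ∧ Failed B s)

theorem Found.update {B : I.Node} {i : Fin I.k} {s s' : State} {l u : ℤ} (h : Found B i s)
    (hi : B (I.idx i) = none) (hr : B.IsRange (I.idx i) l u)
    (hlt : s (.work 5) 0 = -1 ∨ u - l < s (.work 7) 0 - s (.work 6) 0)
    (h5 : s' (.work 5) 0 = (i : ℕ)) (h6 : s' (.work 6) 0 = l) (h7 : s' (.work 7) 0 = u) :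
    Found B (i + 1) s' := by
  refine .inr ⟨i, by omega, hi, h5, by rwa [h6, h7], fun i' hi' hn => ?_⟩
  rw [h6, h7]
  rcases lt_succ_cases hi' with h' | rfl
  · rcases h with ⟨h1, h2⟩ | ⟨i₀, h1, h2, h3, h4, h5'⟩
    · exact absurd hn (h2 i' h')
    · obtain ⟨l', u', hr', hle⟩ := h5' i' h' hn
      refine ⟨l', u', hr', ?_⟩
      rcases hlt with h | h
      · rw [h3] at h; omega
      · omega
  · exact ⟨l, u, hr, le_rfl⟩

theorem Found.keep {B : I.Node} {i : Fin I.k} {s : State} {l u : ℤ} (h : Found B i s)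
    (hr : B.IsRange (I.idx i) l u)
    (h5 : 0 ≤ s (.work 5) 0) (hle : s (.work 7) 0 - s (.work 6) 0 ≤ u - l) :
    Found B (i + 1) s := by
  rcases h with ⟨h1, h2⟩ | ⟨i₀, h1, h2, h3, h4, h5⟩
  · omega
  · refine .inr ⟨i₀, by omega, h2, h3, h4, fun i' hi' hn => ?_⟩
    rcases lt_succ_cases hi' with h | rfl
    · exact h5 i' h hn
    · exact ⟨l, u, hr, hle⟩

def scanBodyMods : List Arr :=
  [.qC, .work 5, .work 6, .work 7, .work 9, .work 10, .work 15, .ansStatus, .ansPoint]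

/-- At most two queries, and only for an unbounded variable, which is exactly when `free` grows by
one. After a failure the body does nothing, so the solver's status survives until the end of the
scan. -/
theorem runs_scanBody (hK : WordLength I g K) {s : State} {B : I.Node} (hs : Static I g s)
    (hB : Cur B s) (hOK : B.OK g) (i : Fin I.k) (hi : s (.work 8) 0 = (i : ℕ))
    (hst : ScanState B i s) :
    ∃ s' L, Runs O K scanBody s L s' (I.n * 8 + 40) ∧ SameOff scanBodyMods s s' ∧
      (∀ Q ∈ L, I.GoodQuery Q) ∧ L.length + 2 * B.free i ≤ 2 * B.free (i + 1) ∧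
      ScanState B (i + 1) s' := by
  have h4 := hK.four_le
  have hmono : B.free i ≤ B.free (i + 1) := by
    unfold IQP.Node.free; exact Nat.count_monotone _ (Nat.le_succ _)
  rcases hst with ⟨h10, hfound⟩ | ⟨h10, hfail⟩
  swap
  · exact ⟨s, [], (Runs.branch_nonpos h4 (by simp [Expr.eval, h10]) (Runs.skip h4 s)).mono
      (by omega), SameOff.refl _ _, by simp, by simpa using hmono, .inr ⟨h10, hfail⟩⟩
  by_cases hn : B (I.idx i) = none
  swap
  · refine ⟨s, [], (Runs.branch_pos h4 (by simp [Expr.eval, h10])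
      (Runs.branch_pos h4 ?_ (Runs.skip h4 s))).mono (by omega), SameOff.refl _ _, by simp,
      by simpa using hmono, .inl ⟨h10, hfound.succ_of_ne_none hn⟩⟩
    have := hB.eq (I.idx i)
    by_contra hneg
    simp only [Expr.eval, hi] at hneg
    rw [if_neg (by simpa [IQP.idx] using hneg)] at this
    exact hn this
  have hflag : s .qLoFlag (i : ℕ) ≤ 0 := by
    have := hB.eq (I.idx i)
    by_contra hpos
    rw [if_pos (by simpa [IQP.idx] using hpos), hn] at this
    simp at this
  have hfree := B.free_succ_of_none i hn
  have hgood : ∀ σ : ℤ, σ.natAbs = 1 → I.GoodQuery (B.ilp (Pi.single (I.idx i) σ)) := fun σ hσ =>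
    hOK.goodQuery_single _ hσ
  -- failure sets the flag
  have hfailrun : ∀ s₁ : State, Failed B s₁ →
      ∃ s₂, Runs O K (.store (.work 10) (.const 0) (.const 0)) s₁ [] s₂ 1 ∧
        SameOff [.work 10] s₁ s₂ ∧ ScanState B (i + 1) s₂ := by
    intro s₁ hf
    refine ⟨_, Runs.store h4 (by simp) (fun A _ => ?_), SameOff.set_right _ (by simp) _ _,
      .inr ⟨State.set_self_same _ _ _ _, hf.congr (State.set_of_ne (by simp) _ _ _)⟩⟩
    have : bitLen 0 ≤ 4 := bitLen_le_four (by simp)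
    simp only [Expr.eval]; omega
  obtain ⟨s₂, hrun₂, hoff₂, hout₂⟩ := runs_rangeQuery (O := O) hK hs hB hOK (σ := 1) (.inl rfl) i hi
  rcases hout₂.range rfl with ⟨hp, hf⟩ | ⟨hp, x, hx, hxi, hxmin⟩
  · obtain ⟨s₃, hrun₃, hoff₃, hst₃⟩ := hfailrun s₂ hf
    refine ⟨s₃, _, (Runs.branch_pos h4 (by simp [Expr.eval, h10])
      (Runs.branch_nonpos h4 (by simpa [Expr.eval, hi] using hflag)
        (hrun₂.seq (Runs.branch_nonpos h4 hp hrun₃)))).mono (by omega),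
      (hoff₂.mono (by simp [scanBodyMods])).trans (hoff₃.mono (by simp [scanBodyMods])),
      by simpa using hgood 1 rfl, by simp; omega, hst₃⟩
  have hw8₂ : s₂ (.work 8) = s (.work 8) := hoff₂ _ (by simp)
  have hrun₃ := Runs.store (O := O) h4 (a := .work 15) (i := .const 0)
    (e := .load .ansPoint (var 8)) (s := s₂) (by simp) (fun A hA => hA.1 _ _)
  simp only [Expr.eval, hw8₂, hi, hxi] at hrun₃
  set s₃ := s₂.set (.work 15) 0 (x (I.idx i)) with hs₃
  have hoff₃ : SameOff scanBodyMods s s₃ := by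
    refine (hoff₂.mono ?_).set ?_ _ _ <;> simp [scanBodyMods]
  obtain ⟨s₄, hrun₄, hoff₄, hout₄⟩ := runs_rangeQuery (O := O) hK (s := s₃) (B := B)
    (hs.of_sameOff hoff₃ (by simp [scanBodyMods])) (hB.of_sameOff hoff₃ (by simp [scanBodyMods]))
    hOK (σ := -1) (.inr rfl) i (by rw [hoff₃ (.work 8) (by simp [scanBodyMods]), hi])
  have hoff₄' : SameOff scanBodyMods s s₄ := hoff₃.trans (hoff₄.mono (by simp [scanBodyMods]))
  rcases hout₄.range rfl with ⟨hp', hf'⟩ | ⟨hp', y, hy, hyi, hymax⟩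
  · obtain ⟨s₅, hrun₅, hoff₅, hst₅⟩ := hfailrun s₄ hf'
    refine ⟨s₅, _, (Runs.branch_pos h4 (by simp [Expr.eval, h10])
      (Runs.branch_nonpos h4 (by simpa [Expr.eval, hi] using hflag)
        (hrun₂.seq (Runs.branch_pos h4 hp (hrun₃.seq (hrun₄.seq
          (Runs.branch_nonpos h4 hp' hrun₅))))))).mono (by omega),
      hoff₄'.trans (hoff₅.mono (by simp [scanBodyMods])), ?_, by simp; omega, hst₅⟩
    simpa using ⟨hgood 1 rfl, hgood (-1) rfl⟩
  have hrange : B.IsRange (I.idx i) (x (I.idx i)) (y (I.idx i)) :=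
    ⟨⟨x, hx, rfl⟩, ⟨y, hy, rfl⟩, fun z hz => ⟨by linarith [hxmin z hz], by linarith [hymax z hz]⟩⟩
  have hw : ∀ a ∈ [Arr.work 5, .work 6, .work 7, .work 8, .work 10], s₄ a = s a := by
    intro a ha
    simp only [List.mem_cons, List.not_mem_nil, or_false] at ha
    have h1 : s₄ a = s₃ a := hoff₄ a (by rcases ha with rfl | rfl | rfl | rfl | rfl <;> simp)
    have h2 : s₃ a = s₂ a := State.set_of_ne (by rcases ha with rfl | rfl | rfl | rfl | rfl <;> simp) _ _ _
    have h3 : s₂ a = s a := hoff₂ a (by rcases ha with rfl | rfl | rfl | rfl | rfl <;> simp)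
    rw [h1, h2, h3]
  have hw5 := hw (.work 5) (by simp)
  have hw6 := hw (.work 6) (by simp)
  have hw7 := hw (.work 7) (by simp)
  have hw8 := hw (.work 8) (by simp)
  have hw10 := hw (.work 10) (by simp)
  have hw15 : s₄ (.work 15) 0 = x (I.idx i) := by
    rw [hoff₄ (.work 15) (by simp), hs₃, State.set_self_same]
  have hfound₄ : Found B i s₄ := hfound.congr hw5 hw6 hw7
  -- the update
  have key : ∃ s₅, Runs O K (.branch (.add (var 5) (.const 1))
      (.branch (.sub (.sub (var 7) (var 6)) (.sub (.load .ansPoint (var 8)) (var 15)))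
        setSel .skip) setSel) s₄ [] s₅ 7 ∧ SameOff [.work 5, .work 6, .work 7] s₄ s₅ ∧
      Found B (i + 1) s₅ := by
    obtain ⟨s₅, hrun₅, hoff₅, h5, h6, h7⟩ := runs_setSel (O := O) h4 s₄
    rw [hw8, hi] at h5 h7
    rw [hw15] at h6
    rw [hyi] at h7
    by_cases hsel : 0 ≤ s₄ (.work 5) 0
    · by_cases hlt : y (I.idx i) - x (I.idx i) < s₄ (.work 7) 0 - s₄ (.work 6) 0
      · refine ⟨s₅, Runs.branch_pos h4 ?_ (Runs.branch_pos h4 ?_ hrun₅), hoff₅,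
          hfound₄.update hn hrange (.inr hlt) h5 h6 h7⟩
        · simp only [Expr.eval]; omega
        · simp only [Expr.eval, hw8, hi, hyi, hw15]; omega
      · refine ⟨s₄, (Runs.branch_pos h4 ?_ (Runs.branch_nonpos h4 ?_ (Runs.skip h4 s₄))).mono
          (by omega), SameOff.refl _ _, hfound₄.keep hrange hsel (by omega)⟩
        · simp only [Expr.eval]; omega
        · simp only [Expr.eval, hw8, hi, hyi, hw15]; omega
    · refine ⟨s₅, (Runs.branch_nonpos h4 ?_ hrun₅).mono (by omega), hoff₅,
        hfound₄.update hn hrange (.inl ?_) h5 h6 h7⟩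
      · simp only [Expr.eval]; omega
      · rcases hfound₄ with ⟨h, -⟩ | ⟨i₀, -, -, h, -⟩
        · exact h
        · omega
  obtain ⟨s₅, hrun₅, hoff₅, hfound₅⟩ := key
  refine ⟨s₅, _, (Runs.branch_pos h4 (by simp [Expr.eval, h10])
    (Runs.branch_nonpos h4 (by simpa [Expr.eval, hi] using hflag)
      (hrun₂.seq (Runs.branch_pos h4 hp (hrun₃.seq (hrun₄.seq
        (Runs.branch_pos h4 hp' hrun₅))))))).mono (by omega),
    hoff₄'.trans (hoff₅.mono (by simp [scanBodyMods])), ?_, by simp; omega,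
    .inl ⟨by rw [hoff₅ (.work 10) (by simp), hw10, h10], hfound₅⟩⟩
  simpa using ⟨hgood 1 rfl, hgood (-1) rfl⟩

/-- Scan all nonlinear variables. -/
def scan : Prog :=
  .seq (.store (.work 5) (.const 0) (.const (-1)))
    (.seq (.store (.work 10) (.const 0) (.const 1)) (forUpTo 8 (dim 2) scanBody))

theorem runs_scan (hK : WordLength I g K) {s : State} {B : I.Node} (hs : Static I g s)
    (hB : Cur B s) (hOK : B.OK g) :
    ∃ s' L, Runs O K scan s L s' (I.k * (I.n * 8 + 43) + 7) ∧ SameOff scanMods s s' ∧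
      (∀ Q ∈ L, I.GoodQuery Q) ∧ L.length ≤ 2 * B.free I.k ∧ ScanState B I.k s' := by
  have h4 := hK.four_le
  have hrun₁ := Runs.store (O := O) h4 (a := .work 5) (i := .const 0) (e := .const (-1)) (s := s)
    (by simp) (fun A _ => by
      have : bitLen (-1) ≤ 4 := bitLen_le_four (by simp)
      simp only [Expr.eval]; omega)
  have hrun₂ := Runs.store (O := O) h4 (a := .work 10) (i := .const 0) (e := .const 1)
    (s := s.set (.work 5) 0 (-1)) (by simp) (fun A _ => by
      have : bitLen 1 ≤ 4 := bitLen_le_four (by simp)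
      simp only [Expr.eval]; omega)
  simp only [Expr.eval] at hrun₁ hrun₂
  set s₂ := (s.set (.work 5) 0 (-1)).set (.work 10) 0 1 with hs₂
  have hoff₂ : SameOff scanMods s s₂ := by
    refine (SameOff.set_right s ?_ _ _).set ?_ _ _ <;> simp [scanMods]
  obtain ⟨s₃, L, hrun₃, hoff₃, hgood, hlen, hst⟩ := Runs.for_rule (O := O) h4 (c := 8)
    (bound := dim 2) (body := scanBody) I.k hK.k_le (I.n * 8 + 40)
    (fun i s' L => SameOff scanMods s s' ∧ (∀ Q ∈ L, I.GoodQuery Q) ∧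
      L.length ≤ 2 * B.free i ∧ ScanState B i s') s₂
    ⟨hoff₂.set (by simp [scanMods]) _ _, by simp, by simp, .inl ⟨by
      rw [State.set_of_ne (by simp)]; exact State.set_self_same _ _ _ _, .inl ⟨by
        rw [State.set_of_ne (by simp), hs₂, State.set_of_ne (by simp), State.set_self_same],
        by simp⟩⟩⟩
    (fun i s' L h => (hs.of_sameOff h.1 (by simp [scanMods])).dim_two)
    (fun i hi s' L ⟨h1, h2, h3, hst⟩ h8 => by
      obtain ⟨s'', L', hrun, hoff, hg, hl, hst'⟩ := runs_scanBody (O := O) hK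
        (hs.of_sameOff h1 (by simp [scanMods])) (hB.of_sameOff h1 (by simp [scanMods])) hOK
        ⟨i, hi⟩ h8 hst
      refine ⟨s'', L', hrun, ?_, ?_, ?_, ?_, ?_⟩
      · rw [hoff (.work 8) (by simp [scanBodyMods]), h8]
      · exact (h1.trans (hoff.mono (by simp [scanBodyMods, scanMods]))).set (by simp [scanMods]) _ _
      · intro Q hQ
        rcases List.mem_append.1 hQ with h | h
        · exact h2 Q h
        · exact hg Q h
      · rw [List.length_append]
        simp only at hl
        omega
      · rcases hst' with ⟨h, h'⟩ | ⟨h, h'⟩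
        · refine .inl ⟨by rw [State.set_of_ne (by simp), h], h'.congr ?_ ?_ ?_⟩ <;>
            exact State.set_of_ne (by simp) _ _ _
        · exact .inr ⟨by rw [State.set_of_ne (by simp), h],
            h'.congr (State.set_of_ne (by simp) _ _ _)⟩)
  exact ⟨s₃, L, (hrun₁.seq (hrun₂.seq hrun₃)).mono
    (by rw [show I.n * 8 + 40 + 3 = I.n * 8 + 43 from rfl]; omega), hoff₃, hgood, hlen, hst⟩

end ConcaveIQP

namespace ConcaveIQP

open IQP State

variable {O : ILPSolver} {K : ℕ} {I : IQP} {g : ℤ}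

/-- The sum is at most `N * 2 ^ b < 2 ^ (N + b)`. The crude term `N` is affordable, since the
dimensions count fully in the size of an instance. -/
theorem bitLen_sum_range_le (val : ℕ → ℤ) (b : ℕ) :
    ∀ N : ℕ, (∀ j < N, bitLen (val j) ≤ b) → bitLen (∑ j ∈ Finset.range N, val j) ≤ N + b + 1 := by
  intro N h
  rw [bitLen_le_iff]
  have h1 : (∑ j ∈ Finset.range N, val j).natAbs ≤ N * 2 ^ b := by
    refine (Int.natAbs_sum_le _ _).trans ?_
    refine (Finset.sum_le_card_nsmul _ _ (2 ^ b) fun j hj => ?_).trans (by simp)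
    exact (natAbs_lt_two_pow (h j (Finset.mem_range.1 hj))).le
  rw [pow_add]
  exact h1.trans_lt (Nat.mul_lt_mul_of_pos_right Nat.lt_two_pow_self (by positivity))

theorem Static.h_eq {s : State} (hs : Static I g s) (j : Fin I.n) : s .inH (j : ℕ) = I.h j := by
  rw [hs.inH]
  exact State.entry_natCast _ _ _

theorem Static.q_eq {s : State} (hs : Static I g s) (i : Fin I.k) : s .inQ (i : ℕ) = I.q i := by
  rw [hs.inQ]
  exact State.entry_natCast _ _ _

/-! ## Loading a node from the stack -/

/-- The node stored at position `t` of the stack. -/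
def stackNode (I : IQP) (s : State) (t : ℕ) : I.Node := fun j =>
  if (j : ℕ) < I.k ∧ 0 < s (.work 2) ((t : ℤ) * I.k + (j : ℕ)) then
    some (s (.work 3) ((t : ℤ) * I.k + (j : ℕ)), s (.work 4) ((t : ℤ) * I.k + (j : ℕ))) else none

theorem stackNode_congr {s s' : State} (t : ℕ)
    (h : ∀ a ∈ [Arr.work 2, .work 3, .work 4], ∀ j < I.k,
      s' a ((t : ℤ) * I.k + (j : ℕ)) = s a ((t : ℤ) * I.k + (j : ℕ))) :
    stackNode I s' t = stackNode I s t := by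
  funext j
  unfold stackNode
  by_cases hj : (j : ℕ) < I.k
  · rw [h (.work 2) (by simp) j hj, h (.work 3) (by simp) j hj, h (.work 4) (by simp) j hj]
  · simp [hj]

/-- The position of the entry `work 8` of the node `work 1` on the stack. -/
abbrev stackPos (e : Expr) : Expr := .add (.mul (var 1) (dim 2)) e

def loadArr (a b : Arr) : Prog := fill 8 (dim 2) a (var 8) (.load b (stackPos (var 8)))

/-- Only the first `k` entries are written, so the zero flags of the purely linear variables
survive, as `Static` demands. -/
theorem runs_loadArr (hK : WordLength I g K) {s : State} (hs : Static I g s) {t : ℕ}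
    (ht : s (.work 1) 0 = t) (a : Arr)
    (ha : a ∈ [Arr.qLoFlag, .qHiFlag, .qLo, .qHi]) (b : Arr)
    (hb : b ∈ [Arr.work 2, .work 3, .work 4]) :
    ∃ s', Runs O K (loadArr a b) s [] s' (I.k * 4 + 3) ∧ SameOff [a, .work 8] s s' ∧
      Static I g s' ∧ ∀ j < I.k, s' a (j : ℕ) = s b ((t : ℤ) * I.k + (j : ℕ)) := by
  have h4 := hK.four_le
  simp only [List.mem_cons, List.not_mem_nil, or_false] at ha hb
  have hane : a ≠ .ansPoint ∧ a ≠ .work 8 ∧ a ≠ .inDim ∧ a ≠ .work 1 := by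
    rcases ha with rfl | rfl | rfl | rfl <;> simp
  have hbne : b ≠ a ∧ b ≠ .work 8 := by
    rcases hb with rfl | rfl | rfl <;> rcases ha with rfl | rfl | rfl | rfl <;> simp
  have hd2 : ∀ s₁, SameOff [a, .work 8] s s₁ → (dim 2).eval s₁ = I.k := by
    intro s₁ h
    rw [← hs.dim_two]
    exact congrFun (h .inDim (by simp [hane.2.2.1.symm])) 2
  have hev : ∀ j < I.k, ∀ s₁, SameOff [a, .work 8] s s₁ → s₁ (.work 8) 0 = (j : ℤ) →
      (Expr.load b (stackPos (var 8))).eval s₁ = s b ((t : ℤ) * I.k + (j : ℕ)) := by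
    intro j _ s₁ h hj
    have h1 := hd2 s₁ h
    have h2 : s₁ (.work 1) = s (.work 1) := h _ (by simp [hane.2.2.2.symm])
    have h3 : s₁ b = s b := h _ (by simp [hbne])
    simp only [Expr.eval] at h1 ⊢
    rw [h3, h1, h2, ht, hj]
  obtain ⟨s', hrun, hoff, hval, hother⟩ := Runs.fill_rule (O := O) h4 (c := 8) (bound := dim 2)
    (a := a) (ie := var 8) (e := .load b (stackPos (var 8))) I.k hK.k_le 0
    (fun j => s b ((t : ℤ) * I.k + (j : ℕ))) s hane.1 hane.2.1 hd2
    (fun j _ s₁ _ h => by simpa [Expr.eval] using h) (fun j hj s₁ h h8 _ => hev j hj s₁ h h8)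
    (fun j hj s₁ h h8 _ A hA => by
      rw [← hev j hj s₁ h h8]
      exact hA.1 _ _)
    (by decide) (by decide) (by
      rcases hb with rfl | rfl | rfl <;> decide)
  refine ⟨s', hrun, hoff, ?_, fun j hj => by simpa using hval j hj⟩
  have hkeep : ∀ a' ∈ [Arr.inDim, .inQ, .inH, .qDim, .qA, .qB, .work 0], s' a' = s a' := by
    intro a' ha'
    refine hoff a' ?_
    simp only [List.mem_cons, List.not_mem_nil, or_false] at ha'
    rcases ha with rfl | rfl | rfl | rfl <;>
      rcases ha' with rfl | rfl | rfl | rfl | rfl | rfl | rfl <;> simp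
  simp only [List.forall_mem_cons] at hkeep
  obtain ⟨k1, k2, k3, k4, k5, k6, k7, -⟩ := hkeep
  have hflag : ∀ a', a' ≠ .work 8 → ∀ j : ℕ, I.k ≤ j → s a' j = 0 → s' a' j = 0 := by
    intro a' h8 j hj h0
    by_cases haa : a' = a
    · subst haa
      rw [hother _ (fun j' hj' => by omega), h0]
    · rw [hoff a' (by simp [haa, h8]), h0]
  exact ⟨k1 ▸ hs.inDim, k2 ▸ hs.inQ, k3 ▸ hs.inH, k4 ▸ hs.qDim_zero, k4 ▸ hs.qDim_one,
    k5 ▸ hs.qA, k6 ▸ hs.qB, fun j hj => hflag _ (by simp) j hj (hs.loFlag j hj),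
    fun j hj => hflag _ (by simp) j hj (hs.hiFlag j hj), k7 ▸ hs.gval⟩

/-- Copy the node `work 1` of the stack to the query arrays. -/
def loadNode : Prog :=
  .seq (loadArr .qLoFlag (.work 2)) (.seq (loadArr .qHiFlag (.work 2))
    (.seq (loadArr .qLo (.work 3)) (loadArr .qHi (.work 4))))

def loadMods : List Arr := [.qLoFlag, .qHiFlag, .qLo, .qHi, .work 8]

theorem runs_loadNode (hK : WordLength I g K) {s : State} (hs : Static I g s) {t : ℕ}
    (ht : s (.work 1) 0 = t) :
    ∃ s', Runs O K loadNode s [] s' (I.k * 16 + 15) ∧ SameOff loadMods s s' ∧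
      Static I g s' ∧ Cur (stackNode I s t) s' := by
  obtain ⟨s₁, r₁, o₁, st₁, v₁⟩ := runs_loadArr (O := O) hK hs ht .qLoFlag (by simp) (.work 2)
    (by simp)
  obtain ⟨s₂, r₂, o₂, st₂, v₂⟩ := runs_loadArr (O := O) hK st₁ (t := t)
    (by rw [o₁ (.work 1) (by simp), ht]) .qHiFlag (by simp) (.work 2) (by simp)
  obtain ⟨s₃, r₃, o₃, st₃, v₃⟩ := runs_loadArr (O := O) hK st₂ (t := t)
    (by rw [o₂ (.work 1) (by simp), o₁ (.work 1) (by simp), ht]) .qLo (by simp) (.work 3)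
    (by simp)
  obtain ⟨s₄, r₄, o₄, st₄, v₄⟩ := runs_loadArr (O := O) hK st₃ (t := t)
    (by rw [o₃ (.work 1) (by simp), o₂ (.work 1) (by simp), o₁ (.work 1) (by simp), ht]) .qHi
    (by simp) (.work 4) (by simp)
  have e1 : s₄ .qLoFlag = s₁ .qLoFlag := by
    rw [o₄ _ (by simp), o₃ _ (by simp), o₂ _ (by simp)]
  have e2 : s₄ .qHiFlag = s₂ .qHiFlag := by
    rw [o₄ _ (by simp), o₃ _ (by simp)]
  have e3 : s₄ .qLo = s₃ .qLo := o₄ _ (by simp)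
  have f2 : s₁ (.work 2) = s (.work 2) := o₁ _ (by simp)
  have f3 : s₂ (.work 3) = s (.work 3) := by rw [o₂ _ (by simp), o₁ _ (by simp)]
  have f4 : s₃ (.work 4) = s (.work 4) := by rw [o₃ _ (by simp), o₂ _ (by simp), o₁ _ (by simp)]
  refine ⟨s₄, (r₁.seq (r₂.seq (r₃.seq r₄))).mono (by omega), ?_, st₄, fun j => ?_, fun j => ?_⟩
  · refine (((o₁.mono ?_).trans (o₂.mono ?_)).trans (o₃.mono ?_)).trans (o₄.mono ?_) <;>
      simp [loadMods]
  · unfold stackNode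
    by_cases hj : (j : ℕ) < I.k
    · rw [e1, v₁ j hj, e3, v₃ j hj, v₄ j hj, f3, f4]
      simp [hj]
    · rw [st₄.loFlag j (by omega)]
      simp [hj]
  · by_cases hj : (j : ℕ) < I.k
    · rw [e1, e2, v₁ j hj, v₂ j hj, f2]
    · rw [st₄.loFlag j (by omega), st₄.hiFlag j (by omega)]

/-! ## Leaves -/

theorem IQP.Node.chord_idx (B : I.Node) (i : Fin I.k) :
    B.chord (I.idx i) = I.h (I.idx i) - I.q i * (B.lo (I.idx i) + B.hi (I.idx i)) := by
  unfold IQP.Node.chord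
  rw [Finset.sum_eq_single i]
  · simp
  · intro b _ hb
    rw [if_neg fun h => hb (I.idx_injective h)]
  · simp

theorem IQP.Node.chord_of_le (B : I.Node) (j : Fin I.n) (hj : I.k ≤ j) : B.chord j = I.h j := by
  unfold IQP.Node.chord
  rw [Finset.sum_eq_zero, sub_zero]
  intro i _
  rw [if_neg]
  rintro rfl
  have := i.2
  simp only [idx, Fin.val_castLE] at hj
  omega

theorem Cur.lo_hi {B : I.Node} {s : State} (hB : Cur B s) (hfull : B.Full) (i : Fin I.k) :
    s .qLo (i : ℕ) = B.lo (I.idx i) ∧ s .qHi (i : ℕ) = B.hi (I.idx i) := by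
  have h1 := hB.eq (I.idx i)
  have h2 := hfull.eq_some i
  rw [h2] at h1
  split_ifs at h1
  simp only [Option.some.injEq, Prod.mk.injEq] at h1
  exact ⟨h1.1.symm, h1.2.symm⟩

/-- Store the linear underestimator as the objective of the query. -/
def leafObjective : Prog :=
  .seq (fill 9 (dim 0) .qC (var 9) (.load .inH (var 9)))
    (fill 8 (dim 2) .qC (var 8) (.sub (.load .qC (var 8))
      (.mul (.load .inQ (var 8)) (.add (.load .qLo (var 8)) (.load .qHi (var 8))))))

/-- The linear part `h` is copied first; the chord slopes are then subtracted in place on the first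
`k` entries. -/
theorem runs_leafObjective (hK : WordLength I g K) {s : State} {B : I.Node} (hs : Static I g s)
    (hB : Cur B s) (hOK : B.OK g) (hfull : B.Full) :
    ∃ s', Runs O K leafObjective s [] s' (I.n * 4 + I.k * 4 + 7) ∧
      SameOff [.qC, .work 8, .work 9] s s' ∧ ∀ j : Fin I.n, s' .qC (j : ℕ) = B.chord j := by
  have h4 := hK.four_le
  obtain ⟨s₁, r₁, o₁, v₁, -⟩ := Runs.fill_rule (O := O) h4 (c := 9) (bound := dim 0)
    (a := .qC) (ie := var 9) (e := .load .inH (var 9)) I.n hK.n_le 0 (fun j => s .inH j) s (by simp)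
    (by simp) (fun s₁ h => (hs.of_sameOff h).dim_zero)
    (fun j _ s₁ _ h => by simpa [Expr.eval] using h)
    (fun j _ s₁ h h9 _ => by simp only [Expr.eval]; rw [h9, h .inH (by simp)])
    (fun j _ s₁ h _ _ A hA => by
      rw [← h .inH (by simp)]
      exact hA.1 _ _)
  have hs₁ := hs.of_sameOff o₁
  have hB₁ := hB.of_sameOff o₁
  have hC : ∀ j : Fin I.n, s₁ .qC (j : ℕ) = I.h j := fun j => by
    have := v₁ j j.2
    rw [zero_add] at this
    rw [this, hs.h_eq]
  obtain ⟨s₂, r₂, o₂, v₂, w₂⟩ := Runs.fill_rule (O := O) h4 (c := 8) (bound := dim 2)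
    (a := .qC) (ie := var 8) (e := .sub (.load .qC (var 8))
      (.mul (.load .inQ (var 8)) (.add (.load .qLo (var 8)) (.load .qHi (var 8))))) I.k hK.k_le 0
    (fun j => if h : j < I.k then B.chord (I.idx ⟨j, h⟩) else 0) s₁ (by simp)
    (by simp) (fun s₁ h => (hs₁.of_sameOff h).dim_two)
    (fun j _ s₁ _ h => by simpa [Expr.eval] using h)
    (fun j hj s' h h8 hsame => by
      rw [zero_add] at hsame
      have hs' := hs₁.of_sameOff h
      obtain ⟨hl, hh⟩ := (hB₁.of_sameOff h).lo_hi hfull ⟨j, hj⟩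
      have hq := hs'.q_eq ⟨j, hj⟩
      have hc := hC (I.idx ⟨j, hj⟩)
      simp only [idx, Fin.val_castLE] at hc
      simp only [Expr.eval, h8, hsame, dif_pos hj, Node.chord_idx]
      rw [hc, hq, hl, hh]
      rfl)
    (fun j hj s' h _ _ A _ => by
      rw [dif_pos hj]
      exact (hOK.bitLen_chord_le _).trans (hK.entry_le.trans (by omega)))
  refine ⟨s₂, (r₁.seq r₂).mono (by omega), (o₁.mono (by simp)).trans (o₂.mono (by simp)), fun j => ?_⟩
  by_cases hj : (j : ℕ) < I.k
  · have := v₂ j hj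
    rw [zero_add, dif_pos hj] at this
    rw [this]
    rfl
  · rw [w₂ _ fun j' hj' => by omega, hC, Node.chord_of_le _ _ (by omega)]

/-- Compute the objective value of the point in the answer array in `work 11`. -/
def evalObjective : Prog :=
  .seq (.store (.work 11) (.const 0) (.const 0))
    (.seq (forUpTo 9 (dim 0) (.store (.work 11) (.const 0) (.add (var 11)
        (.mul (.load .inH (var 9)) (.load .ansPoint (var 9))))))
      (forUpTo 8 (dim 2) (.store (.work 11) (.const 0) (.add (var 11)
        (.sub (.const 0) (.mul (.load .inQ (var 8))
          (.mul (.load .ansPoint (var 8)) (.load .ansPoint (var 8)))))))))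

/-- Here the entries grow with the answers: the linear part takes about `A` bits, the squares about
`2 * A`, and the crude bound for their sum fits into the word length `K + 4 * A`. -/
theorem runs_evalObjective (hK : WordLength I g K) {s : State} (hs : Static I g s)
    {x : Fin I.n → ℤ} (hx : ∀ j : Fin I.n, s .ansPoint (j : ℕ) = x j) :
    ∃ s', Runs O K evalObjective s [] s' (I.n * 4 + I.k * 4 + 9) ∧
      SameOff [.work 8, .work 9, .work 11] s s' ∧ s' (.work 11) 0 = I.objective x := by
  have h4 := hK.four_le
  have hobj := hK.objective_le
  have r₁ := Runs.store (O := O) h4 (a := .work 11) (i := .const 0) (e := .const 0) (s := s)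
    (by simp) (fun A _ => by
      have : bitLen 0 ≤ 4 := bitLen_le_four (by simp)
      simp only [Expr.eval]; omega)
  simp only [Expr.eval] at r₁
  set s₁ := s.set (.work 11) 0 0 with hs₁def
  have o₁ : SameOff [.work 11] s s₁ := SameOff.set_right _ (by simp) _ _
  have hs₁ := hs.of_sameOff o₁
  have hv₁ : s₁ (.work 11) 0 = 0 := State.set_self_same _ _ _ _
  set val₁ : ℕ → ℤ := fun j => if h : j < I.n then I.h ⟨j, h⟩ * x ⟨j, h⟩ else 0 with hval₁
  have hx' : ∀ s', SameOff [.work 8, .work 9, .work 11] s s' → ∀ j : Fin I.n,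
      s' .ansPoint (j : ℕ) = x j := fun s' h j => by rw [h .ansPoint (by simp), hx]
  have hb₁ : ∀ s', SameOff [.work 8, .work 9, .work 11] s s' → ∀ A, s'.Bdd A (K + 4 * A) →
      ∀ j ≤ I.n, bitLen (∑ j' ∈ Finset.range j, val₁ j') ≤ I.n + I.size + A + 1 := by
    intro s' h A hA j hj
    refine (bitLen_sum_range_le val₁ (I.size + A) j fun j' hj' => ?_).trans (by omega)
    simp only [hval₁, dif_pos (hj'.trans_le hj)]
    have h1 := bitLen_mul_le (I.h ⟨j', hj'.trans_le hj⟩) (x ⟨j', hj'.trans_le hj⟩)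
    have h2 := bitLen_h_le (⟨j', hj'.trans_le hj⟩ : Fin I.n)
    have h3 := hA.2 (j' : ℕ)
    have h5 := hx' s' h ⟨j', hj'.trans_le hj⟩
    simp only at h5
    rw [h5] at h3
    omega
  have hsub : ∀ s', SameOff [.work 11, .work 9] s₁ s' →
      SameOff [.work 8, .work 9, .work 11] s s' := fun s' h =>
    (o₁.mono (by simp)).trans (h.mono (by simp))
  obtain ⟨s₂, r₂, o₂, v₂⟩ := Runs.sum_rule (O := O) h4 (c := 9) (d := 11) (bound := dim 0)
    (e := .mul (.load .inH (var 9)) (.load .ansPoint (var 9))) I.n (by norm_num) hK.n_le val₁ s₁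
    (fun s' h => (hs₁.of_sameOff h).dim_zero)
    (fun j hj s' h h9 => by
      have h5 := hx' s' (hsub s' h) ⟨j, hj⟩
      have h6 := (hs₁.of_sameOff h).h_eq ⟨j, hj⟩
      simp only [Expr.eval, h9, hval₁, dif_pos hj]
      rw [h5, h6])
    (fun j hj s' h A hA => by
      rw [hv₁, zero_add]
      exact (hb₁ s' (hsub s' h) A hA j hj).trans (by omega))
  rw [hv₁, zero_add] at v₂
  have hs₂ := hs₁.of_sameOff o₂
  set val₂ : ℕ → ℤ := fun j => if h : j < I.k then
    -(I.q ⟨j, h⟩) * x (I.idx ⟨j, h⟩) ^ 2 else 0 with hval₂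
  have hsub₂ : ∀ s', SameOff [.work 11, .work 8] s₂ s' →
      SameOff [.work 8, .work 9, .work 11] s s' := fun s' h =>
    (hsub s₂ o₂).trans (h.mono (by simp))
  obtain ⟨s₃, r₃, o₃, v₃⟩ := Runs.sum_rule (O := O) h4 (c := 8) (d := 11) (bound := dim 2)
    (e := .sub (.const 0) (.mul (.load .inQ (var 8))
          (.mul (.load .ansPoint (var 8)) (.load .ansPoint (var 8))))) I.k (by norm_num) hK.k_le
    val₂ s₂ (fun s' h => (hs₂.of_sameOff h).dim_two)
    (fun j hj s' h h8 => by
      have h5 := hx' s' (hsub₂ s' h) (I.idx ⟨j, hj⟩)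
      have h6 := (hs₂.of_sameOff h).q_eq ⟨j, hj⟩
      simp only [idx, Fin.val_castLE] at h5
      simp only [Expr.eval, h8, hval₂, dif_pos hj]
      rw [h5, h6]
      simp only [idx]
      ring)
    (fun j hj s' h A hA => by
      rw [v₂]
      have h1 := hb₁ s' (hsub₂ s' h) A hA I.n le_rfl
      have h2 : bitLen (∑ j' ∈ Finset.range j, val₂ j') ≤ j + (I.size + 2 * A) + 1 := by
        refine bitLen_sum_range_le val₂ _ j fun j' hj' => ?_
        have hjk := hj'.trans_le hj
        simp only [hval₂, dif_pos hjk]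
        have h3 := bitLen_mul_le (-(I.q ⟨j', hjk⟩)) (x (I.idx ⟨j', hjk⟩) ^ 2)
        have h5 := bitLen_mul_le (x (I.idx ⟨j', hjk⟩)) (x (I.idx ⟨j', hjk⟩))
        have h6 := bitLen_q_le (⟨j', hjk⟩ : Fin I.k)
        rw [bitLen_neg, sq] at h3
        rw [sq]
        have h7 := hA.2 (j' : ℕ)
        have h8 := hx' s' (hsub₂ s' h) (I.idx ⟨j', hjk⟩)
        simp only [idx, Fin.val_castLE] at h8
        rw [h8] at h7
        simp only [idx] at *
        omega
      have h3 := bitLen_add_le (∑ j' ∈ Finset.range I.n, val₁ j')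
        (∑ j' ∈ Finset.range j, val₂ j')
      omega)
  refine ⟨s₃, (r₁.seq (r₂.seq r₃)).mono (by omega), hsub₂ s₃ o₃, ?_⟩
  rw [v₃, v₂, Finset.sum_range, Finset.sum_range, add_comm]
  simp only [hval₁, hval₂, Fin.is_lt, dif_pos, Fin.eta]
  rfl

/-- The output arrays hold the feasible point `z`, and `work 12` its objective value. -/
def OutIs (z : Fin I.n → ℤ) (s : State) : Prop :=
  s .outStatus 0 = 2 ∧ z ∈ I.feasible ∧ (∀ j : Fin I.n, s .outPoint (j : ℕ) = z j) ∧
    s (.work 12) 0 = I.objective z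

theorem OutIs.congr {z : Fin I.n → ℤ} {s s' : State} (h : OutIs z s)
    (h1 : s' .outStatus = s .outStatus) (h2 : s' .outPoint = s .outPoint)
    (h3 : s' (.work 12) = s (.work 12)) : OutIs z s' := by
  unfold OutIs at *
  rwa [h1, h2, h3]

def saveBest : Prog :=
  .seq (.store (.work 12) (.const 0) (var 11)) (.seq (.store .outStatus (.const 0) (.const 2))
    (fill 9 (dim 0) .outPoint (var 9) (.load .ansPoint (var 9))))

theorem runs_saveBest (hK : WordLength I g K) {s : State} (hs : Static I g s)
    {x : Fin I.n → ℤ} (hx : ∀ j : Fin I.n, s .ansPoint (j : ℕ) = x j) (hxF : x ∈ I.feasible)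
    (hv : s (.work 11) 0 = I.objective x) :
    ∃ s', Runs O K saveBest s [] s' (I.n * 4 + 7) ∧
      SameOff [.work 12, .outStatus, .outPoint, .work 9] s s' ∧ OutIs x s' := by
  have h4 := hK.four_le
  have r₁ := Runs.store (O := O) h4 (a := .work 12) (i := .const 0) (e := var 11) (s := s)
    (by simp) (fun A hA => hA.1 _ _)
  have r₂ := Runs.store (O := O) h4 (a := .outStatus) (i := .const 0) (e := .const 2)
    (s := s.set (.work 12) 0 (I.objective x)) (by simp) (fun A _ => by
      have : bitLen 2 ≤ 4 := bitLen_le_four (by simp)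
      simp only [Expr.eval]; omega)
  simp only [Expr.eval, hv] at r₁ r₂
  set s₂ := (s.set (.work 12) 0 (I.objective x)).set .outStatus 0 2 with hs₂def
  have o₂ : SameOff [.work 12, .outStatus, .outPoint, .work 9] s s₂ :=
    (SameOff.set_right _ (by simp) _ _).set (by simp) _ _
  have hs₂ := hs.of_sameOff o₂
  have hx₂ : s₂ .ansPoint = s .ansPoint := o₂ _ (by simp)
  obtain ⟨s₃, r₃, o₃, v₃, -⟩ := Runs.fill_rule (O := O) h4 (c := 9) (bound := dim 0)
    (a := .outPoint) (ie := var 9) (e := .load .ansPoint (var 9)) I.n hK.n_le 0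
    (fun j => s .ansPoint j) s₂ (by simp)
    (by simp) (fun s₁ h => (hs₂.of_sameOff h).dim_zero)
    (fun j _ s₁ _ h => by simpa [Expr.eval] using h)
    (fun j _ s₁ h h9 _ => by simp only [Expr.eval]; rw [h9, h .ansPoint (by simp), hx₂])
    (fun j _ s₁ h _ _ A hA => by
      rw [← hx₂, ← h .ansPoint (by simp)]
      exact hA.1 _ _)
  refine ⟨s₃, (r₁.seq (r₂.seq r₃)).mono (by omega), o₂.trans (o₃.mono (by simp)), ?_, hxF, ?_, ?_⟩
  · rw [o₃ .outStatus (by simp)]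
    exact State.set_self_same _ _ _ _
  · intro j
    have := v₃ j j.2
    rw [zero_add] at this
    rw [this, hx]
  · rw [o₃ (.work 12) (by simp), hs₂def, State.set_of_ne (by simp), State.set_self_same]

/-- Solve the problem of a leaf and update the best known point. -/
def leaf : Prog :=
  .seq leafObjective (.seq .solve (.branch isPoint
    (.seq evalObjective (.branch (.load .outStatus (.const 0))
      (.branch (.sub (var 12) (var 11)) saveBest .skip) saveBest))
    (.store (.work 10) (.const 0) (.const 0))))

def leafMods : List Arr :=
  [.qC, .work 8, .work 9, .work 10, .work 11, .work 12, .ansStatus, .ansPoint, .outStatus, .outPoint]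

/-- An unbounded underestimator makes the objective unbounded, so failure has the same two meanings
as in the scan. On success the kept point is at least as good as the new optimum of the
underestimator and as every point kept before. -/
theorem runs_leaf (hK : WordLength I g K) {s : State} {B : I.Node} (hs : Static I g s)
    (hB : Cur B s) (hOK : B.OK g) (hfull : B.Full)
    (hout : s .outStatus 0 = 0 ∨ ∃ z : Fin I.n → ℤ, OutIs z s) :
    ∃ s', Runs O K leaf s [B.ilp B.chord] s' (I.n * 12 + I.k * 8 + 40) ∧ SameOff leafMods s s' ∧
      ((s' (.work 10) 0 = 0 ∧ Failed B s' ∧ s' .outStatus = s .outStatus ∧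
          s' .outPoint = s .outPoint ∧ s' (.work 12) = s (.work 12)) ∨
        (s' (.work 10) 0 = s (.work 10) 0 ∧ ∃ x, IsOptimal (fun x => B.chord ⬝ᵥ x) B.pts x ∧
          ∃ z : Fin I.n → ℤ, OutIs z s' ∧ I.objective z ≤ I.objective x ∧
            ∀ z₀ : Fin I.n → ℤ, OutIs z₀ s → I.objective z ≤ I.objective z₀)) := by
  have h4 := hK.four_le
  obtain ⟨s₁, r₁, o₁, hc⟩ := runs_leafObjective (O := O) hK hs hB hOK hfull
  obtain ⟨s₂, r₂, o₂, hout₂⟩ := runs_solve (O := O) h4 (hs.of_sameOff o₁) (hB.of_sameOff o₁) hc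
    (hOK.goodQuery_chord.1.trans hK.query_le)
  have o₂' : SameOff leafMods s s₂ :=
    (o₁.mono (by simp [leafMods])).trans (o₂.mono (by simp [leafMods]))
  have hkeep : ∀ a ∈ [Arr.outStatus, .outPoint, .work 12, .work 10], s₂ a = s a := by
    intro a ha
    simp only [List.mem_cons, List.not_mem_nil, or_false] at ha
    rw [o₂ a (by rcases ha with rfl | rfl | rfl | rfl <;> simp),
      o₁ a (by rcases ha with rfl | rfl | rfl | rfl <;> simp)]
  simp only [List.forall_mem_cons] at hkeep
  obtain ⟨k1, k2, k3, k10, -⟩ := hkeep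
  have hcases : (isPoint.eval s₂ ≤ 0 ∧ Failed B s₂) ∨ (0 < isPoint.eval s₂ ∧
      ∃ x, IsOptimal (fun x => B.chord ⬝ᵥ x) B.pts x ∧
        ∀ j : Fin I.n, s₂ .ansPoint (j : ℕ) = x j) := by
    rcases hout₂ with ⟨h1, h2⟩ | ⟨h1, h2⟩ | ⟨h1, h2⟩
    · exact .inl ⟨by simp [isPoint, Expr.eval, h1], .inl ⟨h1, h2⟩⟩
    · exact .inl ⟨by simp [isPoint, Expr.eval, h1], .inr ⟨h1, Node.unboundedBelow_of_chord hfull h2⟩⟩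
    · exact .inr ⟨by simp [isPoint, Expr.eval, h1], h2⟩
  rcases hcases with ⟨hp, hf⟩ | ⟨hp, x, hopt, hx⟩
  · have r₃ := Runs.store (O := O) h4 (a := .work 10) (i := .const 0) (e := .const 0) (s := s₂)
      (by simp) (fun A _ => by
        have : bitLen 0 ≤ 4 := bitLen_le_four (by simp)
        simp only [Expr.eval]; omega)
    refine ⟨_, (r₁.seq (r₂.seq (Runs.branch_nonpos h4 hp r₃))).mono (by omega),
      o₂'.set (by simp [leafMods]) _ _, .inl ⟨State.set_self_same _ _ _ _,
        hf.congr (State.set_of_ne (by simp) _ _ _), ?_, ?_, ?_⟩⟩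
    · rw [State.set_of_ne (by simp), k1]
    · rw [State.set_of_ne (by simp), k2]
    · rw [State.set_of_ne (by simp), k3]
  · have hs₂ := hs.of_sameOff o₂' (by simp [leafMods])
    obtain ⟨s₃, r₃, o₃, v₃⟩ := runs_evalObjective (O := O) hK hs₂ hx
    have hs₃ := hs₂.of_sameOff o₃
    have o₃' : SameOff leafMods s s₃ := o₂'.trans (o₃.mono (by simp [leafMods]))
    have l1 : s₃ .outStatus = s .outStatus := by rw [o₃ _ (by simp), k1]
    have l2 : s₃ .outPoint = s .outPoint := by rw [o₃ _ (by simp), k2]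
    have l3 : s₃ (.work 12) = s (.work 12) := by rw [o₃ _ (by simp), k3]
    have l10 : s₃ (.work 10) = s (.work 10) := by rw [o₃ _ (by simp), k10]
    obtain ⟨s₄, r₄, o₄, hout₄⟩ := runs_saveBest (O := O) hK hs₃ (x := x)
      (fun j => by rw [o₃ .ansPoint (by simp), hx]) hopt.1.1 v₃
    have o₄' : SameOff leafMods s s₄ := o₃'.trans (o₄.mono (by simp [leafMods]))
    have l10' : s₄ (.work 10) 0 = s (.work 10) 0 := by rw [o₄ _ (by simp), l10]
    rcases hout with h0 | ⟨z, hz⟩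
    · refine ⟨s₄, (r₁.seq (r₂.seq (Runs.branch_pos h4 hp (r₃.seq (Runs.branch_nonpos h4
        (by simp [Expr.eval, l1, h0]) r₄))))).mono (by omega), o₄', .inr ⟨l10', x, hopt, x, hout₄,
          le_rfl, fun z₀ hz₀ => ?_⟩⟩
      have := hz₀.1
      omega
    · have huniq : ∀ z₀ : Fin I.n → ℤ, OutIs z₀ s → I.objective z₀ = I.objective z := fun z₀ hz₀ => by
        rw [← hz₀.2.2.2, ← hz.2.2.2]
      by_cases hlt : I.objective x < I.objective z
      · refine ⟨s₄, (r₁.seq (r₂.seq (Runs.branch_pos h4 hp (r₃.seq (Runs.branch_pos h4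
          (by simp [Expr.eval, l1, hz.1]) (Runs.branch_pos h4
            (by simp [Expr.eval, l3, hz.2.2.2, v₃, hlt]) r₄)))))).mono (by omega), o₄',
            .inr ⟨l10', x, hopt, x, hout₄, le_rfl, fun z₀ hz₀ => ?_⟩⟩
        rw [huniq z₀ hz₀]
        exact hlt.le
      · refine ⟨s₃, (r₁.seq (r₂.seq (Runs.branch_pos h4 hp (r₃.seq (Runs.branch_pos h4
          (by simp [Expr.eval, l1, hz.1]) (Runs.branch_nonpos h4
            (by simp [Expr.eval, l3, hz.2.2.2, v₃]; omega) (Runs.skip h4 s₃))))))).mono (by omega),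
            o₃', .inr ⟨by rw [l10], x, hopt, z, hz.congr l1 l2 l3, by omega, fun z₀ hz₀ => ?_⟩⟩
        rw [huniq z₀ hz₀]

end ConcaveIQP

namespace ConcaveIQP

open IQP State

variable {O : ILPSolver} {K : ℕ} {I : IQP} {g : ℤ}

/-! ## Children of a node -/

namespace IQP

/-- The node with the additional bounds `p` on the `i`-th nonlinear variable. -/
def Node.child (B : I.Node) (i : Fin I.k) (p : ℤ × ℤ) : I.Node :=
  Function.update B (I.idx i) (Option.some p)

theorem Node.child_same (B : I.Node) (i : Fin I.k) (p : ℤ × ℤ) :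
    B.child i p (I.idx i) = Option.some p := Function.update_self _ _ _

theorem Node.child_of_ne (B : I.Node) {i : Fin I.k} (p : ℤ × ℤ) {j : Fin I.n} (h : j ≠ I.idx i) :
    B.child i p j = B j := Function.update_of_ne h _ _

theorem Node.child_of_some {B : I.Node} {i : Fin I.k} (hi : B (I.idx i) = none) (p : ℤ × ℤ)
    {j : Fin I.n} (h : (B j).isSome) : B.child i p j = B j :=
  B.child_of_ne p fun h' => by rw [h', hi] at h; simp at h

theorem Node.mem_pts_child {B : I.Node} {i : Fin I.k} (hi : B (I.idx i) = none) {p : ℤ × ℤ}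
    {x : Fin I.n → ℤ} :
    x ∈ (B.child i p).pts ↔ x ∈ B.pts ∧ p.1 ≤ x (I.idx i) ∧ x (I.idx i) ≤ p.2 := by
  constructor
  · rintro ⟨h1, h2⟩
    refine ⟨⟨h1, fun j q hq => h2 j q ?_⟩, h2 _ p (B.child_same i p)⟩
    rw [Option.mem_def] at hq ⊢
    rw [Node.child_of_some hi p (by rw [hq]; rfl), hq]
  · rintro ⟨⟨h1, h2⟩, h3⟩
    refine ⟨h1, fun j q hq => ?_⟩
    by_cases hj : j = I.idx i
    · subst hj
      rw [Option.mem_def, B.child_same] at hq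
      cases hq
      exact h3
    · rw [B.child_of_ne p hj] at hq
      exact h2 j q hq

theorem Node.free_child {B : I.Node} {i : Fin I.k} (hi : B (I.idx i) = none) (p : ℤ × ℤ) :
    (B.child i p).free I.k + 1 = B.free I.k := by
  classical
  unfold Node.free
  rw [Nat.count_eq_card_filter_range, Nat.count_eq_card_filter_range]
  conv_rhs => rw [← Finset.card_erase_add_one (a := (i : ℕ)) (by simp [hi])]
  congr 2
  ext j
  simp only [Finset.mem_filter, Finset.mem_range, Finset.mem_erase]
  constructor
  · rintro ⟨h1, h2, h3⟩
    have hne : j ≠ i := by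
      rintro rfl
      rw [show (⟨(i : ℕ), h2⟩ : Fin I.k) = i from rfl, B.child_same] at h3
      simp at h3
    refine ⟨hne, h1, h2, ?_⟩
    rwa [B.child_of_ne p fun h => hne (congrArg Fin.val (I.idx_injective h))] at h3
  · rintro ⟨hne, h1, h2, h3⟩
    refine ⟨h1, h2, ?_⟩
    rwa [B.child_of_ne p fun h => hne (congrArg Fin.val (I.idx_injective h))]

theorem coordBound_pos : 1 ≤ I.coordBound :=
  Nat.mul_pos (Nat.factorial_pos _) (Nat.pow_pos (Nat.pow_pos (by norm_num)))

/-- The choice of the smallest range makes this work: if it is below `g`, the pieces are single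
integers; if not, every unbounded variable has range at least `g`, and the node itself becomes the
base `B₀` of a subdivision. -/
theorem Node.OK.child {B : I.Node} (hB : B.OK g) (hg : 0 < g) {i : Fin I.k}
    (hi : B (I.idx i) = none)
    {l u : ℤ} (hr : B.IsRange (I.idx i) l u)
    (hmin : ∀ i', B (I.idx i') = none → ∃ l' u', B.IsRange (I.idx i') l' u' ∧ u - l ≤ u' - l')
    (hΔ : 1 ≤ I.Δ) (hcb : I.CoordBdd) {a : ℤ} (hla : l ≤ a) (hau : a ≤ u) :
    (B.child i (a, a + ((u - l) / g + 1) - 1)).OK g := by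
  have hlen : a + ((u - l) / g + 1) - 1 - a = (u - l) / g := by ring
  have hdiv : g * ((u - l) / g) ≤ u - l := Int.mul_ediv_self_le hg.ne'
  have hdiv0 : 0 ≤ (u - l) / g := Int.ediv_nonneg (by omega) hg.le
  have hdivle : (u - l) / g ≤ u - l := Int.ediv_le_self _ (by omega)
  have hsub : (B.child i (a, a + ((u - l) / g + 1) - 1)).pts ⊆ B.pts := fun x hx =>
    ((Node.mem_pts_child hi).1 hx).1
  refine ⟨fun j p hp => ?_, ?_, .inr ⟨hΔ, hcb⟩⟩
  · by_cases hj : j = I.idx i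
    · subst hj
      rw [B.child_same] at hp
      cases hp
      obtain ⟨x, hx, hxl⟩ := hr.exists_lo
      obtain ⟨y, hy, hyu⟩ := hr.exists_hi
      have h1 := abs_le.1 (hcb x hx.1 i)
      have h2 := abs_le.1 (hcb y hy.1 i)
      rw [hxl] at h1
      rw [hyu] at h2
      -- The ends of the range are coordinates of feasible points, so they are bounded by
      -- `coordBound`. A piece starts inside the range and may reach beyond `u`, but by at most the
      -- length of the range, hence the factor `3`.
      constructor <;> rw [abs_le] <;> constructor <;> simp only <;> linarith
    · rw [B.child_of_ne _ hj] at hp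
      exact hB.bdd j p hp
  · rcases hB.fine with hfix | ⟨B₀, hfix, hsub₀, hsome, l₀, u₀, hlu⟩
    -- For a range below `g` the quotient `(u - l) / g` is `0`, and the child fixes the variable.
    · by_cases hlt : u - l < g
      · left
        intro j p hp
        by_cases hj : j = I.idx i
        · subst hj
          rw [B.child_same] at hp
          cases hp
          rw [Int.ediv_eq_zero_of_lt (by omega) hlt]
          simp
        · rw [B.child_of_ne _ hj] at hp
          exact hfix j p hp
      · right
        choose! l' u' hlu' using hmin
        refine ⟨B, hfix, hsub, fun j hj => Node.child_of_some hi _ hj, l', u', fun i' hi' => ?_⟩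
        obtain ⟨h1, h2⟩ := hlu' i' hi'
        refine ⟨h1, by omega, fun p hp => ?_⟩
        by_cases hj : i' = i
        · subst hj
          rw [B.child_same] at hp
          cases hp
          simp only
          rw [hlen]
          constructor <;> linarith
        · rw [B.child_of_ne _ fun h => hj (I.idx_injective h), hi'] at hp
          simp at hp
    · right
      -- Below the base `B₀` the ranges only shrink, so pieces computed from the current range are
      -- also short relative to the range on `B₀`.
      refine ⟨B₀, hfix, hsub.trans hsub₀, fun j hj => ?_, l₀, u₀, fun i' hi' => ?_⟩
      · rw [Node.child_of_some hi _ (by rw [hsome j hj]; exact hj), hsome j hj]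
      · obtain ⟨h1, h2, h3⟩ := hlu i' hi'
        refine ⟨h1, h2, fun p hp => ?_⟩
        by_cases hj : i' = i
        · subst hj
          rw [B.child_same] at hp
          cases hp
          simp only
          rw [hlen]
          obtain ⟨x, hx, hxl⟩ := hr.exists_lo
          obtain ⟨y, hy, hyu⟩ := hr.exists_hi
          have h5 := h1.le x (hsub₀ hx)
          have h6 := h1.le y (hsub₀ hy)
          constructor <;> linarith
        · rw [B.child_of_ne _ fun h => hj (I.idx_injective h)] at hp
          exact h3 p hp

end IQP

/-! ## Pushing the children onto the stack -/

def pushArr (a b : Arr) : Prog := fill 8 (dim 2) a (stackPos (var 8)) (.load b (var 8))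

theorem runs_pushArr (hK : WordLength I g K) {s : State} (hs : Static I g s) {t : ℕ}
    (ht : s (.work 1) 0 = t) (a : Arr)
    (ha : a ∈ [Arr.work 2, .work 3, .work 4]) (b : Arr)
    (hb : b ∈ [Arr.qLoFlag, .qLo, .qHi]) :
    ∃ s', Runs O K (pushArr a b) s [] s' (I.k * 4 + 3) ∧ SameOff [a, .work 8] s s' ∧
      (∀ j < I.k, s' a ((t : ℤ) * I.k + (j : ℕ)) = s b (j : ℕ)) ∧
      ∀ i, (∀ j < I.k, i ≠ (t : ℤ) * I.k + (j : ℕ)) → s' a i = s a i := by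
  have h4 := hK.four_le
  simp only [List.mem_cons, List.not_mem_nil, or_false] at ha hb
  have hane : a ≠ .ansPoint ∧ a ≠ .work 8 ∧ a ≠ .inDim ∧ a ≠ .work 1 := by
    rcases ha with rfl | rfl | rfl <;> simp
  have hbne : b ≠ a ∧ b ≠ .work 8 := by
    rcases hb with rfl | rfl | rfl <;> rcases ha with rfl | rfl | rfl <;> simp
  have hd2 : ∀ s₁, SameOff [a, .work 8] s s₁ → (dim 2).eval s₁ = I.k := by
    intro s₁ h
    rw [← hs.dim_two]
    exact congrFun (h .inDim (by simp [hane.2.2.1.symm])) 2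
  obtain ⟨s', hrun, hoff, hval, hother⟩ := Runs.fill_rule (O := O) h4 (c := 8) (bound := dim 2)
    (a := a) (ie := stackPos (var 8)) (e := .load b (var 8)) I.k hK.k_le ((t : ℤ) * I.k)
    (fun j => s b j) s hane.1 hane.2.1 hd2
    (fun j _ s₁ h h8 => by
      have h1 := hd2 s₁ h
      have h2 : s₁ (.work 1) = s (.work 1) := h _ (by simp [hane.2.2.2.symm])
      simp only [Expr.eval] at h1 ⊢
      rw [h1, h2, ht, h8])
    (fun j hj s₁ h h8 _ => by
      simp only [Expr.eval]
      rw [h8, h b (by simp [hbne])])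
    (fun j hj s₁ h h8 _ A hA => by
      rw [← h b (by simp [hbne])]
      exact hA.1 _ _)
    (by decide) (by decide) (by
      rcases hb with rfl | rfl | rfl <;> decide)
  exact ⟨s', hrun, hoff, hval, hother⟩

/-- The left end of the piece with number `work 13`. -/
def pieceStart : Expr := .add (var 6) (.mul (var 13) (var 14))

/-- Push the child of the current node that is given by the piece with number `work 13`. -/
def push : Prog :=
  .seq (pushArr (.work 2) .qLoFlag) (.seq (pushArr (.work 3) .qLo) (.seq (pushArr (.work 4) .qHi)
    (.seq (.store (.work 2) (stackPos (var 5)) (.const 1))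
      (.seq (.store (.work 3) (stackPos (var 5)) pieceStart)
        (.seq (.store (.work 4) (stackPos (var 5)) (.sub (.add pieceStart (var 14)) (.const 1)))
          (.store (.work 1) (.const 0) (.add (var 1) (.const 1))))))))

def pushMods : List Arr := [.work 1, .work 2, .work 3, .work 4, .work 8]

/-- The nodes occupy disjoint blocks of `k` cells, so a push does not disturb the nodes below. -/
theorem stackPos_ne {k t t' j j' : ℕ} (ht : t' < t) (hj' : j' < k) :
    (t' : ℤ) * k + (j' : ℕ) ≠ (t : ℤ) * k + (j : ℕ) := by
  have h1 : (t' + 1) * k ≤ t * k := Nat.mul_le_mul_right k ht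
  have h2 : t' * k + j' < t * k + j := by
    rw [add_mul] at h1; omega
  exact_mod_cast h2.ne

/-- The bounds of the current node are copied from the query arrays, and the three cells of the
selected variable are then overwritten. -/
theorem runs_push (hK : WordLength I g K) {s : State} (hs : Static I g s) {B : I.Node}
    (hB : Cur B s) {t : ℕ}
    (ht : s (.work 1) 0 = t) (htK : bitLen ((t + 1 : ℕ) : ℤ) ≤ K) (i : Fin I.k)
    (hi : s (.work 5) 0 = (i : ℕ)) {a b : ℤ} (ha : pieceStart.eval s = a)
    (hb : a + s (.work 14) 0 - 1 = b) (haR : |a| ≤ 3 * I.coordBound) (hbR : |b| ≤ 3 * I.coordBound)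
    (hBk : ∀ j : Fin I.n, I.k ≤ (j : ℕ) → B j = none) :
    ∃ s', Runs O K push s [] s' (I.k * 12 + 19) ∧ SameOff pushMods s s' ∧
      s' (.work 1) 0 = ((t + 1 : ℕ) : ℤ) ∧ stackNode I s' t = B.child i (a, b) ∧
      ∀ t' < t, stackNode I s' t' = stackNode I s t' := by
  have h4 := hK.four_le
  have hent := hK.entry_le
  have hbits : ∀ z : ℤ, |z| ≤ 3 * I.coordBound → bitLen z ≤ K := fun z hz =>
    (bitLen_le_of_abs hz).trans (by unfold IQP.entryBits at hent; omega)
  obtain ⟨s₁, r₁, o₁, v₁, w₁⟩ := runs_pushArr (O := O) hK hs ht (.work 2) (by simp) .qLoFlag (by simp)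
  obtain ⟨s₂, r₂, o₂, v₂, w₂⟩ := runs_pushArr (O := O) hK (hs.of_sameOff o₁) (t := t)
    (by rw [o₁ (.work 1) (by simp), ht]) (.work 3) (by simp) .qLo (by simp)
  have o₂' : SameOff pushMods s s₂ :=
    (o₁.mono (by simp [pushMods])).trans (o₂.mono (by simp [pushMods]))
  obtain ⟨s₃, r₃, o₃, v₃, w₃⟩ := runs_pushArr (O := O) hK
    (hs.of_sameOff o₂' (by simp [pushMods])) (t := t)
    (by rw [o₂ (.work 1) (by simp), o₁ (.work 1) (by simp), ht]) (.work 4) (by simp) .qHi (by simp)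
  have o₃' : SameOff pushMods s s₃ := o₂'.trans (o₃.mono (by simp [pushMods]))
  have t₃ : s₃ (.work 1) 0 = t := by
    rw [o₃ (.work 1) (by simp), o₂ (.work 1) (by simp), o₁ (.work 1) (by simp), ht]
  have hd := (hs.of_sameOff o₃' (by simp [pushMods])).dim_two
  simp only [Expr.eval] at hd
  have i₃ : s₃ (.work 5) 0 = (i : ℕ) := by rw [o₃' (.work 5) (by simp [pushMods]), hi]
  have a₃ : s₃ (.work 6) 0 + s₃ (.work 13) 0 * s₃ (.work 14) 0 = a := by
    rw [← ha]
    simp only [pieceStart, Expr.eval]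
    rw [o₃' (.work 6) (by simp [pushMods]), o₃' (.work 13) (by simp [pushMods]),
      o₃' (.work 14) (by simp [pushMods])]
  have b₃ : a + s₃ (.work 14) 0 - 1 = b := by rw [o₃' (.work 14) (by simp [pushMods]), hb]
  set pos : ℤ := (t : ℤ) * I.k + (i : ℕ) with hpos
  have r₄ := Runs.store (O := O) h4 (a := .work 2) (i := stackPos (var 5)) (e := .const 1) (s := s₃)
    (by simp) (fun A _ => by
      have : bitLen 1 ≤ 4 := bitLen_le_four (by simp)
      simp only [Expr.eval]; omega)
  simp only [Expr.eval, hd, t₃, i₃] at r₄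
  set s₄ := s₃.set (.work 2) pos 1 with hs₄
  have e₄ : ∀ a ≠ Arr.work 2, s₄ a = s₃ a := fun a ha => State.set_of_ne ha _ _ _
  have ev₅ : pieceStart.eval s₄ = a := by
    simp only [pieceStart, Expr.eval]
    rw [e₄ _ (by simp), e₄ _ (by simp), e₄ _ (by simp), a₃]
  have r₅ := Runs.store (O := O) h4 (a := .work 3) (i := stackPos (var 5)) (e := pieceStart)
    (s := s₄) (by simp) (fun A _ => by
      rw [ev₅]
      exact (hbits a haR).trans (by omega))
  rw [ev₅] at r₅
  simp only [Expr.eval] at r₅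
  rw [e₄ _ (by simp), e₄ _ (by simp), e₄ _ (by simp), hd, t₃, i₃] at r₅
  set s₅ := s₄.set (.work 3) pos a with hs₅
  have e₅ : ∀ a ≠ Arr.work 2, a ≠ Arr.work 3 → s₅ a = s₃ a := fun a h2 h3 => by
    rw [hs₅, State.set_of_ne h3, e₄ a h2]
  have ev₆ : (Expr.sub (.add pieceStart (var 14)) (.const 1)).eval s₅ = b := by
    simp only [pieceStart, Expr.eval]
    rw [e₅ _ (by simp) (by simp), e₅ _ (by simp) (by simp), e₅ _ (by simp) (by simp), a₃, b₃]
  have r₆ := Runs.store (O := O) h4 (a := .work 4) (i := stackPos (var 5))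
    (e := .sub (.add pieceStart (var 14)) (.const 1))
    (s := s₅) (by simp) (fun A _ => by
      rw [ev₆]
      exact (hbits b hbR).trans (by omega))
  rw [ev₆] at r₆
  simp only [Expr.eval] at r₆
  rw [e₅ _ (by simp) (by simp), e₅ _ (by simp) (by simp), e₅ _ (by simp) (by simp), hd, t₃, i₃]
    at r₆
  set s₆ := s₅.set (.work 4) pos b with hs₆
  have t₆ : s₆ (.work 1) 0 = t := by
    rw [hs₆, State.set_of_ne (by simp), e₅ _ (by simp) (by simp), t₃]
  have ev₇ : (Expr.add (var 1) (.const 1)).eval s₆ = ((t + 1 : ℕ) : ℤ) := by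
    simp only [Expr.eval, t₆]; push_cast; rfl
  have r₇ := Runs.store (O := O) h4 (a := .work 1) (i := .const 0) (e := .add (var 1) (.const 1))
    (s := s₆) (by simp) (fun A _ => by
      rw [ev₇]
      exact htK.trans (by omega))
  rw [ev₇] at r₇
  simp only [Expr.eval] at r₇
  set s₇ := s₆.set (.work 1) 0 ((t + 1 : ℕ) : ℤ) with hs₇
  have o₇ : SameOff pushMods s s₇ := by
    refine (((o₃'.set ?_ _ _).set ?_ _ _).set ?_ _ _).set ?_ _ _ <;> simp [pushMods]
  have m2 : s₇ (.work 2) = s₄ (.work 2) := by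
    rw [hs₇, State.set_of_ne (by simp), hs₆, State.set_of_ne (by simp), hs₅,
      State.set_of_ne (by simp)]
  have m3 : s₇ (.work 3) = s₅ (.work 3) := by
    rw [hs₇, State.set_of_ne (by simp), hs₆, State.set_of_ne (by simp)]
  have m4 : s₇ (.work 4) = s₆ (.work 4) := by
    rw [hs₇, State.set_of_ne (by simp)]
  have n2 : s₃ (.work 2) = s₁ (.work 2) := by rw [o₃ _ (by simp), o₂ _ (by simp)]
  have n3 : s₃ (.work 3) = s₂ (.work 3) := by rw [o₃ _ (by simp)]
  have p2 : ∀ x, s₇ (.work 2) x = if x = pos then 1 else s₁ (.work 2) x := fun x => by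
    rw [m2, hs₄, State.set_self, n2]
  have p3 : ∀ x, s₇ (.work 3) x = if x = pos then a else s₂ (.work 3) x := fun x => by
    rw [m3, hs₅, State.set_self, e₄ _ (by simp), n3]
  have p4 : ∀ x, s₇ (.work 4) x = if x = pos then b else s₃ (.work 4) x := fun x => by
    rw [m4, hs₆, State.set_self, e₅ _ (by simp) (by simp)]
  refine ⟨s₇, (r₁.seq (r₂.seq (r₃.seq (r₄.seq (r₅.seq (r₆.seq r₇)))))).mono (by omega), o₇,
    State.set_self_same _ _ _ _, ?_, fun t' ht' => ?_⟩
  · funext j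
    unfold stackNode
    by_cases hj : (j : ℕ) < I.k
    · by_cases hji : j = I.idx i
      · subst hji
        rw [B.child_same]
        have hval : ((I.idx i : Fin I.n) : ℕ) = i := rfl
        rw [hval, p2, p3, p4, if_pos rfl, if_pos rfl, if_pos rfl]
        simp
      · have hne : (t : ℤ) * I.k + ((j : ℕ) : ℤ) ≠ pos := by
          intro h
          apply hji
          apply Fin.ext
          have h' : ((j : ℕ) : ℤ) = ((i : ℕ) : ℤ) := by rw [hpos] at h; linarith
          exact_mod_cast h'
        rw [B.child_of_ne _ hji, hB.eq, p2, p3, p4, if_neg hne, if_neg hne, if_neg hne, v₁ j hj,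
          v₂ j hj, v₃ j hj, o₁ .qLo (by simp), o₂ .qHi (by simp), o₁ .qHi (by simp)]
        simp [hj]
    · have hji : j ≠ I.idx i := by
        rintro rfl
        exact hj i.2
      rw [B.child_of_ne _ hji, hBk j (by omega)]
      simp [hj]
  · refine stackNode_congr t' fun c hc j hj => ?_
    have hne : ∀ j' < I.k, (t' : ℤ) * I.k + (j : ℕ) ≠ (t : ℤ) * I.k + (j' : ℕ) := fun j' _ =>
      stackPos_ne ht' hj
    simp only [List.mem_cons, List.not_mem_nil, or_false] at hc
    rcases hc with rfl | rfl | rfl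
    · rw [p2, if_neg (hne i i.2), w₁ _ hne]
    · rw [p3, if_neg (hne i i.2), w₂ _ hne, o₁ _ (by simp)]
    · rw [p4, if_neg (hne i i.2), w₃ _ hne, o₂ _ (by simp), o₁ _ (by simp)]

/-- Subdivide the range `work 6, work 7` of the variable `work 5`. -/
def children : Prog :=
  .seq (.store (.work 14) (.const 0) (.add (.div (.sub (var 7) (var 6)) (var 0)) (.const 1)))
    (forUpTo 13 (var 0) (.branch (.add (.sub (var 7) pieceStart) (.const 1)) push .skip))

def childrenMods : List Arr := [.work 1, .work 2, .work 3, .work 4, .work 8, .work 13, .work 14]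

/-- The pieces start at `l`, `l + w`, `l + 2 w` and so on. The loop invariant says that the pieces
handled so far cover the values of the range below `l + j * w`. -/
theorem runs_children {G : ℕ} (hK : WordLength I G K) (hG : 0 < G) {s : State}
    (hs : Static I G s) {B : I.Node}
    (hB : Cur B s) (hBk : ∀ j : Fin I.n, I.k ≤ (j : ℕ) → B j = none) {t₀ : ℕ}
    (ht : s (.work 1) 0 = t₀) (htK : bitLen ((t₀ + G : ℕ) : ℤ) ≤ K) (i : Fin I.k)
    (hi : s (.work 5) 0 = (i : ℕ)) {l u : ℤ} (hl : s (.work 6) 0 = l) (hu : s (.work 7) 0 = u)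
    (hlu : l ≤ u) (hlR : |l| ≤ I.coordBound) (huR : |u| ≤ I.coordBound) :
    ∃ s', Runs O K children s [] s' (G * (I.k * 12 + 23) + 5) ∧ SameOff childrenMods s s' ∧
      ∃ c ≤ G, s' (.work 1) 0 = ((t₀ + c : ℕ) : ℤ) ∧
        (∀ t < t₀, stackNode I s' t = stackNode I s t) ∧
        (∀ t, t₀ ≤ t → t < t₀ + c → ∃ a, l ≤ a ∧ a ≤ u ∧
          stackNode I s' t = B.child i (a, a + ((u - l) / G + 1) - 1)) ∧
        ∀ y, l ≤ y → y ≤ u → ∃ t, t₀ ≤ t ∧ t < t₀ + c ∧ ∃ a,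
          stackNode I s' t = B.child i (a, a + ((u - l) / G + 1) - 1) ∧
            a ≤ y ∧ y ≤ a + ((u - l) / G + 1) - 1 := by
  have h4 := hK.four_le
  have hent := hK.entry_le
  have hR1 := coordBound_pos (I := I)
  have hGz : (0 : ℤ) < G := by exact_mod_cast hG
  set w : ℤ := (u - l) / G + 1 with hw
  have hw1 : 1 ≤ w := by
    have := Int.ediv_nonneg (a := u - l) (b := G) (by omega) hGz.le
    omega
  have hwle : w ≤ u - l + 1 := by
    have := Int.ediv_le_self (a := u - l) G (by omega)
    omega
  -- Thus `G` pieces of `w` integers reach every integer of the range.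
  have hGw : u - l < G * w := by
    have := Int.lt_mul_ediv_self_add (x := u - l) hGz
    rw [hw]; linarith
  rw [abs_le] at hlR huR
  have ev₁ : (Expr.add (.div (.sub (var 7) (var 6)) (var 0)) (.const 1)).eval s = w := by
    simp only [Expr.eval, hl, hu, hs.gval, hw]
  have r₁ := Runs.store (O := O) h4 (a := .work 14) (i := .const 0)
    (e := .add (.div (.sub (var 7) (var 6)) (var 0)) (.const 1)) (s := s)
    (by simp) (fun A _ => by
      rw [ev₁]
      have : bitLen w ≤ bitLen (3 * I.coordBound : ℤ) := bitLen_le_of_abs (by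
        rw [abs_le]; constructor <;> omega)
      unfold IQP.entryBits at hent
      omega)
  rw [ev₁] at r₁
  simp only [Expr.eval] at r₁
  set s₁ := s.set (.work 14) 0 w with hs₁
  have o₁ : SameOff childrenMods s s₁ := SameOff.set_right _ (by simp [childrenMods]) _ _
  obtain ⟨s₂, r₂, o₂, hw2, c, hcG, h1, h2, h3, h5⟩ := Runs.for_rule_nil (O := O) h4 (c := 13)
    (bound := var 0)
    (body := .branch (.add (.sub (var 7) pieceStart) (.const 1)) push .skip) G hK.g_le
    (I.k * 12 + 20)
    (fun j s' => SameOff childrenMods s s' ∧ s' (.work 14) 0 = w ∧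
      ∃ c ≤ j, s' (.work 1) 0 = ((t₀ + c : ℕ) : ℤ) ∧
        (∀ t < t₀, stackNode I s' t = stackNode I s t) ∧
        (∀ t, t₀ ≤ t → t < t₀ + c → ∃ a, l ≤ a ∧ a ≤ u ∧
          stackNode I s' t = B.child i (a, a + w - 1)) ∧
        ∀ y, l ≤ y → y ≤ u → y < l + j * w → ∃ t, t₀ ≤ t ∧ t < t₀ + c ∧ ∃ a,
          stackNode I s' t = B.child i (a, a + w - 1) ∧ a ≤ y ∧ y ≤ a + w - 1) s₁
    ⟨o₁.set (by simp [childrenMods]) _ _, by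
      rw [State.set_of_ne (by simp)]; exact State.set_self_same _ _ _ _, 0, le_rfl, by
      rw [State.set_of_ne (by simp), hs₁, State.set_of_ne (by simp), ht]; rfl,
      fun t _ => stackNode_congr t fun a ha j _ => by
        simp only [List.mem_cons, List.not_mem_nil, or_false] at ha
        rw [State.set_of_ne (by rcases ha with rfl | rfl | rfl <;> simp), hs₁,
          State.set_of_ne (by rcases ha with rfl | rfl | rfl <;> simp)],
      fun t h h' => by omega, fun y h _ h' => by simp at h'; omega⟩
    (fun j s' h => (hs.of_sameOff h.1 (by simp [childrenMods])).gval)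
    (fun j hj s' ⟨hoff, hw14, c, hc, ht', hold, hnew, hcov⟩ h13 => by
      have hs' := hs.of_sameOff hoff (by simp [childrenMods])
      have hB' := hB.of_sameOff hoff (by simp [childrenMods])
      have e6 : s' (.work 6) 0 = l := by rw [hoff _ (by simp [childrenMods]), hl]
      have e7 : s' (.work 7) 0 = u := by rw [hoff _ (by simp [childrenMods]), hu]
      have e5 : s' (.work 5) 0 = (i : ℕ) := by rw [hoff _ (by simp [childrenMods]), hi]
      have ev : pieceStart.eval s' = l + j * w := by
        simp only [pieceStart, Expr.eval, e6, h13, hw14]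
      have hjw : 0 ≤ (j : ℤ) * w := mul_nonneg (by positivity) (by omega)
      have hset : ∀ (s'' : State) (t : ℕ),
          stackNode I (s''.set (.work 13) 0 ((j + 1 : ℕ) : ℤ)) t = stackNode I s'' t := by
        intro s'' t
        refine stackNode_congr t fun a ha j _ => ?_
        simp only [List.mem_cons, List.not_mem_nil, or_false] at ha
        rw [State.set_of_ne (by rcases ha with rfl | rfl | rfl <;> simp)]
      -- Pieces beyond `u` are skipped, so each pushed piece starts inside the range, which
      -- `Node.OK.child` requires.
      by_cases hlt : l + j * w ≤ u
      · obtain ⟨s'', hrun, hoff', ht'', hnode, hold'⟩ := runs_push (O := O) hK hs' hB' ht'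
          ((bitLen_natCast_mono (by omega)).trans htK) i e5 ev rfl
          (by rw [abs_le]; constructor <;> omega)
          (by rw [hw14, abs_le]; constructor <;> omega) hBk
        rw [hw14] at hnode
        refine ⟨s'', Runs.branch_pos h4 ?_ hrun, ?_, ?_, ?_, c + 1, by omega, ?_, ?_, ?_, ?_⟩
        · simp only [Expr.eval, e7, ev]; omega
        · rw [hoff' _ (by simp [pushMods]), h13]
        · exact (hoff.trans (hoff'.mono (by simp [pushMods, childrenMods]))).set
            (by simp [childrenMods]) _ _
        · rw [State.set_of_ne (by simp), hoff' _ (by simp [pushMods]), hw14]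
        · rw [State.set_of_ne (by simp), ht'', add_assoc]
        · intro t ht
          rw [hset, hold' t (by omega), hold t ht]
        · intro t h h'
          rw [hset]
          by_cases htc : t < t₀ + c
          · rw [hold' t htc]
            exact hnew t h htc
          · obtain rfl : t = t₀ + c := by omega
            exact ⟨l + j * w, by omega, hlt, hnode⟩
        · intro y hly hyu hy
          by_cases hyj : y < l + j * w
          · obtain ⟨t, h1, h2, a, h3, h4⟩ := hcov y hly hyu hyj
            exact ⟨t, h1, by omega, a, by rw [hset, hold' t h2, h3], h4⟩
          · refine ⟨t₀ + c, by omega, by omega, l + j * w, by rw [hset, hnode], by omega, ?_⟩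
            push_cast at hy
            rw [add_mul, one_mul] at hy
            omega
      · refine ⟨s', (Runs.branch_nonpos h4 ?_ (Runs.skip h4 s')).mono (by omega), h13,
          hoff.set (by simp [childrenMods]) _ _, ?_, c, by omega, ?_, ?_, ?_, ?_⟩
        · simp only [Expr.eval, e7, ev]; omega
        · rw [State.set_of_ne (by simp), hw14]
        · rw [State.set_of_ne (by simp), ht']
        · intro t ht
          rw [hset, hold t ht]
        · intro t h h'
          rw [hset]
          exact hnew t h h'
        · intro y hly hyu hy
          obtain ⟨t, h1, h2, a, h3, h4⟩ := hcov y hly hyu (by omega)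
          exact ⟨t, h1, h2, a, by rw [hset, h3], h4⟩)
  refine ⟨s₂, (r₁.seq r₂).mono ?_, o₂, c, hcG, h1, h2, h3, fun y hy hy' => h5 y hy hy' (by omega)⟩
  rw [show I.k * 12 + 20 + 3 = I.k * 12 + 23 from rfl]
  omega

end ConcaveIQP

namespace ConcaveIQP

open IQP State

variable {O : ILPSolver} {K : ℕ} {I : IQP} {G : ℕ} {ε : ℝ}

/-! ## The number of problems solved below a node -/

/-- A bound for the number of problems solved for a node with `r` unbounded variables. -/
def nodeWeight (G : ℕ) : ℕ → ℕ
  | 0 => 1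
  | r + 1 => 2 * (r + 1) + G * nodeWeight G r

theorem nodeWeight_pos (G r : ℕ) : 0 < nodeWeight G r := by
  cases r <;> simp [nodeWeight]

theorem two_mul_le_nodeWeight (G r : ℕ) : 2 * r ≤ nodeWeight G r := by
  cases r <;> simp [nodeWeight]

/-- The `2 * (r + 1)` range queries are absorbed by `2 * (G + 2) ^ r`, because `r + 1 ≤ 2 ^ r`. -/
theorem nodeWeight_le (G : ℕ) : ∀ r, nodeWeight G r ≤ (G + 2) ^ r
  | 0 => le_rfl
  | r + 1 => by
    have h1 := Nat.mul_le_mul_left G (nodeWeight_le G r)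
    have h2 : r + 1 ≤ 2 ^ r := Nat.lt_two_pow_self
    have h3 : 2 ^ r ≤ (G + 2) ^ r := Nat.pow_le_pow_left (by omega) r
    have h4 : (G + 2) ^ (r + 1) = G * (G + 2) ^ r + 2 * (G + 2) ^ r := by ring
    simp only [nodeWeight]
    omega

/-- The total weight of the lowest `t` nodes on the stack. -/
def stackWeight (I : IQP) (G : ℕ) (s : State) (t : ℕ) : ℕ :=
  ∑ t' ∈ Finset.range t, nodeWeight G ((stackNode I s t').free I.k)

theorem le_stackWeight (I : IQP) (G : ℕ) (s : State) (t : ℕ) : t ≤ stackWeight I G s t := by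
  have := Finset.card_nsmul_le_sum (Finset.range t)
    (fun t' => nodeWeight G ((stackNode I s t').free I.k)) 1 fun t' _ => nodeWeight_pos _ _
  simpa [stackWeight] using this

theorem Found.full {B : I.Node} {s : State} (h : Found B I.k s) (h5 : s (.work 5) 0 = -1) :
    B.Full := by
  rcases h with ⟨-, h⟩ | ⟨i₀, -, -, h, -⟩
  · exact fun i => Option.ne_none_iff_isSome.1 (h i i.2)
  · omega

/-! ## The invariant of the main loop -/

/-- The point in the output arrays is good enough in comparison with `y`. -/
def Covered (I : IQP) (ε : ℝ) (s : State) (y : Fin I.n → ℤ) : Prop :=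
  ∃ z : Fin I.n → ℤ, OutIs z s ∧ ∀ m M : ℤ, (∀ x ∈ I.feasible, m ≤ I.objective x) →
    (∀ x ∈ I.feasible, I.objective x ≤ M) →
    (I.objective z : ℝ) - I.objective y ≤ ε * ((M : ℝ) - m)

theorem Covered.congr {s s' : State} {y : Fin I.n → ℤ} (h : Covered I ε s y)
    (h1 : s' .outStatus = s .outStatus) (h2 : s' .outPoint = s .outPoint)
    (h3 : s' (.work 12) = s (.work 12)) : Covered I ε s' y := by
  obtain ⟨z, hz, h⟩ := h
  exact ⟨z, hz.congr h1 h2 h3, h⟩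

/-- The state between two iterations of the main loop, with `tp` nodes on the stack, and the list
`L` of the problems solved so far. -/
structure Pending (I : IQP) (ε : ℝ) (G T tp : ℕ) (s : State) (L : List ILP) : Prop where
  static : Static I G s
  top : s (.work 1) 0 = tp
  ok : ∀ t < tp, (stackNode I s t).OK G
  out : s .outStatus 0 = 0 ∨ ∃ z : Fin I.n → ℤ, OutIs z s
  cover : ∃ b : ℤ, ∀ y ∈ I.feasible, (∃ t < tp, y ∈ (stackNode I s t).pts) ∨
    (b ≤ I.objective y ∧ Covered I ε s y)
  good : ∀ Q ∈ L, I.GoodQuery Q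
  length : stackWeight I G s tp + L.length ≤ T

/-- The state after the detection of unboundedness. -/
structure Halted (I : IQP) (T : ℕ) (s : State) (L : List ILP) : Prop where
  top : s (.work 1) 0 = 0
  out : s .outStatus 0 = 1
  unbounded : UnboundedBelow I.objective I.feasible
  good : ∀ Q ∈ L, I.GoodQuery Q
  length : L.length ≤ T

/-- The top node is replaced by `c` new ones. Its weight has to pay for the weights of the new nodes
and for the problems solved meanwhile, and its points have to pass to the new nodes or be covered by
the output. -/
theorem Pending.step {T tp : ℕ} {s s' : State} {L L' : List ILP} {c : ℕ}
    (h : Pending I ε G T (tp + 1) s L) (hs : Static I G s')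
    (htop : s' (.work 1) 0 = ((tp + c : ℕ) : ℤ))
    (hold : ∀ t < tp, stackNode I s' t = stackNode I s t)
    (hnew : ∀ t, tp ≤ t → t < tp + c → (stackNode I s' t).OK G)
    (hout : s' .outStatus 0 = 0 ∨ ∃ z : Fin I.n → ℤ, OutIs z s')
    (hcov : ∃ b : ℤ, ∀ y ∈ (stackNode I s tp).pts,
      (∃ t, t < tp + c ∧ y ∈ (stackNode I s' t).pts) ∨ (b ≤ I.objective y ∧ Covered I ε s' y))
    (hmono : ∀ y, Covered I ε s y → Covered I ε s' y)
    (hgood : ∀ Q ∈ L', I.GoodQuery Q)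
    (hw : (∑ t ∈ Finset.range c, nodeWeight G ((stackNode I s' (tp + t)).free I.k)) + L'.length ≤
      nodeWeight G ((stackNode I s tp).free I.k)) :
    Pending I ε G T (tp + c) s' (L ++ L') := by
  refine ⟨hs, htop, fun t ht => ?_, hout, ?_, fun Q hQ => ?_, ?_⟩
  · by_cases h' : t < tp
    · rw [hold t h']
      exact h.ok t (by omega)
    · exact hnew t (by omega) ht
  · obtain ⟨b₁, h₁⟩ := h.cover
    obtain ⟨b₂, h₂⟩ := hcov
    refine ⟨min b₁ b₂, fun y hy => ?_⟩
    rcases h₁ y hy with ⟨t, ht, hyt⟩ | ⟨h3, h4⟩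
    · by_cases h' : t < tp
      · exact .inl ⟨t, by omega, by rwa [hold t h']⟩
      · obtain rfl : t = tp := by omega
        exact (h₂ y hyt).imp_right fun h5 => ⟨(min_le_right _ _).trans h5.1, h5.2⟩
    · exact .inr ⟨(min_le_left _ _).trans h3, hmono y h4⟩
  · rcases List.mem_append.1 hQ with h' | h'
    · exact h.good Q h'
    · exact hgood Q h'
  · have h1 := h.length
    unfold stackWeight at *
    rw [Finset.sum_range_succ] at h1
    rw [Finset.sum_range_add, Finset.sum_congr rfl fun t ht => by
      rw [hold t (Finset.mem_range.1 ht)], List.length_append]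
    omega

theorem Pending.step_weight_lt {tp : ℕ} {s s' : State} {c : ℕ}
    (hold : ∀ t < tp, stackNode I s' t = stackNode I s t)
    (hw : (∑ t ∈ Finset.range c, nodeWeight G ((stackNode I s' (tp + t)).free I.k)) <
      nodeWeight G ((stackNode I s tp).free I.k)) :
    stackWeight I G s' (tp + c) < stackWeight I G s (tp + 1) := by
  unfold stackWeight
  rw [Finset.sum_range_succ, Finset.sum_range_add, Finset.sum_congr rfl fun t ht => by
      rw [hold t (Finset.mem_range.1 ht)]]
  omega

/-! ## Branch nodes and leaves -/

/-- Only the root has no bounds. There the scan has found the ranges of all nonlinear variables,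
which shows that these are bounded and that `W` is not zero; deeper nodes inherit both facts. -/
theorem coordBdd_of_found {g : ℤ} {B : I.Node} (hOK : B.OK g) {i : Fin I.k} {l u : ℤ}
    (hr : B.IsRange (I.idx i) l u)
    (hmin : ∀ i' : Fin I.k, B (I.idx i') = none → ∃ l' u', B.IsRange (I.idx i') l' u') :
    1 ≤ I.Δ ∧ I.CoordBdd := by
  rcases hOK.some with hnone | h
  · constructor
    · obtain ⟨x, hx, hxl⟩ := hr.exists_lo
      refine Δ_pos_of_isOptimal hnone (j := I.idx i) (σ := 1) rfl (x := x) ⟨hx, fun y hy => ?_⟩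
      simp only [one_mul, hxl]
      exact (hr.le y hy).1
    · intro x hx i'
      obtain ⟨l', u', h'⟩ := hmin i' (hnone _)
      exact h'.abs_le hnone hx
  · exact h

/-- If `Δ = 0`, no variable is ever bounded, so a full node exists only for `k = 0`, where the
requirement on `g` is void and `D = 1` serves as the bound. -/
theorem leaf_bound {B : I.Node} (hG : 0 < G) (hε : 0 < ε)
    (hgb : 1 ≤ I.Δ → (I.k : ℝ) * ((2 * (I.n : ℝ) * (I.Δ : ℝ)) ^ 2 + 1 / ε) ≤ (G : ℝ) ^ 2)
    (hOK : B.OK G) (hfull : B.Full) {x y : Fin I.n → ℤ} (hx : x ∈ B.pts) (hy : y ∈ B.pts)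
    (hxy : B.chord ⬝ᵥ x ≤ B.chord ⬝ᵥ y)
    {m M : ℤ} (hm : ∀ z ∈ I.feasible, m ≤ I.objective z) (hM : ∀ z ∈ I.feasible, I.objective z ≤ M) :
    ((I.objective x : ℝ) - I.objective y) ≤ ε * ((M : ℝ) - m) := by
  have hGz : (0 : ℤ) < G := by exact_mod_cast hG
  rcases Nat.eq_zero_or_pos I.Δ with hΔ | hΔ
  · have hk : I.k = 0 := by
      by_contra hk
      rcases hOK.some with h | h
      · have := hfull ⟨0, Nat.pos_of_ne_zero hk⟩
        rw [h] at this
        simp at this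
      · omega
    refine hOK.fine.approx hfull hGz (D := 1) le_rfl (by omega) hε ?_ hx hy hxy hm hM
    rw [hk]
    simp only [Nat.cast_zero, zero_mul]
    positivity
  · refine hOK.fine.approx hfull hGz hΔ le_rfl hε ?_ hx hy hxy hm hM
    simpa using hgb hΔ

theorem objective_ge_of_chord {B : I.Node} (hfull : B.Full) {x : Fin I.n → ℤ}
    (hopt : IsOptimal (fun x => B.chord ⬝ᵥ x) B.pts x) :
    ∀ y ∈ B.pts, B.chord ⬝ᵥ x + (∑ i, I.q i * (B.lo (I.idx i) * B.hi (I.idx i))) ≤ I.objective y := by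
  intro y hy
  have h1 := hopt.2 y hy
  have h2 := Node.err_nonneg hfull hy
  rw [B.objective_eq y]
  simp only at h1
  linarith

/-! ## The main loop -/

/-- Stop if the problem has turned out to be unbounded. -/
def conclude : Prog :=
  .branch (var 10) .skip (.branch (.load .ansStatus (.const 0))
    (.seq (.store .outStatus (.const 0) (.const 1)) (.store (.work 1) (.const 0) (.const 0))) .skip)

theorem runs_conclude (hK : 4 ≤ K) {B : I.Node} {s : State} (h10 : s (.work 10) 0 = 0)
    (h : Failed B s) :
    ∃ s', Runs O K conclude s [] s' 5 ∧ ((s' = s ∧ B.pts = ∅) ∨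
      (UnboundedBelow I.objective I.feasible ∧ s' .outStatus 0 = 1 ∧ s' (.work 1) 0 = 0)) := by
  rcases h with ⟨h1, h2⟩ | ⟨h1, h2⟩
  · exact ⟨s, (Runs.branch_nonpos hK (by simp [Expr.eval, h10]) (Runs.branch_nonpos hK
      (by simp [Expr.eval, h1]) (Runs.skip hK s))).mono (by omega), .inl ⟨rfl, h2⟩⟩
  · have b1 : bitLen 1 ≤ 4 := bitLen_le_four (by simp)
    have b0 : bitLen 0 ≤ 4 := bitLen_le_four (by simp)
    have r₁ := Runs.store (O := O) hK (a := .outStatus) (i := .const 0) (e := .const 1) (s := s)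
      (by simp) (fun A _ => by simp only [Expr.eval]; omega)
    have r₂ := Runs.store (O := O) hK (a := .work 1) (i := .const 0) (e := .const 0)
      (s := s.set .outStatus 0 1) (by simp) (fun A _ => by simp only [Expr.eval]; omega)
    exact ⟨_, (Runs.branch_nonpos hK (by simp [Expr.eval, h10]) (Runs.branch_pos hK
      (by simp [Expr.eval, h1]) (r₁.seq r₂))).mono (by omega), .inr ⟨h2, by
        rw [State.set_of_ne (by simp)]; exact State.set_self_same _ _ _ _,
        State.set_self_same _ _ _ _⟩⟩

def mainBody : Prog :=
  .seq (.store (.work 1) (.const 0) (.sub (var 1) (.const 1)))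
    (.seq loadNode (.seq scan (.seq
      (.branch (var 10) (.branch (.add (var 5) (.const 1)) children leaf) .skip) conclude)))

def bodyCost (I : IQP) (G : ℕ) : ℕ :=
  G * (I.k * 12 + 23) + I.k * (I.n * 8 + 43) + I.n * 12 + I.k * 24 + 80

def mainMods : List Arr :=
  [.work 1, .work 5, .work 6, .work 7, .work 8, .work 9, .work 10, .work 15, .qC, .qLoFlag,
    .qHiFlag, .qLo, .qHi, .ansStatus, .ansPoint]

theorem SameOff.stackNode_eq {l : List Arr} {s s' : State} (h : SameOff l s s')
    (hl : ∀ a ∈ [Arr.work 2, .work 3, .work 4], a ∉ l) (t : ℕ) :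
    stackNode I s' t = stackNode I s t :=
  stackNode_congr t fun a ha _ _ => by rw [h a (hl a ha)]

/-- There are three ways to remove the top node: it is dropped or the run halts after a failure; it
is full and is settled by one query; or it is replaced by its children. Each decreases the weight of
the stack unless the run halts. -/
theorem runs_mainBody (hK : WordLength I G K) (hG : 0 < G) (hε : 0 < ε)
    (hgb : 1 ≤ I.Δ → (I.k : ℝ) * ((2 * (I.n : ℝ) * (I.Δ : ℝ)) ^ 2 + 1 / ε) ≤ (G : ℝ) ^ 2)
    {T tp : ℕ} (hT : bitLen (T : ℤ) ≤ K) {s : State} {L : List ILP}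
    (h : Pending I ε G T (tp + 1) s L) :
    ∃ s' L', Runs O K mainBody s L' s' (bodyCost I G) ∧ (Halted I T s' (L ++ L') ∨
      ∃ tp', Pending I ε G T tp' s' (L ++ L') ∧
        stackWeight I G s' tp' < stackWeight I G s (tp + 1)) := by
  have h4 := hK.four_le
  set B := stackNode I s tp with hBdef
  have hOK : B.OK G := h.ok tp (by omega)
  have hBk : ∀ j : Fin I.n, I.k ≤ (j : ℕ) → B j = none := fun j hj => by
    simp [hBdef, stackNode, hj]
  -- Each stacked node weighs at least one, so the budget `T` also bounds the height of the stack,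
  -- including after the children are pushed; this keeps the stack pointer within the word length.
  have htpT : tp + nodeWeight G (B.free I.k) ≤ T := by
    have h1 := h.length
    have h2 := le_stackWeight I G s tp
    unfold stackWeight at *
    rw [Finset.sum_range_succ, ← hBdef] at h1
    omega
  have hbitT : ∀ z : ℕ, z ≤ T → bitLen (z : ℤ) ≤ K := fun z hz => (bitLen_natCast_mono hz).trans hT
  have ev₁ : (Expr.sub (var 1) (.const 1)).eval s = tp := by
    simp only [Expr.eval, h.top]; push_cast; ring
  have r₁ := Runs.store (O := O) h4 (a := .work 1) (i := .const 0) (e := .sub (var 1) (.const 1))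
    (s := s) (by simp) (fun A _ => by
      rw [ev₁]
      exact (hbitT tp (by omega)).trans (by omega))
  rw [ev₁] at r₁
  simp only [Expr.eval] at r₁
  set s₁ := s.set (.work 1) 0 tp with hs₁
  have o₁ : SameOff mainMods s s₁ := SameOff.set_right _ (by simp [mainMods]) _ _
  have st₁ : Static I G s₁ :=
    h.static.of_sameOff (l := [.work 1]) (SameOff.set_right _ (by simp) _ _)
  have n₁ : ∀ t, stackNode I s₁ t = stackNode I s t := fun t =>
    SameOff.stackNode_eq o₁ (by simp [mainMods]) t
  have w₁ : s₁ (.work 1) 0 = tp := State.set_self_same _ _ _ _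
  obtain ⟨s₂, r₂, o₂, st₂, cur₂⟩ := runs_loadNode (O := O) hK st₁ w₁
  rw [n₁, ← hBdef] at cur₂
  obtain ⟨s₃, L₃, r₃, o₃, g₃, l₃, sc₃⟩ := runs_scan (O := O) hK st₂ cur₂ hOK
  have st₃ := st₂.of_sameOff o₃ (by simp [scanMods])
  have cur₃ := cur₂.of_sameOff o₃ (by simp [scanMods])
  have o₃' : SameOff mainMods s s₃ := (o₁.trans (o₂.mono (by simp [loadMods, mainMods]))).trans
    (o₃.mono (by simp [scanMods, mainMods]))
  have w₃ : s₃ (.work 1) 0 = tp := by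
    rw [o₃ _ (by simp [scanMods]), o₂ _ (by simp [loadMods]), w₁]
  have n₃ : ∀ t, stackNode I s₃ t = stackNode I s t := fun t =>
    SameOff.stackNode_eq o₃' (by simp [mainMods]) t
  have p1 : s₃ .outStatus = s .outStatus := o₃' _ (by simp [mainMods])
  have p2 : s₃ .outPoint = s .outPoint := o₃' _ (by simp [mainMods])
  have p3 : s₃ (.work 12) = s (.work 12) := o₃' _ (by simp [mainMods])
  have hout₃ : s₃ .outStatus 0 = 0 ∨ ∃ z : Fin I.n → ℤ, OutIs z s₃ :=
    h.out.imp (fun h => by rw [p1, h]) fun ⟨z, hz⟩ => ⟨z, hz.congr p1 p2 p3⟩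
  -- the conclusion after a failure
  have hfail : ∀ (s₄ : State) (L₄ : List ILP), s₄ (.work 10) 0 = 0 → Failed B s₄ →
      Static I G s₄ → s₄ (.work 1) 0 = tp → (∀ t, stackNode I s₄ t = stackNode I s t) →
      s₄ .outStatus = s .outStatus → s₄ .outPoint = s .outPoint → s₄ (.work 12) = s (.work 12) →
      (∀ Q ∈ L₄, I.GoodQuery Q) → L₄.length ≤ nodeWeight G (B.free I.k) →
      ∃ s', Runs O K conclude s₄ [] s' 5 ∧ (Halted I T s' (L ++ L₄) ∨
        ∃ tp', Pending I ε G T tp' s' (L ++ L₄) ∧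
          stackWeight I G s' tp' < stackWeight I G s (tp + 1)) := by
    intro s₄ L₄ h10 hf st₄ w₄ n₄ q1 q2 q3 g₄ l₄
    obtain ⟨s', hrun, hs'⟩ := runs_conclude (O := O) h4 h10 hf
    refine ⟨s', hrun, ?_⟩
    rcases hs' with ⟨rfl, hempty⟩ | ⟨hunb, ho, hw⟩
    · refine .inr ⟨tp + 0, ?_, ?_⟩
      · refine h.step st₄ (by rw [w₄]; rfl) (fun t _ => n₄ t) (fun t ht ht' => by omega)
          (h.out.imp (fun h => by rw [q1, h]) fun ⟨z, hz⟩ => ⟨z, hz.congr q1 q2 q3⟩)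
          ⟨0, fun y hy => ?_⟩ (fun y hy => hy.congr q1 q2 q3) g₄ (by simpa using l₄)
        rw [← hBdef, hempty] at hy
        exact absurd hy (Set.notMem_empty y)
      · exact Pending.step_weight_lt (fun t _ => n₄ t) (by simpa using nodeWeight_pos _ _)
    · refine .inl ⟨hw, ho, hunb, fun Q hQ => ?_, ?_⟩
      · rcases List.mem_append.1 hQ with h' | h'
        · exact h.good Q h'
        · exact g₄ Q h'
      · have h1 := h.length
        unfold stackWeight at h1
        rw [Finset.sum_range_succ, ← hBdef] at h1
        rw [List.length_append]
        omega
  have hlen₃ : L₃.length ≤ nodeWeight G (B.free I.k) := l₃.trans (two_mul_le_nodeWeight _ _)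
  rcases sc₃ with ⟨h10, hfound⟩ | ⟨h10, hf⟩
  swap
  · obtain ⟨s', r', hs'⟩ := hfail s₃ L₃ h10 hf st₃ w₃ n₃ p1 p2 p3 g₃ hlen₃
    refine ⟨s', L₃, ?_, hs'⟩
    have := r₁.seq (r₂.seq (r₃.seq ((Runs.branch_nonpos
      (P := .branch (.add (var 5) (.const 1)) children leaf) (Q := .skip) (e := var 10) h4
      (by simp [Expr.eval, h10]) (Runs.skip h4 s₃)).seq r')))
    simp only [List.nil_append, List.append_nil] at this
    exact this.mono (by unfold bodyCost; omega)
  have hskip : ∀ s₄ : State, s₄ (.work 10) 0 = 1 → Runs O K conclude s₄ [] s₄ 2 := fun s₄ h' =>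
    Runs.branch_pos h4 (by simp [Expr.eval, h']) (Runs.skip h4 s₄)
  have hsel := hfound
  rcases hsel with ⟨h5, -⟩ | ⟨i, hik, hinone, h5, hr, hmin⟩
  · have hfull := hfound.full h5
    have hfree : B.free I.k = 0 := by
      classical
      unfold Node.free
      rw [Nat.count_eq_card_filter_range, Finset.card_eq_zero, Finset.filter_eq_empty_iff]
      rintro j - ⟨hj, hn⟩
      have := hfull ⟨j, hj⟩
      rw [hn] at this
      simp at this
    have hL₃ : L₃ = [] := by
      rw [hfree] at l₃
      exact List.eq_nil_of_length_eq_zero (by omega)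
    subst hL₃
    obtain ⟨s₄, r₄, o₄, hs₄⟩ := runs_leaf (O := O) hK st₃ cur₃ hOK hfull hout₃
    have st₄ := st₃.of_sameOff o₄ (by simp [leafMods])
    have w₄ : s₄ (.work 1) 0 = tp := by rw [o₄ _ (by simp [leafMods]), w₃]
    have n₄ : ∀ t, stackNode I s₄ t = stackNode I s t := fun t => by
      rw [SameOff.stackNode_eq o₄ (by simp [leafMods]) t, n₃]
    have hprog : ∀ s' N, Runs O K conclude s₄ [] s' N → N ≤ 5 →
        Runs O K mainBody s [B.ilp B.chord] s' (bodyCost I G) := by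
      intro s' N r' hN
      have := r₁.seq (r₂.seq (r₃.seq ((Runs.branch_pos (Q := .skip) (e := var 10) h4
        (by simp [Expr.eval, h10]) (Runs.branch_nonpos (P := children)
          (e := .add (var 5) (.const 1)) h4
          (by simp [Expr.eval, h5]) r₄)).seq r')))
      simp only [List.nil_append, List.append_nil] at this
      exact this.mono (by unfold bodyCost; omega)
    have hgood : ∀ Q ∈ [B.ilp B.chord], I.GoodQuery Q := by
      intro Q hQ
      rw [List.mem_singleton] at hQ
      rw [hQ]
      exact hOK.goodQuery_chord
    rcases hs₄ with ⟨h10', hf, q1, q2, q3⟩ | ⟨h10', x, hopt, z, hz, hzx, hzold⟩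
    · obtain ⟨s', r', hs'⟩ := hfail s₄ _ h10' hf st₄ w₄ n₄ (q1.trans p1) (q2.trans p2)
        (q3.trans p3) hgood (nodeWeight_pos _ _)
      exact ⟨s', _, hprog s' _ r' le_rfl, hs'⟩
    · refine ⟨s₄, _, hprog s₄ _ (hskip s₄ (by rw [h10', h10])) (by omega), .inr ⟨tp + 0, ?_, ?_⟩⟩
      · refine h.step st₄ (by rw [w₄]; rfl) (fun t _ => n₄ t) (fun t ht ht' => by omega)
          (.inr ⟨z, hz⟩) ⟨_, fun y hy => .inr ⟨objective_ge_of_chord hfull hopt y hy, z, hz, ?_⟩⟩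
          ?_ hgood (by
            simp only [Finset.range_zero, Finset.sum_empty, zero_add]
            exact nodeWeight_pos _ _)
        · intro m M hm hM
          have h1 := leaf_bound hG hε hgb hOK hfull hopt.1 hy (hopt.2 y hy) hm hM
          have h2 : (I.objective z : ℝ) ≤ I.objective x := by exact_mod_cast hzx
          linarith
        · rintro y ⟨z₀, hz₀, h'⟩
          refine ⟨z, hz, fun m M hm hM => ?_⟩
          have h1 := h' m M hm hM
          have h2 : (I.objective z : ℝ) ≤ I.objective z₀ := by
            exact_mod_cast hzold z₀ (hz₀.congr p1 p2 p3)
          linarith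
      · exact Pending.step_weight_lt (fun t _ => n₄ t) (by simpa using nodeWeight_pos _ _)
  · have hmin' : ∀ i' : Fin I.k, B (I.idx i') = none → ∃ l' u', B.IsRange (I.idx i') l' u' ∧
        s₃ (.work 7) 0 - s₃ (.work 6) 0 ≤ u' - l' := fun i' hi' => hmin i' i'.2 hi'
    obtain ⟨hΔ, hcb⟩ := coordBdd_of_found hOK hr fun i' hi' => by
      obtain ⟨l', u', h', -⟩ := hmin' i' hi'
      exact ⟨l', u', h'⟩
    obtain ⟨xl, hxl, hxl'⟩ := hr.exists_lo
    obtain ⟨xu, hxu, hxu'⟩ := hr.exists_hi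
    have hlR := hcb xl hxl.1 i
    have huR := hcb xu hxu.1 i
    have hlu := (hr.le xl hxl).2
    rw [hxl'] at hlR hlu
    rw [hxu'] at huR
    obtain ⟨r, hr'⟩ : ∃ r, B.free I.k = r + 1 := ⟨_, (Node.free_child hinone (0, 0)).symm⟩
    have hfc : ∀ p, (B.child i p).free I.k = r := fun p => by
      have := Node.free_child hinone p
      omega
    have hGr := Nat.mul_le_mul_left G (nodeWeight_pos G r)
    have hw' : nodeWeight G (B.free I.k) = 2 * (r + 1) + G * nodeWeight G r := by
      rw [hr']; rfl
    obtain ⟨s₄, r₄, o₄, c, hcG, w₄, hold, hnew, hcov⟩ := runs_children (O := O) hK hG st₃ cur₃ hBk w₃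
      (hbitT _ (by omega)) i h5 rfl rfl hlu hlR huR
    have hnew' : ∀ t ∈ Finset.range c, nodeWeight G ((stackNode I s₄ (tp + t)).free I.k)
        = nodeWeight G r := by
      intro t ht
      obtain ⟨a, -, -, ha⟩ := hnew (tp + t) (by omega) (by have := Finset.mem_range.1 ht; omega)
      rw [ha, hfc]
    have hsum : (∑ t ∈ Finset.range c, nodeWeight G ((stackNode I s₄ (tp + t)).free I.k))
        ≤ G * nodeWeight G r := by
      rw [Finset.sum_congr rfl hnew', Finset.sum_const, Finset.card_range, smul_eq_mul]
      exact Nat.mul_le_mul_right _ hcG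
    have q1 : s₄ .outStatus = s .outStatus := by rw [o₄ _ (by simp [childrenMods]), p1]
    have q2 : s₄ .outPoint = s .outPoint := by rw [o₄ _ (by simp [childrenMods]), p2]
    have q3 : s₄ (.work 12) = s (.work 12) := by rw [o₄ _ (by simp [childrenMods]), p3]
    have hold' : ∀ t < tp, stackNode I s₄ t = stackNode I s t := fun t ht => by
      rw [hold t ht, n₃]
    refine ⟨s₄, L₃, ?_, .inr ⟨tp + c, ?_, ?_⟩⟩
    · have := r₁.seq (r₂.seq (r₃.seq ((Runs.branch_pos (Q := .skip) (e := var 10) h4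
        (by simp [Expr.eval, h10]) (Runs.branch_pos (Q := leaf)
          (e := .add (var 5) (.const 1)) h4
          (by simp [Expr.eval, h5]) r₄)).seq (hskip s₄ (by
            rw [o₄ _ (by simp [childrenMods]), h10])))))
      simp only [List.nil_append, List.append_nil] at this
      exact this.mono (by unfold bodyCost; omega)
    · refine h.step (st₃.of_sameOff o₄ (by simp [childrenMods])) w₄ hold' (fun t ht ht' => ?_)
        (h.out.imp (fun h => by rw [q1, h]) fun ⟨z, hz⟩ => ⟨z, hz.congr q1 q2 q3⟩)
        ⟨0, fun y hy => .inl ?_⟩ (fun y hy => hy.congr q1 q2 q3) g₃ (by rw [← hBdef]; omega)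
      · obtain ⟨a, hla, hau, ha⟩ := hnew t ht ht'
        rw [ha]
        exact hOK.child (by exact_mod_cast hG) hinone hr hmin' hΔ hcb hla hau
      · obtain ⟨t, -, ht, a, ha, h1, h2⟩ := hcov (y (I.idx i)) (hr.le y hy).1 (hr.le y hy).2
        exact ⟨t, ht, by rw [ha]; exact (Node.mem_pts_child hinone).2 ⟨hy, h1, h2⟩⟩
    · exact Pending.step_weight_lt hold' (by rw [← hBdef]; omega)

def mainLoop : Prog := .loop (var 1) mainBody

/-- With an empty stack every feasible point is covered. The bound `b` shows that the objective is
bounded below, so an optimal solution exists, and coverage of that solution is the approximation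
guarantee. If nothing was ever stored, there is no feasible point. -/
theorem Pending.approxCorrect {T : ℕ} {s : State} {L : List ILP}
    (h : Pending I ε G T 0 s L) : I.ApproxCorrect ε (s.output I.n) := by
  obtain ⟨b, hb⟩ := h.cover
  have hb' : ∀ y ∈ I.feasible, b ≤ I.objective y ∧ Covered I ε s y := fun y hy =>
    (hb y hy).resolve_left (by rintro ⟨t, ht, -⟩; omega)
  rcases h.out with h0 | ⟨z, hz⟩
  · simp only [State.output, h0, if_true, IQP.ApproxCorrect]
    refine Set.eq_empty_of_forall_notMem fun y hy => ?_
    obtain ⟨z, hz, -⟩ := (hb' y hy).2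
    have := hz.1
    omega
  · have hs : s.output I.n = .point z := by
      simp only [State.output, hz.1]
      norm_num
      exact funext hz.2.2.1
    rw [hs]
    obtain ⟨xs, hxs⟩ := exists_isOptimal ⟨z, hz.2.1⟩ b fun y hy => (hb' y hy).1
    refine ⟨hz.2.1, xs, hxs, fun M hM => ?_⟩
    obtain ⟨z', hz', hcov⟩ := (hb' xs hxs.1).2
    have hzz : I.objective z' = I.objective z := by rw [← hz'.2.2.2, ← hz.2.2.2]
    have h1 := hcov (I.objective xs) M hxs.2 fun y hy => hM.2 ⟨y, hy, rfl⟩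
    rw [hzz] at h1
    rcases (hM.2 ⟨xs, hxs.1, rfl⟩ : I.objective xs ≤ M).eq_or_lt with h2 | h2
    · exact .inl h2
    · refine .inr ⟨h2, ?_⟩
      have h3 : (I.objective xs : ℝ) < M := by exact_mod_cast h2
      rw [div_le_iff₀ (by linarith)]
      exact h1

theorem runs_mainLoop (hK : WordLength I G K) (hG : 0 < G) (hε : 0 < ε)
    (hgb : 1 ≤ I.Δ → (I.k : ℝ) * ((2 * (I.n : ℝ) * (I.Δ : ℝ)) ^ 2 + 1 / ε) ≤ (G : ℝ) ^ 2)
    {T tp : ℕ} (hT : bitLen (T : ℤ) ≤ K) {s : State} (h : Pending I ε G T tp s []) :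
    ∃ s' L, Runs O K mainLoop s L s' (T * (bodyCost I G + 1) + 1) ∧ L.length ≤ T ∧
      (∀ Q ∈ L, I.GoodQuery Q) ∧ I.ApproxCorrect ε (s'.output I.n) := by
  obtain ⟨r', s', L, hrun, hP, hend⟩ := Runs.loop_rule (O := O) hK.four_le (e := var 1)
    (body := mainBody) ((by decide : (var 1).Light).cheap hK.four_le) (bodyCost I G)
    (fun r s L => Halted I T s L ∨ ∃ tp, r = stackWeight I G s tp ∧ Pending I ε G T tp s L) (by
      rintro r s L hP hpos
      simp only [Expr.eval] at hpos
      rcases hP with hP | ⟨tp, rfl, hP⟩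
      · rw [hP.top] at hpos
        omega
      · obtain ⟨tp, rfl⟩ : ∃ tp', tp = tp' + 1 := Nat.exists_eq_add_one.2 (by
          rw [hP.top] at hpos; exact_mod_cast hpos)
        obtain ⟨s', L', hrun, hs'⟩ := runs_mainBody (O := O) hK hG hε hgb hT hP
        rcases hs' with hs' | ⟨tp', hs', hlt⟩
        · refine ⟨0, s', L', ?_, hrun, .inl hs'⟩
          have := le_stackWeight I G s (tp + 1)
          omega
        · exact ⟨_, s', L', hlt, hrun, .inr ⟨tp', rfl, hs'⟩⟩)
    (stackWeight I G s tp) s [] (.inr ⟨tp, rfl, h⟩)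
  rw [List.nil_append] at hP
  refine ⟨s', L, hrun.mono (by
    have := Nat.mul_le_mul_right (bodyCost I G + 1) ((Nat.le_add_right _ _).trans h.length)
    omega), ?_⟩
  rcases hP with hP | ⟨tp', -, hP⟩
  · refine ⟨hP.length, hP.good, ?_⟩
    simp only [State.output, hP.out]
    exact hP.unbounded
  · simp only [Expr.eval, hP.top] at hend
    obtain rfl : tp' = 0 := by omega
    exact ⟨by have := hP.length; omega, hP.good, hP.approxCorrect⟩

end ConcaveIQP

namespace ConcaveIQP

open IQP State

variable {O : ILPSolver} {K : ℕ} {I : IQP}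

/-! ## The initial part of the algorithm -/

/-- While the square of the number in `work 0` is less than `k (4 n² Δ² + E)`, increase it. -/
def gridCondition (E : ℕ) : Expr :=
  .sub (.mul (dim 2) (.add (.mul (.mul (.const 4) (.mul (dim 0) (dim 0))) (.mul (dim 3) (dim 3)))
    (.const E))) (.mul (var 0) (var 0))

def gridStep : Prog := .store (.work 0) (.const 0) (.add (var 0) (.const 1))

def setup (E : ℕ) : Prog :=
  .seq (.store .qDim (.const 0) (dim 0)) (.seq (.store .qDim (.const 1) (dim 1))
    (.seq (fill 8 (.mul (dim 0) (dim 1)) .qA (var 8) (.load .inW (var 8)))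
      (.seq (fill 8 (dim 1) .qB (var 8) (.load .inRhs (var 8)))
        (.seq (.store (.work 0) (.const 0) (.const 1))
          (.seq (.branch (.mul (dim 2) (dim 3)) (.loop (gridCondition E) gridStep) .skip)
            (.store (.work 1) (.const 0) (.const 1)))))))

/-- The lower bound for the square of the number of pieces of an interval. -/
def gridTarget (I : IQP) (E : ℕ) : ℕ := I.k * (4 * (I.n * I.n) * (I.Δ * I.Δ) + E)

/-- `G` is the least positive integer whose square is at least `gridTarget I E`; it is `1` if this
number is not needed. -/
structure IsGrid (I : IQP) (E G : ℕ) : Prop where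
  pos : 0 < G
  le : 0 < I.k * I.Δ → gridTarget I E ≤ G * G
  least : G = 1 ∨ (0 < I.k * I.Δ ∧ (G - 1) * (G - 1) < gridTarget I E)

/-- A linear search for the square root, at most `gridTarget I E` steps long. This is affordable
because the target is at most the square of the allowed number of problems plus `k`. -/
theorem runs_gridLoop (hK : 4 ≤ K) {E : ℕ} (hE : bitLen (E : ℤ) ≤ K)
    (hC : bitLen (gridTarget I E : ℤ) ≤ K) {s : State} (hs : s .inDim = I.init .inDim)
    (h0 : s (.work 0) 0 = 1) (hpos : 0 < I.k * I.Δ) :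
    ∃ s' G, Runs O K (.loop (gridCondition E) gridStep) s [] s' (gridTarget I E * 2 + 1) ∧
      SameOff [.work 0] s s' ∧ s' (.work 0) 0 = (G : ℕ) ∧ IsGrid I E G := by
  -- The test is not `Light`: its constant `E` depends on `ε`. It is still cheap, since `E` fits
  -- into a word.
  have hcheap : (gridCondition E).Cheap K := fun A s hA => by
    have hconst : (gridCondition E).ConstLe (K + 4 * A) := by
      have : bitLen 0 ≤ 4 ∧ bitLen 2 ≤ 4 ∧ bitLen 3 ≤ 4 ∧ bitLen 4 ≤ 4 :=
        ⟨bitLen_le_four (by simp), bitLen_le_four (by simp), bitLen_le_four (by simp),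
          bitLen_le_four (by simp)⟩
      simp only [gridCondition, Expr.ConstLe]
      omega
    refine (Expr.cost_le hA _ hconst).trans (Nat.mul_le_mul_right _ ?_)
    simp [gridCondition, Expr.weight, Expr.leaves]
  have hev : ∀ s₁, SameOff [.work 0] s s₁ → ∀ j : ℕ, s₁ (.work 0) 0 = j →
      (gridCondition E).eval s₁ = (gridTarget I E : ℤ) - j * j := by
    intro s₁ h j hj
    simp only [gridCondition, Expr.eval]
    rw [h .inDim (by simp), hs, hj]
    simp [IQP.init, State.entry, gridTarget]
  obtain ⟨r', s', L', hrun, ⟨hL, j, hoff, hj, hj1, hleast, -⟩, hend⟩ :=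
    Runs.loop_rule (O := O) hK hcheap (body := gridStep) 1
    (fun r s₁ L => L = [] ∧ ∃ j : ℕ, SameOff [.work 0] s s₁ ∧ s₁ (.work 0) 0 = j ∧ 0 < j ∧
      (j = 1 ∨ (j - 1) * (j - 1) < gridTarget I E) ∧ r = gridTarget I E - j) (by
      rintro r s₁ L ⟨rfl, j, hoff, hj, hj1, hleast, rfl⟩ hpos
      rw [hev s₁ hoff j hj] at hpos
      have hlt : j * j < gridTarget I E := by
        have : ((j * j : ℕ) : ℤ) < gridTarget I E := by push_cast; omega
        exact_mod_cast this
      have hjle : j ≤ j * j := Nat.le_mul_self j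
      have hval : (Expr.add (var 0) (.const 1)).eval s₁ = ((j + 1 : ℕ) : ℤ) := by
        simp [Expr.eval, hj]
      have hst := Runs.store (O := O) hK (a := .work 0) (i := .const 0)
        (e := .add (var 0) (.const 1)) (s := s₁) (by simp) (fun A _ => by
          rw [hval]
          exact ((bitLen_natCast_mono (by omega)).trans hC).trans (by omega))
      rw [hval] at hst
      exact ⟨_, _, [], by omega, hst, rfl, j + 1, hoff.set (by simp) _ _,
        State.set_self_same _ _ _ _, by omega, .inr (by simpa using hlt), rfl⟩)
    (gridTarget I E - 1) s [] ⟨rfl, 1, SameOff.refl _ _, by simpa using h0, by omega, .inl rfl, rfl⟩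
  rw [List.nil_append] at hL
  subst hL
  refine ⟨s', j, hrun.mono (by omega), hoff, hj, hj1, fun _ => ?_, hleast.imp_right fun h => ⟨hpos, h⟩⟩
  rw [hev s' hoff j hj] at hend
  have : (gridTarget I E : ℤ) ≤ ((j * j : ℕ) : ℤ) := by push_cast; omega
  exact_mod_cast this

theorem init_inW (i : Fin I.m) (j : Fin I.n) :
    I.init .inW ((i : ℕ) * (I.n : ℕ) + (j : ℕ)) = I.W i j := by
  have hlt : (i : ℕ) * I.n + j < I.m * I.n := by
    have h1 : ((i : ℕ) + 1) * I.n ≤ I.m * I.n := Nat.mul_le_mul_right _ i.2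
    have h2 := j.2
    rw [add_mul] at h1
    omega
  have hn : 0 < I.n := j.pos
  have h := State.entry_natCast (fun r : Fin (I.m * I.n) => I.W r.divNat r.modNat)
    ⟨(i : ℕ) * I.n + j, hlt⟩ 0
  push_cast at h
  refine h.trans ?_
  congr 1
  · apply Fin.ext
    simp only [Fin.coe_divNat]
    rw [mul_comm, Nat.mul_add_div hn, Nat.div_eq_of_lt j.2, add_zero]
  · apply Fin.ext
    simp only [Fin.coe_modNat]
    rw [mul_comm, Nat.mul_add_mod, Nat.mod_eq_of_lt j.2]

def setupMods : List Arr := [.qDim, .qA, .qB, .work 0, .work 1, .work 8]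

theorem runs_setup (hK : 4 ≤ K) {E : ℕ} (hn : bitLen (I.n : ℤ) ≤ K) (hm : bitLen (I.m : ℤ) ≤ K)
    (hnm : bitLen ((I.n * I.m : ℕ) : ℤ) ≤ K)
    (hE : 0 < I.k * I.Δ → bitLen (E : ℤ) ≤ K ∧ bitLen (gridTarget I E : ℤ) ≤ K) {N : ℕ}
    (hN : 0 < I.k * I.Δ → gridTarget I E ≤ N) :
    ∃ s' G, Runs O K (setup E) I.init [] s' (I.n * I.m * 4 + I.m * 4 + N * 2 + 20) ∧
      SameOff setupMods I.init s' ∧ Static I (G : ℕ) s' ∧ s' (.work 1) 0 = 1 ∧ IsGrid I E G := by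
  have b1 : bitLen 1 ≤ 4 := bitLen_le_four (by simp)
  have d : ∀ s : State, SameOff setupMods I.init s → (dim 0).eval s = I.n ∧ (dim 1).eval s = I.m ∧
      (Expr.mul (dim 2) (dim 3)).eval s = (I.k * I.Δ : ℕ) ∧
      (Expr.mul (dim 0) (dim 1)).eval s = (I.n * I.m : ℕ) := by
    intro s h
    simp only [Expr.eval]
    rw [h .inDim (by simp [setupMods])]
    simp [IQP.init, State.entry]
  have o₀ : SameOff setupMods I.init I.init := SameOff.refl _ _
  have r₁ := Runs.store (O := O) hK (a := .qDim) (i := .const 0) (e := dim 0) (s := I.init)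
    (by simp) (fun A _ => by rw [(d _ o₀).1]; omega)
  rw [(d _ o₀).1] at r₁
  simp only [Expr.eval] at r₁
  have o₁ := o₀.set (a := .qDim) (by simp [setupMods]) 0 I.n
  have r₂ := Runs.store (O := O) hK (a := .qDim) (i := .const 1) (e := dim 1)
    (s := I.init.set .qDim 0 I.n) (by simp) (fun A _ => by rw [(d _ o₁).2.1]; omega)
  rw [(d _ o₁).2.1] at r₂
  simp only [Expr.eval] at r₂
  have o₂ := o₁.set (a := .qDim) (by simp [setupMods]) 1 I.m
  set s₂ := (I.init.set .qDim 0 I.n).set .qDim 1 I.m with hs₂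
  obtain ⟨s₃, r₃, o₃, v₃, -⟩ := Runs.fill_rule (O := O) hK (c := 8) (bound := .mul (dim 0) (dim 1))
    (a := .qA) (ie := var 8) (e := .load .inW (var 8)) (I.n * I.m) hnm 0
    (fun j => I.init .inW j) s₂ (by simp) (by simp)
    (fun s₁ h => (d _ (o₂.trans (h.mono (by simp [setupMods])))).2.2.2)
    (fun j _ s₁ _ h => by simpa [Expr.eval] using h)
    (fun j _ s₁ h h8 _ => by
      simp only [Expr.eval]
      rw [h8, h .inW (by simp), o₂ .inW (by simp [setupMods])])
    (fun j _ s₁ h _ _ A hA => by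
      rw [← o₂ .inW (by simp [setupMods]), ← h .inW (by simp)]
      exact hA.1 _ _)
  have o₃' := o₂.trans (o₃.mono (l' := setupMods) (by simp [setupMods]))
  obtain ⟨s₄, r₄, o₄, v₄, -⟩ := Runs.fill_rule (O := O) hK (c := 8) (bound := dim 1)
    (a := .qB) (ie := var 8) (e := .load .inRhs (var 8)) I.m hm 0
    (fun j => I.init .inRhs j) s₃ (by simp) (by simp)
    (fun s₁ h => (d _ (o₃'.trans (h.mono (by simp [setupMods])))).2.1)
    (fun j _ s₁ _ h => by simpa [Expr.eval] using h)
    (fun j _ s₁ h h8 _ => by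
      simp only [Expr.eval]
      rw [h8, h .inRhs (by simp), o₃' .inRhs (by simp [setupMods])])
    (fun j _ s₁ h _ _ A hA => by
      rw [← o₃' .inRhs (by simp [setupMods]), ← h .inRhs (by simp)]
      exact hA.1 _ _)
  have o₄' := o₃'.trans (o₄.mono (l' := setupMods) (by simp [setupMods]))
  have r₅ := Runs.store (O := O) hK (a := .work 0) (i := .const 0) (e := .const 1)
    (s := s₄) (by simp) (fun A _ => by simp only [Expr.eval]; omega)
  simp only [Expr.eval] at r₅
  set s₅ := s₄.set (.work 0) 0 1 with hs₅
  have o₅ : SameOff setupMods I.init s₅ := o₄'.set (by simp [setupMods]) _ _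
  have w₅ : s₅ (.work 0) 0 = 1 := State.set_self_same _ _ _ _
  obtain ⟨s₆, G, r₆, o₆, w₆, hG⟩ : ∃ s₆ G, Runs O K
      (.branch (.mul (dim 2) (dim 3)) (.loop (gridCondition E) gridStep) .skip) s₅ [] s₆
        (N * 2 + 2) ∧ SameOff [.work 0] s₅ s₆ ∧ s₆ (.work 0) 0 = (G : ℕ) ∧ IsGrid I E G := by
    -- With `k = 0` or `Δ = 0` the tree consists of its root and `g = 1` will do. Skipping the
    -- search matters for `k = 0`: then the bound on the number of problems is `1`, and `E` is not
    -- controlled by it.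
    rcases Nat.eq_zero_or_pos (I.k * I.Δ) with h | h
    · exact ⟨s₅, 1, (Runs.branch_nonpos hK (by rw [(d _ o₅).2.2.1, h]; rfl)
        (Runs.skip hK s₅)).mono (by omega), SameOff.refl _ _, w₅, one_pos,
        fun h' => by omega, .inl rfl⟩
    · obtain ⟨s₆, G, r₆, h'⟩ := runs_gridLoop (O := O) hK (hE h).1 (hE h).2 (s := s₅)
        (o₅ .inDim (by simp [setupMods])) w₅ h
      refine ⟨s₆, G, (Runs.branch_pos hK (by rw [(d _ o₅).2.2.1]; exact_mod_cast h) r₆).mono ?_, h'⟩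
      have := hN h
      omega
  have o₆' := o₅.trans (o₆.mono (l' := setupMods) (by simp [setupMods]))
  have r₇ := Runs.store (O := O) hK (a := .work 1) (i := .const 0) (e := .const 1)
    (s := s₆) (by simp) (fun A _ => by simp only [Expr.eval]; omega)
  simp only [Expr.eval] at r₇
  have o₇ : SameOff setupMods I.init (s₆.set (.work 1) 0 1) := o₆'.set (by simp [setupMods]) _ _
  have q₇ : (s₆.set (.work 1) 0 1) .qDim = s₂ .qDim := by
    rw [State.set_of_ne (by simp), o₆ _ (by simp), hs₅, State.set_of_ne (by simp),
      o₄ _ (by simp), o₃ _ (by simp)]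
  have qA₇ : (s₆.set (.work 1) 0 1) .qA = s₃ .qA := by
    rw [State.set_of_ne (by simp), o₆ _ (by simp), hs₅, State.set_of_ne (by simp),
      o₄ _ (by simp)]
  have qB₇ : (s₆.set (.work 1) 0 1) .qB = s₄ .qB := by
    rw [State.set_of_ne (by simp), o₆ _ (by simp), hs₅, State.set_of_ne (by simp)]
  refine ⟨_, G, (r₁.seq (r₂.seq (r₃.seq (r₄.seq (r₅.seq (r₆.seq r₇)))))).mono (by omega), o₇,
    ⟨o₇ _ (by simp [setupMods]), o₇ _ (by simp [setupMods]), o₇ _ (by simp [setupMods]), ?_, ?_,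
      fun i j => ?_, fun i => ?_, fun j _ => ?_, fun j _ => ?_, ?_⟩,
    State.set_self_same _ _ _ _, hG⟩
  · rw [q₇, hs₂, State.set_self, if_neg (by norm_num), State.set_self_same]
  · rw [q₇, hs₂, State.set_self_same]
  · have hlt : (i : ℕ) * I.n + j < I.n * I.m := by
      have h1 : ((i : ℕ) + 1) * I.n ≤ I.m * I.n := Nat.mul_le_mul_right _ i.2
      have h2 := j.2
      rw [add_mul, mul_comm I.m] at h1
      omega
    have := v₃ _ hlt
    push_cast at this
    rw [qA₇, ← init_inW, ← this, zero_add]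
  · have := v₄ _ i.2
    rw [qB₇]
    rw [zero_add] at this
    rw [this]
    exact State.entry_natCast _ _ _
  · rw [o₇ _ (by simp [setupMods])]; rfl
  · rw [o₇ _ (by simp [setupMods])]; rfl
  · rw [State.set_of_ne (by simp), w₆]

/-! ## Numerical bounds -/

/-- The exponent is quadratic in the size, which makes the bounds in the queries polynomially long.
-/
theorem coordBound_le : I.coordBound ≤ 2 ^ (2 * I.size * (I.size + 1)) := by
  have hn : I.n ≤ I.size := by unfold IQP.size; omega
  have h1 : (I.n + 1).factorial ≤ (2 ^ I.size) ^ (I.n + 1) := by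
    refine (Nat.factorial_le_pow _).trans (Nat.pow_le_pow_left ?_ _)
    exact (Nat.succ_le_of_lt Nat.lt_two_pow_self).trans (Nat.pow_le_pow_right (by omega) hn)
  calc I.coordBound ≤ (2 ^ I.size) ^ (I.n + 1) * (2 ^ I.size) ^ (I.n + 1) :=
        Nat.mul_le_mul_right _ h1
    _ = 2 ^ (2 * I.size * (I.n + 1)) := by rw [← pow_mul, ← pow_add]; congr 1; ring
    _ ≤ _ := Nat.pow_le_pow_right (by omega) (Nat.mul_le_mul_left _ (by omega))

theorem entryBits_le : I.entryBits ≤ 4 * I.size ^ 2 + 6 * I.size + 10 := by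
  have h : bitLen (3 * I.coordBound : ℤ) ≤ 2 * I.size * (I.size + 1) + 2 + 1 := by
    rw [bitLen_le_iff, pow_add]
    have h1 := coordBound_le (I := I)
    have h2 : 0 < 2 ^ (2 * I.size * (I.size + 1)) := by positivity
    have h3 : (3 * (I.coordBound : ℤ)).natAbs = 3 * I.coordBound := by omega
    rw [h3]
    omega
  unfold IQP.entryBits
  nlinarith

theorem querySize_le : I.querySize ≤ 12 * I.size ^ 3 + 18 * I.size ^ 2 + 33 * I.size := by
  have hn : I.n ≤ I.size := by unfold IQP.size; omega
  have h := entryBits_le (I := I)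
  calc I.querySize ≤ I.size + I.size * (3 * (4 * I.size ^ 2 + 6 * I.size + 10) + 2) := by
        unfold IQP.querySize; gcongr
    _ = _ := by ring

theorem Δ_le_coordBound : I.Δ ≤ I.coordBound := by
  unfold IQP.Δ maxSubdet
  refine Finset.sup_le fun r hr => Finset.sup_le fun p _ => ?_
  have hr' : r + 1 ≤ I.n := by
    rw [Finset.mem_range, Fintype.card_fin, Fintype.card_fin] at hr
    omega
  refine (natAbs_det_le_factorial _ (2 ^ I.size) fun i j =>
    (natAbs_lt_two_pow (bitLen_W_le _ _)).le).trans ?_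
  exact Nat.mul_le_mul (Nat.factorial_le (by omega))
    (Nat.pow_le_pow_right (by positivity) (by omega))

theorem bitLen_init_le (a : Arr) (i : ℤ) : bitLen (I.init a i) ≤ I.entryBits := by
  have h0 : ∀ b : ℤ, b.natAbs ≤ 7 → bitLen b ≤ I.entryBits := fun b hb => by
    have := bitLen_le_four hb
    unfold IQP.entryBits
    omega
  have hz := h0 0 (by simp)
  have hsize : ∀ b : ℤ, bitLen b ≤ I.size + 1 → bitLen b ≤ I.entryBits := fun b hb => by
    unfold IQP.entryBits; omega
  cases a with
  | inDim =>
    refine State.bitLen_entry_le _ _ _ _ (fun j => ?_) hz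
    have hnat : ∀ z : ℕ, z ≤ I.size → bitLen (z : ℤ) ≤ I.entryBits := fun z hz =>
      hsize _ ((bitLen_natCast_le z).trans (by omega))
    fin_cases j
    · exact hnat _ (by unfold IQP.size; omega)
    · exact hnat _ (by unfold IQP.size; omega)
    · exact hnat _ (by unfold IQP.size; omega)
    · have h1 : bitLen (I.Δ : ℤ) ≤ bitLen (3 * I.coordBound : ℤ) := bitLen_le_of_abs (by
        have := Δ_le_coordBound (I := I)
        rw [abs_of_nonneg (by positivity)]
        omega)
      refine h1.trans ?_
      unfold IQP.entryBits
      omega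
  | inW =>
    exact State.bitLen_entry_le _ _ _ _
      (fun j => hsize _ ((bitLen_W_le _ _).trans (Nat.le_succ _))) hz
  | inRhs =>
    exact State.bitLen_entry_le _ _ _ _
      (fun j => hsize _ ((bitLen_w_le _).trans (Nat.le_succ _))) hz
  | inQ =>
    exact State.bitLen_entry_le _ _ _ _
      (fun j => hsize _ ((bitLen_q_le _).trans (Nat.le_succ _))) hz
  | inH =>
    exact State.bitLen_entry_le _ _ _ _
      (fun j => hsize _ ((bitLen_h_le _).trans (Nat.le_succ _))) hz
  | _ => exact hz

/-! ### The number of pieces compared with the bound on the number of problems. -/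

section Grid

variable {ε : ℝ} {G : ℕ}

theorem gridTarget_cast (E : ℕ) : (gridTarget I E : ℝ) =
    (I.k : ℝ) * ((2 * (I.n : ℝ) * (I.Δ : ℝ)) ^ 2 + E) := by
  unfold gridTarget
  push_cast
  ring

/-- Programs contain only integer constants, so `1 / ε` is rounded up; this costs an extra `k` in
the target. -/
theorem le_gridTarget : (I.k : ℝ) * ((2 * (I.n : ℝ) * (I.Δ : ℝ)) ^ 2 + 1 / ε) ≤
    gridTarget I ⌈1 / ε⌉₊ := by
  rw [gridTarget_cast]
  gcongr
  exact Nat.le_ceil _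

theorem gridTarget_le (hε : 0 < ε) : (gridTarget I ⌈1 / ε⌉₊ : ℝ) ≤
    (I.k : ℝ) * ((2 * (I.n : ℝ) * (I.Δ : ℝ)) ^ 2 + 1 / ε) + I.k := by
  rw [gridTarget_cast]
  have h := (Nat.ceil_lt_add_one (a := 1 / ε) (by positivity)).le
  calc _ ≤ (I.k : ℝ) * ((2 * (I.n : ℝ) * (I.Δ : ℝ)) ^ 2 + (1 / ε + 1)) := by gcongr
    _ = _ := by ring

/-- Write `R` for the radicand. Rounding `1 / ε` raises it to at most `R + k`, and `k ≤ 2nΔ` gives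
`k ≤ √R`, so `R + k < (√R + 1)²`. The least integer whose square reaches the target thus exceeds
`⌈√R⌉` by at most one, which with the `2` of `nodeWeight_le` makes the `3` in `ilpBound`. -/
theorem IsGrid.le_ceil (hε : 0 < ε) (hG : IsGrid I ⌈1 / ε⌉₊ G) :
    G ≤ ⌈√((I.k : ℝ) * ((2 * (I.n : ℝ) * (I.Δ : ℝ)) ^ 2 + 1 / ε))⌉₊ + 1 := by
  rcases hG.least with h | ⟨hpos, hlt⟩
  · omega
  set R : ℝ := (I.k : ℝ) * ((2 * (I.n : ℝ) * (I.Δ : ℝ)) ^ 2 + 1 / ε) with hR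
  have hk : (1 : ℝ) ≤ I.k := by exact_mod_cast Nat.pos_of_mul_pos_right hpos
  have hΔ : (1 : ℝ) ≤ I.Δ := by exact_mod_cast Nat.pos_of_mul_pos_left hpos
  have hn : (I.k : ℝ) ≤ I.n := by exact_mod_cast I.k_le_n
  have hε' : 0 < 1 / ε := by positivity
  have hkR : (I.k : ℝ) ≤ √R := by
    refine Real.le_sqrt_of_sq_le ?_
    have h1 : (I.k : ℝ) ≤ 2 * (I.n : ℝ) * I.Δ := by nlinarith
    have h2 : (I.k : ℝ) ^ 2 ≤ (2 * (I.n : ℝ) * I.Δ) ^ 2 := by gcongr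
    calc (I.k : ℝ) ^ 2 ≤ 1 * ((2 * (I.n : ℝ) * I.Δ) ^ 2 + 1 / ε) := by linarith
      _ ≤ R := by rw [hR]; gcongr
  have hR0 : 0 ≤ R := by positivity
  by_contra! hcon
  have h1 : √R + 1 ≤ ((G - 1 : ℕ) : ℝ) := by
    have h2 := Nat.le_ceil √R
    have h3 : ((⌈√R⌉₊ + 1 : ℕ) : ℝ) ≤ ((G - 1 : ℕ) : ℝ) := by exact_mod_cast (by omega)
    push_cast at h3
    linarith
  have h2 : (((G - 1 : ℕ) : ℝ)) * ((G - 1 : ℕ) : ℝ) < gridTarget I ⌈1 / ε⌉₊ := by exact_mod_cast hlt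
  have h3 := gridTarget_le (I := I) hε
  have h4 := Real.sq_sqrt hR0
  have h5 := Real.sqrt_nonneg R
  nlinarith

theorem IsGrid.nodeWeight_le (hε : 0 < ε) (hG : IsGrid I ⌈1 / ε⌉₊ G) :
    nodeWeight G I.k ≤ ilpBound I.n I.k I.Δ ε := by
  refine (ConcaveIQP.nodeWeight_le G I.k).trans (Nat.pow_le_pow_left ?_ _)
  have := hG.le_ceil hε
  omega

theorem IsGrid.le_ilpBound (hε : 0 < ε) (hG : IsGrid I ⌈1 / ε⌉₊ G) :
    G ≤ ilpBound I.n I.k I.Δ ε := by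
  rcases Nat.eq_zero_or_pos I.k with hk | hk
  · have : G = 1 := hG.least.resolve_right (by rw [hk]; simp)
    rw [this]
    exact Nat.pow_pos (by omega)
  · refine le_trans ?_ (Nat.le_self_pow hk.ne' _)
    have := hG.le_ceil hε
    omega

theorem gridTarget_le_ilpBound (hε : 0 < ε) (hpos : 0 < I.k * I.Δ) :
    gridTarget I ⌈1 / ε⌉₊ ≤ ilpBound I.n I.k I.Δ ε ^ 2 + I.k := by
  have hk := Nat.pos_of_mul_pos_right hpos
  set R : ℝ := (I.k : ℝ) * ((2 * (I.n : ℝ) * (I.Δ : ℝ)) ^ 2 + 1 / ε) with hR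
  have hR0 : 0 ≤ R := by positivity
  have h1 : ⌈√R⌉₊ ≤ ilpBound I.n I.k I.Δ ε :=
    le_trans (Nat.le_add_left _ 3) (Nat.le_self_pow hk.ne' _)
  have h2 : √R ≤ ilpBound I.n I.k I.Δ ε := (Nat.le_ceil _).trans (by exact_mod_cast h1)
  have h3 := gridTarget_le (I := I) hε
  have h4 := Real.sq_sqrt hR0
  have h5 : √R ^ 2 ≤ (ilpBound I.n I.k I.Δ ε : ℝ) ^ 2 := by gcongr
  have : (gridTarget I ⌈1 / ε⌉₊ : ℝ) ≤ (ilpBound I.n I.k I.Δ ε : ℝ) ^ 2 + I.k := by linarith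
  exact_mod_cast this

theorem le_gridTarget_of_pos {E : ℕ} (hpos : 0 < I.k * I.Δ) : E ≤ gridTarget I E :=
  le_trans (Nat.le_add_left _ _) (Nat.le_mul_of_pos_left _ (Nat.pos_of_mul_pos_right hpos))

theorem IsGrid.sq_ge (hG : IsGrid I ⌈1 / ε⌉₊ G) (hΔ : 1 ≤ I.Δ) :
    (I.k : ℝ) * ((2 * (I.n : ℝ) * (I.Δ : ℝ)) ^ 2 + 1 / ε) ≤ (G : ℝ) ^ 2 := by
  rcases Nat.eq_zero_or_pos I.k with hk | hk
  · rw [hk]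
    simp only [Nat.cast_zero, zero_mul]
    positivity
  · refine le_gridTarget.trans ?_
    rw [sq]
    exact_mod_cast hG.le (Nat.mul_pos hk hΔ)

end Grid

end ConcaveIQP

/-! ### The complete algorithm and its total cost. -/

namespace ConcaveIQP

open IQP State

variable {O : ILPSolver} {K : ℕ} {I : IQP} {ε : ℝ} {G : ℕ}

/-- The stack arrays are still zero, so their first block is a node without bounds: the root, with
weight `nodeWeight G I.k`. -/
theorem Pending.initial (hε : 0 < ε) (hG : IsGrid I ⌈1 / ε⌉₊ G) {s : State}
    (hs : Static I G s) (ho : SameOff setupMods I.init s) (h1 : s (.work 1) 0 = 1) :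
    Pending I ε G (ilpBound I.n I.k I.Δ ε) 1 s [] := by
  have hroot : ∀ j, stackNode I s 0 j = none := fun j => by
    unfold stackNode
    rw [ho (.work 2) (by simp [setupMods])]
    simp [IQP.init]
  refine ⟨hs, h1, fun t ht => ?_, .inl (by rw [ho _ (by simp [setupMods])]; rfl),
    ⟨0, fun y hy => .inl ⟨0, by omega, by rwa [Node.pts_of_forall_none hroot]⟩⟩, by simp, ?_⟩
  · obtain rfl : t = 0 := by omega
    exact ⟨fun j p h => by rw [hroot] at h; simp at h, .inl fun j p h => by
      rw [hroot] at h; simp at h, .inl hroot⟩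
  · have hfree : (stackNode I s 0).free I.k = I.k := by
      classical
      unfold Node.free
      exact Nat.count_iff_forall.2 fun j hj => ⟨hj, hroot _⟩
    simp only [stackWeight, Finset.sum_range_one, hfree, List.length_nil, add_zero]
    exact hG.nodeWeight_le hε

/-- The algorithm, for `E = ⌈1 / ε⌉`. -/
def algorithm (E : ℕ) : Prog := .seq (setup E) mainLoop

/-- A bound for the word length. -/
noncomputable def wordLength (I : IQP) (ε : ℝ) : ℕ := 100 * (I.size + ilpBound I.n I.k I.Δ ε + 1) ^ 3

theorem wordLength_ge (I : IQP) (ε : ℝ) :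
    12 * I.size ^ 3 + 18 * I.size ^ 2 + 33 * I.size + 20 ≤ wordLength I ε ∧
    (I.size + ilpBound I.n I.k I.Δ ε + 1) ^ 2 ≤ wordLength I ε := by
  unfold wordLength
  set N := ilpBound I.n I.k I.Δ ε
  set X := I.size + N + 1 with hX
  have h1 : 1 ≤ X := by omega
  have h2 : X ≤ X ^ 2 := Nat.le_self_pow (by omega) _
  have h3 : X ^ 2 ≤ X ^ 3 := Nat.pow_le_pow_right h1 (by omega)
  have h4 : I.size ^ 3 ≤ X ^ 3 := Nat.pow_le_pow_left (by omega) _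
  have h5 : I.size ^ 2 ≤ X ^ 2 := Nat.pow_le_pow_left (by omega) _
  omega

theorem wordLength_spec (hε : 0 < ε) (hG : IsGrid I ⌈1 / ε⌉₊ G) :
    WordLength I G (wordLength I ε) := by
  obtain ⟨h1, h2⟩ := wordLength_ge I ε
  have hn : I.n + I.m + I.k ≤ I.size := by unfold IQP.size; omega
  have hN := hG.le_ilpBound hε
  have hent := entryBits_le (I := I)
  have hX : I.size + ilpBound I.n I.k I.Δ ε + 1 ≤ (I.size + ilpBound I.n I.k I.Δ ε + 1) ^ 2 :=
    Nat.le_self_pow (by omega) _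
  have hS : I.size ^ 2 ≤ I.size ^ 3 := by
    rcases Nat.eq_zero_or_pos I.size with h | h
    · simp [h]
    · exact Nat.pow_le_pow_right h (by omega)
  refine ⟨by omega, ?_, ?_, ?_, ?_, by omega, by omega⟩
  · have := bitLen_natCast_le I.n; omega
  · have := bitLen_natCast_le I.k; omega
  · have := querySize_le (I := I); omega
  · have := bitLen_natCast_le G; omega

theorem steps_le (hN : G ≤ ilpBound I.n I.k I.Δ ε) :
    (I.n * I.m * 4 + I.m * 4 + (ilpBound I.n I.k I.Δ ε ^ 2 + I.k) * 2 + 20) +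
      (ilpBound I.n I.k I.Δ ε * (bodyCost I G + 1) + 1) + 1 ≤
      300 * (I.size + ilpBound I.n I.k I.Δ ε + 1) ^ 3 := by
  have hn : I.n + I.m + I.k ≤ I.size := by unfold IQP.size; omega
  set N := ilpBound I.n I.k I.Δ ε
  set X := I.size + N + 1 with hX
  have hn' : I.n ≤ X := by omega
  have hm' : I.m ≤ X := by omega
  have hk' : I.k ≤ X := by omega
  have hN' : N ≤ X := by omega
  have hG' : G ≤ X := by omega
  have h1 : 1 ≤ X := by omega
  have e2 : X * X = X ^ 2 := by ring
  have h2 : X ≤ X ^ 2 := Nat.le_self_pow (by omega) _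
  have h3 : X ^ 2 ≤ X ^ 3 := Nat.pow_le_pow_right h1 (by omega)
  have hb : bodyCost I G + 1 ≤ 203 * X ^ 2 := by
    have k1 : G * (I.k * 12 + 23) ≤ X * (X * 12 + 23) := by gcongr
    have k2 : I.k * (I.n * 8 + 43) ≤ X * (X * 8 + 43) := by gcongr
    unfold bodyCost
    nlinarith
  have k3 : N * (bodyCost I G + 1) ≤ X * (203 * X ^ 2) := Nat.mul_le_mul hN' hb
  have k4 : X * (203 * X ^ 2) = 203 * X ^ 3 := by ring
  have k5 : I.n * I.m ≤ X * X := Nat.mul_le_mul hn' hm'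
  have k6 : N ^ 2 ≤ X ^ 2 := Nat.pow_le_pow_left hN' _
  omega

/-- The polynomial that bounds the running time and the sizes of the queries. -/
noncomputable def costPolynomial : Polynomial ℕ := Polynomial.C 4000000 * (Polynomial.X + 1) ^ 6

theorem costPolynomial_eval (x : ℕ) : costPolynomial.eval x = 4000000 * (x + 1) ^ 6 := by
  simp [costPolynomial]

/-- Units of cost times cost per unit, both cubic: `300 * 100 * (100 + 4)` is below the coefficient
of `costPolynomial`. -/
theorem time_le {S N A t : ℕ}
    (ht : t ≤ 300 * (S + N + 1) ^ 3 * (100 * (100 * (S + N + 1) ^ 3 + 4 * (A + 1)))) :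
    t ≤ costPolynomial.eval (S + N + A) := by
  rw [costPolynomial_eval]
  set X := S + N + A + 1
  have h1 : S + N + 1 ≤ X := by omega
  have h2 : A + 1 ≤ X ^ 3 := le_trans (by omega) (Nat.le_self_pow (n := 3) (by omega) X)
  calc t ≤ _ := ht
    _ ≤ 300 * X ^ 3 * (100 * (100 * X ^ 3 + 4 * X ^ 3)) := by gcongr
    _ = 3120000 * X ^ 6 := by ring
    _ ≤ _ := Nat.mul_le_mul_right _ (by norm_num)

theorem querySize_le_costPolynomial : I.querySize ≤ costPolynomial.eval I.size := by
  rw [costPolynomial_eval]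
  have h := querySize_le (I := I)
  have h1 : I.size ^ 3 ≤ (I.size + 1) ^ 6 :=
    (Nat.pow_le_pow_left (Nat.le_succ _) 3).trans (Nat.pow_le_pow_right (by omega) (by omega))
  have h2 : I.size ^ 2 ≤ (I.size + 1) ^ 6 :=
    (Nat.pow_le_pow_left (Nat.le_succ _) 2).trans (Nat.pow_le_pow_right (by omega) (by omega))
  have h3 : I.size ≤ (I.size + 1) ^ 6 :=
    (Nat.le_succ _).trans (Nat.le_self_pow (by omega) _)
  omega

theorem ILPSolver.small_answersSize (O : ILPSolver) (L : List ILP) :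
    O.Small (O.answersSize L + 1) L := by
  intro Q hQ
  have := List.single_le_sum (l := L.map fun p => (O.answer p).size) (fun _ _ => Nat.zero_le _) _
    (List.mem_map_of_mem hQ)
  unfold ILPSolver.answersSize
  omega

theorem algorithm_spec (hε : 0 < ε) (O : ILPSolver) (I : IQP) :
    ∃ (t : ℕ) (L : List ILP) (s : State),
      Exec O (algorithm ⌈1 / ε⌉₊) I.init t L s ∧
      I.ApproxCorrect ε (s.output I.n) ∧
      L.length ≤ ilpBound I.n I.k I.Δ ε ∧
      t ≤ costPolynomial.eval (I.size + ilpBound I.n I.k I.Δ ε + O.answersSize L) ∧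
      ∀ Q ∈ L, I.GoodQuery Q := by
  obtain ⟨hw1, hw2⟩ := wordLength_ge I ε
  have hn : I.n + I.m + I.k ≤ I.size := by unfold IQP.size; omega
  have hX : (I.size + ilpBound I.n I.k I.Δ ε + 1) ^ 2 = I.size ^ 2 + ilpBound I.n I.k I.Δ ε ^ 2 +
      2 * (I.size * ilpBound I.n I.k I.Δ ε) + 2 * I.size + 2 * ilpBound I.n I.k I.Δ ε + 1 := by
    ring
  have hnm : I.n * I.m ≤ I.size ^ 2 := by
    rw [sq]
    exact Nat.mul_le_mul (by omega) (by omega)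
  obtain ⟨s₁, G, r₁, o₁, st₁, w₁, hG⟩ := runs_setup (O := O) (K := wordLength I ε) (by omega)
    (E := ⌈1 / ε⌉₊) (I := I) ((bitLen_natCast_le _).trans (by omega))
    ((bitLen_natCast_le _).trans (by omega)) ((bitLen_natCast_le _).trans (by omega))
    (fun hpos => by
      have h1 := gridTarget_le_ilpBound hε hpos
      have h2 := le_gridTarget_of_pos (E := ⌈1 / ε⌉₊) hpos
      exact ⟨(bitLen_natCast_le _).trans (by omega), (bitLen_natCast_le _).trans (by omega)⟩)
    (fun hpos => gridTarget_le_ilpBound hε hpos)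
  have hK := wordLength_spec hε hG
  obtain ⟨s₂, L, r₂, hlen, hgood, hcorrect⟩ := runs_mainLoop (O := O) hK hG.pos hε
    hG.sq_ge ((bitLen_natCast_le _).trans (by omega)) (Pending.initial hε hG st₁ o₁ w₁)
  obtain ⟨t, hexec, hcost⟩ := r₁.seq r₂
  rw [List.nil_append] at hexec hcost
  refine ⟨t, L, s₂, hexec, hcorrect, hlen, time_le ?_, hgood⟩
  -- The summand `1` makes room for the zeros that initially fill `ansPoint`, each of length `1`; it
  -- matters when no problem is solved.
  refine (hcost (O.answersSize L + 1) ⟨fun a i => ?_, fun i => ?_⟩ (O.small_answersSize L)).1.trans ?_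
  · exact ((bitLen_init_le a i).trans hK.entry_le).trans (by omega)
  · have : I.init .ansPoint i = 0 := rfl
    rw [this]
    have : bitLen 0 = 1 := by simp [bitLen]
    omega
  · exact Nat.mul_le_mul_right _ (steps_le (hG.le_ilpBound hε))

end ConcaveIQP

theorem theorem1 :
    ∃ p : Polynomial ℕ, ∀ ε : ℝ, 0 < ε → ε ≤ 1 →
      ∃ P : Prog, ∀ (O : ILPSolver) (I : IQP),
        ∃ (t : ℕ) (L : List ILP) (s : State),
          Exec O P I.init t L s ∧
          I.ApproxCorrect ε (s.output I.n) ∧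
          L.length ≤ ilpBound I.n I.k I.Δ ε ∧
          t ≤ p.eval (I.size + ilpBound I.n I.k I.Δ ε + O.answersSize L) ∧
          ∀ Q ∈ L,
            Q.size ≤ p.eval I.size ∧
            Q.n ≤ I.n ∧
            Q.m ≤ I.m ∧
            maxSubdet Q.constraintMatrix ≤ I.Δ := by
  refine ⟨costPolynomial, fun ε hε _ => ⟨algorithm ⌈1 / ε⌉₊, fun O I => ?_⟩⟩
  obtain ⟨t, L, s, h1, h2, h3, h4, h5⟩ := algorithm_spec hε O I
  exact ⟨t, L, s, h1, h2, h3, h4, fun Q hQ =>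
    ⟨(h5 Q hQ).1.trans querySize_le_costPolynomial, (h5 Q hQ).2⟩⟩
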